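/- Let $n\ge 0$, let $\theta=(\theta^{ij})$ be a complex skew-symmetric $n\times n$ matrix, and let $\Sigma$ be a fan in $\mathbb R^n$: a non-empty finite collection of strongly convex cones, each generated by finitely many vectors of $L=\mathbb Z^n$, that contains the faces of its members and in which any two members meet in a common face. The quantum Laurent algebra is the $\mathbb C$-algebra with basis $t^p$, $p\in L^*=\mathbb Z^n$, and product $$t^p\star_\theta t^q=\exp\Big(\tfrac{i}{2}\sum_{i,j}p_i\,\theta^{ij}q_j\Big)\,t^{p+q}.$$ For $\sigma\in\Sigma$ let $\mathbb C_\theta[\sigma]$ be its subalgebra spanned by the $t^m$ with $m\in\sigma^\vee\cap L^*$; thus $\mathbb C_\theta[\sigma]\subseteq\mathbb C_\theta[\tau]$ for $\tau\subseteq\sigma$. The noncommutative toric variety $X_\theta=X_\theta[\Sigma]$ is the site whose open sets $U_\theta[\sigma]$ are the cones $\sigma\in\Sigma$ with inclusions as morphisms, a family $(\sigma_i\hookrightarrow\sigma)$ being a covering if $\sigma=\bigcup_i\sigma_i$, together with the sheaf of algebras $\mathcal O_{X_\theta}:\sigma\mapsto\mathbb C_\theta[\sigma]$. A sheaf $E$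 of right $\mathcal O_{X_\theta}$-modules, with sections $E_\sigma$ over $U_\theta[\sigma]$, is quasi-coherent if $E_\sigma\otimes_{\mathbb C_\theta[\sigma]}\mathbb C_\theta[\tau]\to E_\tau$ is an isomorphism whenever $\tau\subseteq\sigma$ in $\Sigma$; it is coherent if moreover each $E_\sigma$ is finitely generated. Let $\mathsf{coh}(X_\theta)$ denote the category of quasi-coherent sheaves of right $\mathcal O_{X_\theta}$-modules. A closed subscheme of $X_\theta$ is a full subcategory of $\mathsf{coh}(X_\theta)$ that is closed under subobjects (in particular under isomorphisms) and whose inclusion functor has both a left and a right adjoint. An ideal sheaf on $X_\theta$ is a coherent subsheaf $I$ of $\mathcal O_{X_\theta}$ such that $I_\sigma$ is a two-sided ideal of $\mathbb C_\theta[\sigma]$ for every $\sigma\in\Sigma$. **Theorem.** The map that sends $I$ to the full subcategory of $\mathsf{coh}(X_\theta)$ of sheaves of right $\mathcal O_{X_\theta}/I$-modules, i.e. of those $E$ with $E_\sigma I_\sigma=0$ for all $\sigma\in\Sigma$, is a bijection from the set of ideal sheaves $I$ on $X_\theta$ such that $$I_\sigma\star_\theta\mathbb C_\theta[\sigma\cap\sigma']=I_{\sigma'}\star_\theta\mathbb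 C_\theta[\sigma\cap\sigma']\qquad\text{for all }\sigma,\sigma'\in\Sigma$$ onto the class of closed subschemes of $X_\theta$. -/

import Mathlib

open CategoryTheory Opposite
open scoped TensorProduct

noncomputable section

namespace NCToric

/-! ## Cones and fans in `L ⊗ ℝ = ℝⁿ`, for the lattice `L = ℤⁿ` with dual lattice `L^* = ℤⁿ` -/

/-- Cones in `L ⊗ ℝ` with apex at the origin. -/
abbrev Cone (n : ℕ) : Type := PointedCone ℝ (Fin n → ℝ)

/-- The dual cone `σ^∨` of all `m` with `⟨m, u⟩ ≥ 0` for all `u ∈ σ`. -/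
def dualCone {n : ℕ} (σ : Cone n) : Set (Fin n → ℝ) :=
  {m | ∀ u ∈ σ, 0 ≤ m ⬝ᵥ u}

/-- A character `p ∈ L^*`, seen as a vector in `L^* ⊗ ℝ`. -/
def charVec {n : ℕ} (p : Fin n → ℤ) : Fin n → ℝ := fun i => (p i : ℝ)

/-- `σ` is generated by finitely many vectors of the lattice `L`. -/
def IsRationalPolyhedral {n : ℕ} (σ : Cone n) : Prop :=
  ∃ S : Finset (Fin n → ℤ), σ = PointedCone.hull ℝ (charVec '' (S : Set (Fin n → ℤ)))

/-- `σ` contains no line: `σ ∩ (-σ) = 0`. -/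
def IsStronglyConvex {n : ℕ} (σ : Cone n) : Prop :=
  ∀ u, u ∈ σ → -u ∈ σ → u = 0

/-- `τ` is a face of `σ`: it is `σ ∩ m^⊥` for some `m ∈ σ^∨`. -/
def IsFace {n : ℕ} (τ σ : Cone n) : Prop :=
  ∃ m ∈ dualCone σ, ∀ u, u ∈ τ ↔ u ∈ σ ∧ m ⬝ᵥ u = 0

/-- A fan: a non-empty finite collection of strongly convex rational polyhedral cones, closed
under taking faces, in which any two cones meet along a common face. -/
structure Fan (n : ℕ) where
  cones : Set (Cone n)
  nonempty : cones.Nonempty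
  finite : cones.Finite
  rational : ∀ σ ∈ cones, IsRationalPolyhedral σ
  stronglyConvex : ∀ σ ∈ cones, IsStronglyConvex σ
  face_mem : ∀ σ ∈ cones, ∀ τ, IsFace τ σ → τ ∈ cones
  inter_face : ∀ σ ∈ cones, ∀ τ ∈ cones, IsFace (σ ⊓ τ) σ ∧ IsFace (σ ⊓ τ) τ

/-! ## The quantum Laurent algebra and the algebras of the affine charts -/

/-- The factor `exp((i/2) ∑ p_i θ^{ij} q_j)`. -/
def phase {n : ℕ} (θ : Matrix (Fin n) (Fin n) ℂ) (p q : Fin n → ℤ) : ℂ :=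
  Complex.exp (Complex.I / 2 * ∑ i, ∑ j, (p i : ℂ) * θ i j * (q j : ℂ))

lemma phase_add_left {n : ℕ} (θ : Matrix (Fin n) (Fin n) ℂ) (p q r : Fin n → ℤ) :
    phase θ (p + q) r = phase θ p r * phase θ q r := by
  simp only [phase, ← Complex.exp_add, ← mul_add, ← Finset.sum_add_distrib, Pi.add_apply,
    Int.cast_add, add_mul]

lemma phase_add_right {n : ℕ} (θ : Matrix (Fin n) (Fin n) ℂ) (p q r : Fin n → ℤ) :
    phase θ p (q + r) = phase θ p q * phase θ p r := by
  simp only [phase, ← Complex.exp_add, ← mul_add, ← Finset.sum_add_distrib, Pi.add_apply,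
    Int.cast_add]

lemma phase_zero_left {n : ℕ} (θ : Matrix (Fin n) (Fin n) ℂ) (p : Fin n → ℤ) :
    phase θ 0 p = 1 := by simp [phase]

lemma phase_zero_right {n : ℕ} (θ : Matrix (Fin n) (Fin n) ℂ) (p : Fin n → ℤ) :
    phase θ p 0 = 1 := by simp [phase]

/-- The quantum Laurent algebra: the vector space with basis the characters `t^p`, `p ∈ L^*`
(a function `f` stands for `∑ f(p) t^p`). -/
def QuantumLaurent {n : ℕ} (_θ : Matrix (Fin n) (Fin n) ℂ) : Type := (Fin n → ℤ) →₀ ℂ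

namespace QuantumLaurent

variable {n : ℕ} {θ : Matrix (Fin n) (Fin n) ℂ}

instance : AddCommGroup (QuantumLaurent θ) := inferInstanceAs (AddCommGroup ((Fin n → ℤ) →₀ ℂ))

instance : Module ℂ (QuantumLaurent θ) := inferInstanceAs (Module ℂ ((Fin n → ℤ) →₀ ℂ))

/-- The coefficient of `t^p` in `f`. -/
def coeff (f : QuantumLaurent θ) (p : Fin n → ℤ) : ℂ := (show (Fin n → ℤ) →₀ ℂ from f) p

/-- The term `a t^p`. -/
def term (p : Fin n → ℤ) (a : ℂ) : QuantumLaurent θ :=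
  (Finsupp.single p a : (Fin n → ℤ) →₀ ℂ)

/-- The star product: `(a t^p) ⋆ (b t^q) = a b exp((i/2) ∑ p_i θ^{ij} q_j) t^{p+q}`, extended
bilinearly. -/
def mul (f g : QuantumLaurent θ) : QuantumLaurent θ :=
  Finsupp.sum (show (Fin n → ℤ) →₀ ℂ from f) fun p a =>
    Finsupp.sum (show (Fin n → ℤ) →₀ ℂ from g) fun q b =>
      term (p + q) (a * b * phase θ p q)

instance : Mul (QuantumLaurent θ) := ⟨mul⟩

instance : One (QuantumLaurent θ) := ⟨term 0 1⟩

lemma term_add (p : Fin n → ℤ) (a b : ℂ) :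
    (term p (a + b) : QuantumLaurent θ) = term p a + term p b :=
  Finsupp.single_add p a b

lemma term_zero (p : Fin n → ℤ) : (term p 0 : QuantumLaurent θ) = 0 :=
  Finsupp.single_zero p

protected lemma right_distrib (f g h : QuantumLaurent θ) : (f + g) * h = f * h + g * h := by
  change mul (f + g) h = mul f h + mul g h
  unfold mul
  refine Finsupp.sum_add_index' (fun p => ?_) (fun p a b => ?_)
  · simp only [zero_mul, term_zero]; exact Finsupp.sum_fun_zero _
  · simp only [add_mul, term_add]; exact Finsupp.sum_add

protected lemma left_distrib (f g h : QuantumLaurent θ) : f * (g + h) = f * g + f * h := by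
  change mul f (g + h) = mul f g + mul f h
  unfold mul
  refine Eq.trans ?_ (Finsupp.sum_add)
  refine Finsupp.sum_congr fun p _ => ?_
  refine Finsupp.sum_add_index' (fun q => ?_) (fun q a b => ?_)
  · simp only [mul_zero, zero_mul, term_zero]
  · simp only [mul_add, add_mul, term_add]

lemma term_mul_term (p q : Fin n → ℤ) (a b : ℂ) :
    (term p a * term q b : QuantumLaurent θ) = term (p + q) (a * b * phase θ p q) := by
  change mul (term p a) (term q b) = _
  unfold mul
  refine (Finsupp.sum_single_index ?_).trans (Finsupp.sum_single_index ?_)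
  · simp only [zero_mul, term_zero]; exact Finsupp.sum_fun_zero _
  · simp only [mul_zero, zero_mul, term_zero]

protected lemma induction {P : QuantumLaurent θ → Prop} (f : QuantumLaurent θ) (h0 : P 0)
    (hadd : ∀ f g, P f → P g → P (f + g)) (hterm : ∀ p a, P (term p a)) : P f :=
  Finsupp.induction_linear (motive := P) f h0 hadd hterm

protected lemma zero_mul (f : QuantumLaurent θ) : 0 * f = 0 := by
  have h := QuantumLaurent.right_distrib 0 0 f
  rw [add_zero] at h
  exact left_eq_add.mp h

protected lemma mul_zero (f : QuantumLaurent θ) : f * 0 = 0 := by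
  have h := QuantumLaurent.left_distrib f 0 0
  rw [add_zero] at h
  exact left_eq_add.mp h

protected lemma mul_assoc (f g h : QuantumLaurent θ) : f * g * h = f * (g * h) := by
  induction f using QuantumLaurent.induction with
  | h0 => simp only [QuantumLaurent.zero_mul]
  | hadd f f' hf hf' => simp only [QuantumLaurent.right_distrib, hf, hf']
  | hterm p a =>
    induction g using QuantumLaurent.induction with
    | h0 => simp only [QuantumLaurent.zero_mul, QuantumLaurent.mul_zero]
    | hadd g g' hg hg' =>
      simp only [QuantumLaurent.right_distrib, QuantumLaurent.left_distrib, hg, hg']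
    | hterm q b =>
      induction h using QuantumLaurent.induction with
      | h0 => simp only [QuantumLaurent.mul_zero]
      | hadd h h' hh hh' => simp only [QuantumLaurent.left_distrib, hh, hh']
      | hterm r c =>
        simp only [term_mul_term, phase_add_left, phase_add_right, add_assoc]
        congr 1
        ring

protected lemma one_mul (f : QuantumLaurent θ) : 1 * f = f := by
  change term 0 1 * f = f
  induction f using QuantumLaurent.induction with
  | h0 => exact QuantumLaurent.mul_zero _
  | hadd f g hf hg => rw [QuantumLaurent.left_distrib, hf, hg]
  | hterm p a => rw [term_mul_term, phase_zero_left, zero_add, one_mul, mul_one]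

protected lemma mul_one (f : QuantumLaurent θ) : f * 1 = f := by
  change f * term 0 1 = f
  induction f using QuantumLaurent.induction with
  | h0 => exact QuantumLaurent.zero_mul _
  | hadd f g hf hg => rw [QuantumLaurent.right_distrib, hf, hg]
  | hterm p a => rw [term_mul_term, phase_zero_right, add_zero, mul_one, mul_one]

instance : Ring (QuantumLaurent θ) :=
  { (inferInstance : AddCommGroup (QuantumLaurent θ)) with
    mul := (· * ·)
    one := 1
    left_distrib := QuantumLaurent.left_distrib
    right_distrib := QuantumLaurent.right_distrib
    zero_mul := QuantumLaurent.zero_mul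
    mul_zero := QuantumLaurent.mul_zero
    mul_assoc := QuantumLaurent.mul_assoc
    one_mul := QuantumLaurent.one_mul
    mul_one := QuantumLaurent.mul_one }

lemma smul_term (c : ℂ) (p : Fin n → ℤ) (a : ℂ) :
    (c • term p a : QuantumLaurent θ) = term p (c * a) :=
  Finsupp.smul_single' c p a

instance : Algebra ℂ (QuantumLaurent θ) :=
  Algebra.ofModule
    (fun c f g => by
      induction f using QuantumLaurent.induction with
      | h0 => simp
      | hadd f f' hf hf' => simp only [smul_add, add_mul, hf, hf']
      | hterm p a =>
        induction g using QuantumLaurent.induction with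
        | h0 => simp
        | hadd g g' hg hg' => simp only [smul_add, mul_add, hg, hg']
        | hterm q b => simp only [smul_term, term_mul_term]; congr 1; ring)
    (fun c f g => by
      induction f using QuantumLaurent.induction with
      | h0 => simp
      | hadd f f' hf hf' => simp only [smul_add, add_mul, hf, hf']
      | hterm p a =>
        induction g using QuantumLaurent.induction with
        | h0 => simp
        | hadd g g' hg hg' => simp only [smul_add, mul_add, hg, hg']
        | hterm q b => simp only [smul_term, term_mul_term]; congr 1; ring)

end QuantumLaurent

lemma charVec_zero {n : ℕ} : charVec (0 : Fin n → ℤ) = 0 := by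
  ext i; simp [charVec]

lemma charVec_add {n : ℕ} (p q : Fin n → ℤ) : charVec (p + q) = charVec p + charVec q := by
  ext i; simp [charVec]

/-- The subspace spanned by the characters `t^m`, `m ∈ σ^∨ ∩ L^*`. -/
def coordSpace {n : ℕ} (θ : Matrix (Fin n) (Fin n) ℂ) (σ : Cone n) :
    Submodule ℂ (QuantumLaurent θ) :=
  Submodule.span ℂ {f | ∃ m : Fin n → ℤ, charVec m ∈ dualCone σ ∧ f = QuantumLaurent.term m 1}

/-- The algebra `ℂ_θ[σ]` of the affine chart `U_θ[σ]`: the subalgebra of the quantum Laurent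
algebra generated, in fact spanned, by the `t^m` with `m ∈ σ^∨ ∩ L^*`. -/
def chart {n : ℕ} (θ : Matrix (Fin n) (Fin n) ℂ) (σ : Cone n) :
    Subalgebra ℂ (QuantumLaurent θ) :=
  (coordSpace θ σ).toSubalgebra
    (Submodule.subset_span ⟨0, by simp [charVec_zero, dualCone], rfl⟩)
    (fun f g hf hg => by
      induction hf using Submodule.span_induction with
      | zero => simp
      | add f f' _ _ hf hf' => rw [add_mul]; exact Submodule.add_mem _ hf hf'
      | smul c f _ hf => rw [smul_mul_assoc]; exact Submodule.smul_mem _ _ hf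
      | mem f hf =>
        obtain ⟨p, hp, rfl⟩ := hf
        induction hg using Submodule.span_induction with
        | zero => simp
        | add g g' _ _ hg hg' => rw [mul_add]; exact Submodule.add_mem _ hg hg'
        | smul c g _ hg => rw [mul_smul_comm]; exact Submodule.smul_mem _ _ hg
        | mem g hg =>
          obtain ⟨q, hq, rfl⟩ := hg
          rw [QuantumLaurent.term_mul_term, one_mul, one_mul,
            ← mul_one (phase θ p q), ← QuantumLaurent.smul_term]
          refine Submodule.smul_mem _ _ (Submodule.subset_span ⟨p + q, ?_, rfl⟩)
          intro u hu
          rw [charVec_add, add_dotProduct]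
          exact add_nonneg (hp u hu) (hq u hu))

/-- For `τ ⊆ σ` one has `ℂ_θ[σ] ⊆ ℂ_θ[τ]`. -/
lemma chart_anti {n : ℕ} (θ : Matrix (Fin n) (Fin n) ℂ) {τ σ : Cone n} (h : τ ≤ σ) :
    chart θ σ ≤ chart θ τ :=
  Submodule.span_mono (fun _ ⟨m, hm, hf⟩ => ⟨m, fun u hu => hm u (h hu), hf⟩)

/-! ## The site of toric open sets and the structure sheaf -/

/-- The toric open sets of `X_θ[Σ]`, which are the cones of `Σ`, with inclusions as morphisms. -/
abbrev Opens {n : ℕ} (F : Fan n) : Type := {σ : Cone n // σ ∈ F.cones}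

/-- The intersection of two cones of the fan. -/
def Opens.inter {n : ℕ} {F : Fan n} (σ τ : Opens F) : Opens F :=
  ⟨σ.1 ⊓ τ.1, F.face_mem σ.1 σ.2 _ (F.inter_face σ.1 σ.2 τ.1 τ.2).1⟩

lemma Opens.inter_le_left {n : ℕ} {F : Fan n} (σ τ : Opens F) : σ.inter τ ≤ σ :=
  (inf_le_left : σ.1 ⊓ τ.1 ≤ σ.1)

lemma Opens.inter_le_right {n : ℕ} {F : Fan n} (σ τ : Opens F) : σ.inter τ ≤ τ :=
  (inf_le_right : σ.1 ⊓ τ.1 ≤ τ.1)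

/-- The topology on the category of toric open sets: a family of inclusions `σ_i ↪ σ` is
covering if `σ = ⋃ σ_i`. -/
def topology {n : ℕ} (F : Fan n) : GrothendieckTopology (Opens F) where
  sieves σ := {S | ∀ u ∈ σ.1, ∃ (τ : Opens F) (f : τ ⟶ σ), S f ∧ u ∈ τ.1}
  top_mem' σ u hu := ⟨σ, 𝟙 σ, trivial, hu⟩
  pullback_stable' σ ρ S g hS u hu := by
    obtain ⟨τ, f, hf, hu'⟩ := hS u (leOfHom g hu)
    refine ⟨ρ.inter τ, homOfLE (ρ.inter_le_left τ), ?_, ⟨hu, hu'⟩⟩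
    have : homOfLE (ρ.inter_le_left τ) ≫ g = homOfLE (ρ.inter_le_right τ) ≫ f :=
      Subsingleton.elim _ _
    change S _
    rw [this]
    exact S.downward_closed hf _
  transitive' σ S hS R hR u hu := by
    obtain ⟨τ, f, hf, hu'⟩ := hS u hu
    obtain ⟨ρ, g, hg, hu''⟩ := hR hf u hu'
    exact ⟨ρ, g ≫ f, hg, hu''⟩

/-- A cone of a fan is not the union of its proper faces, so that only the trivial sieves cover. -/
lemma topology_eq_bot {n : ℕ} (F : Fan n) : topology F = ⊥ := by
  refine le_bot_iff.mp fun σ S hS => ?_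
  rw [GrothendieckTopology.bot_covering]
  obtain ⟨G, hG⟩ := F.rational σ.1 σ.2
  have hmem : ∀ v ∈ G, charVec v ∈ σ.1 := fun v hv => by
    rw [hG]; exact Submodule.subset_span ⟨v, hv, rfl⟩
  obtain ⟨τ, f, hf, hu⟩ := hS (∑ v ∈ G, charVec v) (Submodule.sum_mem _ hmem)
  have hτσ : τ.1 ≤ σ.1 := leOfHom f
  obtain ⟨⟨m, hm, hface⟩, -⟩ := F.inter_face σ.1 σ.2 τ.1 τ.2
  have h0 := ((hface _).1 ⟨hτσ hu, hu⟩).2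
  rw [dotProduct_sum, Finset.sum_eq_zero_iff_of_nonneg (fun v hv => hm _ (hmem v hv))] at h0
  have hle : σ.1 ≤ τ.1 := by
    conv_lhs => rw [hG]
    refine Submodule.span_le.2 ?_
    rintro _ ⟨v, hv, rfl⟩
    exact ((hface _).2 ⟨hmem v hv, h0 v hv⟩).2
  obtain rfl : τ = σ := Subtype.ext (le_antisymm hτσ hle)
  rw [← Sieve.id_mem_iff_eq_top]
  rwa [Subsingleton.elim f (𝟙 _)] at hf

lemma isSheaf_topology {n : ℕ} (F : Fan n) {A : Type*} [Category A] (P : (Opens F)ᵒᵖ ⥤ A) :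
    Presheaf.IsSheaf (topology F) P := by
  rw [topology_eq_bot]
  exact Presheaf.isSheaf_bot P

/-- The presheaf `σ ↦ ℂ_θ[σ]^op` with the inclusions `ℂ_θ[σ] ⊆ ℂ_θ[τ]` for `τ ⊆ σ` as
restrictions. Left modules over it are right modules over `σ ↦ ℂ_θ[σ]`. -/
def structurePresheaf {n : ℕ} (θ : Matrix (Fin n) (Fin n) ℂ) (F : Fan n) :
    (Opens F)ᵒᵖ ⥤ RingCat.{0} where
  obj X := RingCat.of (chart θ X.unop.1)ᵐᵒᵖ
  map f := RingCat.ofHom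
    (RingHom.op (Subalgebra.inclusion (chart_anti θ (leOfHom f.unop))).toRingHom)

/-- The structure sheaf `𝒪` of `X_θ[Σ]` (with opposite multiplication). -/
abbrev structureSheaf {n : ℕ} (θ : Matrix (Fin n) (Fin n) ℂ) (F : Fan n) :
    Sheaf (topology F) RingCat.{0} :=
  ⟨structurePresheaf θ F, isSheaf_topology F _⟩

/-! ## Quasi-coherent and coherent sheaves of right modules -/

/-- The category `mod(X_θ)` of sheaves of right `𝒪`-modules. -/
abbrev RightMod {n : ℕ} (θ : Matrix (Fin n) (Fin n) ℂ) (F : Fan n) : Type 1 :=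
  SheafOfModules.{0} (structureSheaf θ F)

/-- The right `ℂ_θ[σ]`-module of sections of `E` over `U_θ[σ]`, as a module over the opposite
algebra. -/
abbrev sections {n : ℕ} {θ : Matrix (Fin n) (Fin n) ℂ} {F : Fan n} (E : RightMod θ F)
    (σ : Opens F) : ModuleCat.{0} ((structurePresheaf θ F).obj (op σ)) :=
  E.val.obj (op σ)

/-- The right multiplication `e ↦ e a` by an element `a` of `ℂ_θ[σ]` on sections over `U_θ[σ]`. -/
def rightMul {n : ℕ} {θ : Matrix (Fin n) (Fin n) ℂ} {F : Fan n} (E : RightMod θ F)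
    {σ : Opens F} (a : chart θ σ.1) (e : sections E σ) : sections E σ :=
  (show (structurePresheaf θ F).obj (op σ) from MulOpposite.op a) • e

/-- The restriction of sections of `E` from `U_θ[σ]` to `U_θ[τ]`, for `τ ⊆ σ`. -/
abbrev restrict {n : ℕ} {θ : Matrix (Fin n) (Fin n) ℂ} {F : Fan n} (E : RightMod θ F)
    {τ σ : Opens F} (h : τ ≤ σ) :
    sections E σ →ₛₗ[((structurePresheaf θ F).map (homOfLE h).op).hom] sections E τ :=
  E.val.restrictₛₗ (homOfLE h).op

/-- The canonical map `s ⊗ m ↦ s • g m` for a map `g : M → N` that is semilinear along `f`. -/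
def baseChangeMap {R S M N : Type} [Ring R] [Ring S] [AddCommGroup M] [AddCommGroup N]
    [Module R M] [Module S N] {f : R →+* S} (g : M →ₛₗ[f] N) : S ⊗[ℤ] M →ₗ[ℤ] N :=
  TensorProduct.lift (LinearMap.mk₂ ℤ (fun (s : S) (m : M) => s • g m)
    (fun s s' m => add_smul s s' (g m))
    (fun c s m => smul_assoc c s (g m))
    (fun s m m' => by rw [map_add, smul_add])
    (fun c s m => by rw [map_zsmul, smul_comm]))

lemma baseChangeMap_tmul {R S M N : Type} [Ring R] [Ring S] [AddCommGroup M] [AddCommGroup N]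
    [Module R M] [Module S N] {f : R →+* S} (g : M →ₛₗ[f] N) (s : S) (m : M) :
    baseChangeMap g (s ⊗ₜ[ℤ] m) = s • g m := rfl

/-- `g` exhibits `N` as `S ⊗_R M`: the canonical map from `S ⊗_ℤ M` is onto and its kernel is
generated by the balancing relations `s f(r) ⊗ m - s ⊗ r m`. For `R = A^op` and `S = B^op` this
says that the right `B`-module `N` is `M ⊗_A B`. -/
def IsExtensionOfScalars {R S M N : Type} [Ring R] [Ring S] [AddCommGroup M] [AddCommGroup N]
    [Module R M] [Module S N] {f : R →+* S} (g : M →ₛₗ[f] N) : Prop :=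
  Function.Surjective (baseChangeMap g) ∧
    LinearMap.ker (baseChangeMap g) =
      Submodule.span ℤ {x | ∃ (s : S) (r : R) (m : M), x = (s * f r) ⊗ₜ[ℤ] m - s ⊗ₜ[ℤ] (r • m)}

/-- `E` is quasi-coherent: on each affine open set `U_θ[σ]` it is the sheaf
`τ ↦ M ⊗_{ℂ_θ[σ]} ℂ_θ[τ]` associated to a right `ℂ_θ[σ]`-module `M` (which is then `E(σ)`). -/
def IsQuasiCoherent {n : ℕ} (θ : Matrix (Fin n) (Fin n) ℂ) (F : Fan n) :
    ObjectProperty (RightMod θ F) :=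
  fun E => ∀ (τ σ : Opens F) (h : τ ≤ σ), IsExtensionOfScalars (restrict E h)

/-- The category `coh(X_θ)` of quasi-coherent sheaves of right `𝒪`-modules. -/
abbrev Coh {n : ℕ} (θ : Matrix (Fin n) (Fin n) ℂ) (F : Fan n) : Type 1 :=
  (IsQuasiCoherent θ F).FullSubcategory

/-- `E` is coherent: it is quasi-coherent with finitely generated modules of sections. -/
def IsCoherent {n : ℕ} (θ : Matrix (Fin n) (Fin n) ℂ) (F : Fan n) :
    ObjectProperty (RightMod θ F) :=
  fun E => IsQuasiCoherent θ F E ∧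
    ∀ σ : Opens F, Module.Finite ((structurePresheaf θ F).obj (op σ)) (sections E σ)

/-! ## Closed subschemes -/

/-- A closed subscheme of `X_θ`: a full subcategory of `coh(X_θ)`, closed under subobjects (in
particular under isomorphisms), whose inclusion functor has a left and a right adjoint. -/
structure IsClosedSubscheme {n : ℕ} {θ : Matrix (Fin n) (Fin n) ℂ} {F : Fan n}
    (Y : ObjectProperty (Coh θ F)) : Prop where
  subobjects : Y.IsClosedUnderSubobjects
  exists_rightAdjoint : Y.ι.IsLeftAdjoint
  exists_leftAdjoint : Y.ι.IsRightAdjoint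

/-! ## Ideal sheaves -/

/-- A subsheaf of `𝒪` whose sections over each `U_θ[σ]` form a two-sided ideal of `ℂ_θ[σ]`. -/
@[ext]
structure SubsheafOfIdeals {n : ℕ} (θ : Matrix (Fin n) (Fin n) ℂ) (F : Fan n) where
  ideal : ∀ σ : Opens F, TwoSidedIdeal (chart θ σ.1)
  restrict_mem : ∀ (τ σ : Opens F) (h : τ ≤ σ) (a : chart θ σ.1), a ∈ ideal σ →
    Subalgebra.inclusion (chart_anti θ h) a ∈ ideal τ

namespace SubsheafOfIdeals

variable {n : ℕ} {θ : Matrix (Fin n) (Fin n) ℂ} {F : Fan n} (I : SubsheafOfIdeals θ F)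

/-- `I_σ` as a module over the opposite algebra. -/
def module (X : (Opens F)ᵒᵖ) : Ideal ((structurePresheaf θ F).obj X) :=
  TwoSidedIdeal.asIdealOpposite (I.ideal X.unop)

/-- The restriction map `I_σ → I_τ`. -/
def res {X Y : (Opens F)ᵒᵖ} (f : X ⟶ Y) :
    I.module X →ₛₗ[((structurePresheaf θ F).map f).hom]
      I.module Y where
  toFun a := ⟨((structurePresheaf θ F).map f).hom a.1,
    TwoSidedIdeal.mem_asIdealOpposite.2
      (I.restrict_mem _ _ (leOfHom f.unop) _ (TwoSidedIdeal.mem_asIdealOpposite.1 a.2))⟩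
  map_add' _ _ := Subtype.ext (map_add _ _ _)
  map_smul' _ _ := Subtype.ext (map_mul _ _ _)

/-- The sheaf of right `𝒪`-modules `σ ↦ I_σ`. -/
def sheaf : RightMod θ F where
  val :=
    { obj := fun X => ModuleCat.of ((structurePresheaf θ F).obj X)
        (I.module X)
      map := fun {X Y} f => ModuleCat.ofHom
        (Y := (ModuleCat.restrictScalars ((structurePresheaf θ F).map f).hom).obj
          (ModuleCat.of ((structurePresheaf θ F).obj Y)
            (I.module Y)))
        { toFun := fun a => I.res f a
          map_add' := fun a b => map_add (I.res f) a b
          map_smul' := fun r a => (I.res f).map_smulₛₗ r a }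
      map_id := fun X => by
        ext a
        rfl
      map_comp := fun f g => by
        ext a
        rfl }
  isSheaf := isSheaf_topology F _

end SubsheafOfIdeals

/-- An ideal sheaf on `X_θ`: a coherent sheaf whose restriction to each affine open set
`U_θ[σ]` is a two-sided ideal `I_σ` of `ℂ_θ[σ]`. -/
structure IdealSheaf {n : ℕ} (θ : Matrix (Fin n) (Fin n) ℂ) (F : Fan n) extends
    SubsheafOfIdeals θ F where
  coherent : IsCoherent θ F toSubsheafOfIdeals.sheaf

namespace IdealSheaf

variable {n : ℕ} {θ : Matrix (Fin n) (Fin n) ℂ} {F : Fan n} (I : IdealSheaf θ F)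

/-- The right ideal `I_σ ⋆ ℂ_θ[τ]` of `ℂ_θ[τ]` generated by `I_σ`, for `τ ⊆ σ`. -/
def extend {τ σ : Opens F} (h : τ ≤ σ) : Submodule (chart θ τ.1)ᵐᵒᵖ (chart θ τ.1) :=
  Submodule.span (chart θ τ.1)ᵐᵒᵖ
    (Subalgebra.inclusion (chart_anti θ h) '' {a | a ∈ I.ideal σ})

/-- `I_σ ⋆ ℂ_θ[σ ∩ σ'] = I_σ' ⋆ ℂ_θ[σ ∩ σ']` for all cones `σ`, `σ'` of the fan. -/
def AgreesOnOverlaps : Prop :=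
  ∀ σ σ' : Opens F, I.extend (σ.inter_le_left σ') = I.extend (σ.inter_le_right σ')

/-- The full subcategory of `coh(X_θ)` of the sheaves of right `𝒪/I`-modules, that is, of
those `E` with `E(σ) I_σ = 0` for all `σ`. -/
def subscheme : ObjectProperty (Coh θ F) :=
  fun E => ∀ (σ : Opens F) (e : sections E.obj σ) (a : chart θ σ.1), a ∈ I.ideal σ →
    rightMul E.obj a e = 0

end IdealSheaf

end NCToric

end

/-! A face `τ` of `σ` is cut out by an integral functional (`exists_isCutter`), so the algebra of
`τ` is the localization of the algebra of `σ` at one monomial, `den`. This monomial is normal, since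
monomials commute up to nonzero scalars. Hence quasi-coherence is a statement about fractions
(`isQuasiCoherent_iff`), and kernels, images and quotients can be computed on sections. The charts
are right noetherian (`isNoetherian_chart`), and every section lies in a coherent subsheaf
(`exists_coherent_subsheaf`).

From ideals to subschemes: `E ↦ E/EI` and `E ↦` (largest subsheaf killed by `I`) are the two
adjoints of the inclusion. The ideal is recovered because an element that kills the class of `1` in
`𝒪/I` lies in `I` (`ideal_le_of_subscheme_le`).

From a closed subscheme `Y` to ideals: the left adjoint puts into `Y` every sheaf whose sections are
separated by morphisms to members (`prop_of_separated`), the right adjoint every sheaf generated by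
images of members (`prop_of_generated`). Let `I_σ` be the annihilator (`killing`) of the modules
`E_σ` whose direct image from `U[σ]` is in `Y`. Separation shows that the direct image of `A_σ/I_σ`
is in `Y`, where `A_σ` is the chart algebra, and generation then shows that a direct image from
`U[σ]` is in `Y` exactly when `I_σ` kills its module (`prop_direct_iff`). Comparing direct images
from `τ ⊆ σ` gives `I_τ = I_σ A_τ` (`mem_killing_iff`), so the `I_σ` form an ideal sheaf that agrees
on overlaps. A sheaf killed by `I` is separated by its maps to direct images, hence is in `Y`.

The hard part is that every member `E` of `Y` is killed by `I`, although its direct images are not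
known to be in `Y`. If not, noetherianity yields a coherent counterexample all of whose proper
quotients are killed, with a minimal cone `τ` over which it is not killed
(`exists_isMinimalUnkilled`). Then every nonzero submodule of `E_ρ` contains `E_ρ I_ρ`, and `E`
vanishes on proper faces of `τ`. For `ρ ⊇ τ`, monomials that are not invertible over `τ` kill `E_ρ
I_ρ`, the others act on it surjectively, and `E_ρ I_ρ` is simple under the latter
(`eq_bot_or_eq_top`). With homogeneous generators `a_i` of `I_τ`, the tuples `(x a_i)` for `x ∈ E_ρ`
form a subgroup of `(E_ρ I_ρ)^r` stable under diagonal operators. Simplicity makes it divisible by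
the denominator (`exists_eq_diagonal_of_mem`). It follows that `E_τ` is the image of `E_ρ` plus the
part killed by `I_τ` (`exists_sub_res_act_eq_zero`). So the direct image of `E` from `U[τ]` is
generated by `E` and by a killed direct image. It is therefore in `Y`, and `I_τ` kills `E_τ`, a
contradiction (`not_isClosedSubscheme`). -/

noncomputable section

namespace NCToric

variable {n : ℕ} {θ : Matrix (Fin n) (Fin n) ℂ} {F : Fan n}

/-! ## Sections of sheaves of right modules -/

/-- The inclusion `ℂ_θ[σ] ⊆ ℂ_θ[τ]` for `τ ⊆ σ`. -/
abbrev incl {τ σ : Opens F} (h : τ ≤ σ) : chart θ σ.1 →ₐ[ℂ] chart θ τ.1 :=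
  Subalgebra.inclusion (chart_anti θ h)

lemma incl_injective {τ σ : Opens F} (h : τ ≤ σ) : Function.Injective (incl (θ := θ) h) :=
  Subalgebra.inclusion_injective _

lemma incl_incl {κ τ σ : Opens F} (h : τ ≤ σ) (h' : κ ≤ τ) (a : chart θ σ.1) :
    incl h' (incl h a) = incl (h'.trans h) a := Subalgebra.inclusion_inclusion _ _ _

lemma incl_refl {σ : Opens F} (a : chart θ σ.1) : incl (le_refl σ) a = a :=
  Subtype.ext rfl

instance sectionsModule (E : RightMod θ F) (σ : Opens F) : Module (chart θ σ.1)ᵐᵒᵖ (sections E σ) :=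
  inferInstanceAs (Module ((structurePresheaf θ F).obj (op σ)) (sections E σ))

/-- The right action of the coordinate algebra on sections. -/
def act {M : Type} {σ : Opens F} [AddCommGroup M] [Module (chart θ σ.1)ᵐᵒᵖ M]
    (e : M) (a : chart θ σ.1) : M := MulOpposite.op a • e

/-- The right action of the coordinate algebra on sections. -/
infixl:73 " ◃ " => act

lemma rightMul_eq_act {E : RightMod θ F} {σ : Opens F} (e : sections E σ) (a : chart θ σ.1) :
    rightMul E a e = e ◃ a := rfl

section act

variable {σ : Opens F} {M : Type} [AddCommGroup M] [Module (chart θ σ.1)ᵐᵒᵖ M]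

lemma act_mul (e : M) (a b : chart θ σ.1) : e ◃ (a * b) = e ◃ a ◃ b := by
  simp only [act, MulOpposite.op_mul, mul_smul]

lemma act_one (e : M) : e ◃ (1 : chart θ σ.1) = e := by
  simp only [act, MulOpposite.op_one, one_smul]

lemma act_add (e : M) (a b : chart θ σ.1) : e ◃ (a + b) = e ◃ a + e ◃ b := by
  simp only [act, MulOpposite.op_add, add_smul]

lemma act_zero (e : M) : e ◃ (0 : chart θ σ.1) = 0 := by
  simp only [act, MulOpposite.op_zero, zero_smul]

lemma add_act (e e' : M) (a : chart θ σ.1) : (e + e') ◃ a = e ◃ a + e' ◃ a := by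
  simp only [act, smul_add]

lemma sub_act (e e' : M) (a : chart θ σ.1) : (e - e') ◃ a = e ◃ a - e' ◃ a := by
  simp only [act, smul_sub]

lemma zero_act (a : chart θ σ.1) : (0 : M) ◃ a = 0 := by
  simp only [act, smul_zero]

lemma neg_act (e : M) (a : chart θ σ.1) : (-e) ◃ a = -(e ◃ a) := by
  simp only [act, smul_neg]

lemma act_mem {N : Submodule (chart θ σ.1)ᵐᵒᵖ M} {e : M} (he : e ∈ N) (a : chart θ σ.1) :
    e ◃ a ∈ N := N.smul_mem _ he

lemma map_act {M' : Type} [AddCommGroup M'] [Module (chart θ σ.1)ᵐᵒᵖ M']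
    (f : M →ₗ[(chart θ σ.1)ᵐᵒᵖ] M') (e : M) (a : chart θ σ.1) : f (e ◃ a) = f e ◃ a :=
  f.map_smul _ _

end act

/-- The restriction of sections, as an additive map. -/
def res {E : RightMod θ F} {τ σ : Opens F} (h : τ ≤ σ) : sections E σ →+ sections E τ :=
  (restrict E h).toAddMonoidHom

section res

variable {E : RightMod θ F} {σ : Opens F}

lemma res_act {τ : Opens F} (h : τ ≤ σ) (e : sections E σ) (a : chart θ σ.1) :
    res h (e ◃ a) = res h e ◃ incl h a :=
  (restrict E h).map_smulₛₗ _ _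

lemma res_res {κ τ : Opens F} (h : τ ≤ σ) (h' : κ ≤ τ) (e : sections E σ) :
    res h' (res h e) = res (h'.trans h) e :=
  (PresheafOfModules.map_comp_apply E.val (homOfLE h).op (homOfLE h').op e).symm.trans
    (PresheafOfModules.congr_map_apply E.val (Subsingleton.elim _ _) e)

lemma res_refl (e : sections E σ) : res (le_refl σ) e = e := by
  refine (PresheafOfModules.congr_map_apply E.val
    (Subsingleton.elim (homOfLE (le_refl σ)).op (𝟙 (op σ))) e).trans ?_
  rw [E.val.map_id]
  rfl

end res

/-! ## Construction of sheaves and morphisms -/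

/-- Data that amount to a sheaf of right modules. -/
structure SheafData (θ : Matrix (Fin n) (Fin n) ℂ) (F : Fan n) where
  carrier : Opens F → Type
  [group : ∀ σ, AddCommGroup (carrier σ)]
  [module : ∀ σ, Module (chart θ σ.1)ᵐᵒᵖ (carrier σ)]
  res : ∀ {τ σ : Opens F} (_ : τ ≤ σ), carrier σ →+ carrier τ
  res_act : ∀ {τ σ : Opens F} (h : τ ≤ σ) (x : carrier σ) (a : chart θ σ.1),
    res h (x ◃ a) = res h x ◃ incl h a
  res_refl : ∀ (σ : Opens F) (x : carrier σ), res (le_refl σ) x = x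
  res_trans : ∀ {κ τ σ : Opens F} (h : τ ≤ σ) (h' : κ ≤ τ) (x : carrier σ),
    res h' (res h x) = res (h'.trans h) x

namespace SheafData

attribute [instance] group module

/-- The presheaf of abelian groups given by `SheafData`. -/
def presheaf (D : SheafData θ F) : (Opens F)ᵒᵖ ⥤ Ab.{0} where
  obj X := AddCommGrpCat.of (D.carrier X.unop)
  map f := AddCommGrpCat.ofHom (D.res (leOfHom f.unop))
  map_id X := AddCommGrpCat.hom_ext (AddMonoidHom.ext (D.res_refl X.unop))
  map_comp f g := AddCommGrpCat.hom_ext (AddMonoidHom.ext fun x =>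
    (D.res_trans (leOfHom f.unop) (leOfHom g.unop) x).symm)

instance moduleObj (D : SheafData θ F) (X : (Opens F)ᵒᵖ) :
    Module ((structurePresheaf θ F).obj X) (D.presheaf.obj X) :=
  inferInstanceAs (Module (chart θ X.unop.1)ᵐᵒᵖ (D.carrier X.unop))

/-- The sheaf of right modules given by `SheafData`. -/
def sheaf (D : SheafData θ F) : RightMod θ F where
  val := PresheafOfModules.ofPresheaf D.presheaf
    (fun _ _ f r x => D.res_act (leOfHom f.unop) x r.unop)
  isSheaf := isSheaf_topology F _

end SheafData

/-- The map on sections of a morphism of sheaves. -/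
def onSections {E E' : Coh θ F} (f : E ⟶ E') (σ : Opens F) :
    sections E.obj σ →ₗ[(chart θ σ.1)ᵐᵒᵖ] sections E'.obj σ :=
  (f.hom.val.app (op σ)).hom

lemma onSections_res {E E' : Coh θ F} (f : E ⟶ E') {τ σ : Opens F} (h : τ ≤ σ)
    (e : sections E.obj σ) :
    onSections f τ (res h e) = res h (onSections f σ e) :=
  PresheafOfModules.naturality_apply f.hom.val (homOfLE h).op e

lemma onSections_comp {E E' E'' : Coh θ F} (f : E ⟶ E') (g : E' ⟶ E'') (σ : Opens F)
    (e : sections E.obj σ) : onSections (f ≫ g) σ e = onSections g σ (onSections f σ e) := rfl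

lemma hom_ext_sections {E E' : Coh θ F} {f g : E ⟶ E'}
    (h : ∀ σ e, onSections f σ e = onSections g σ e) : f = g := by
  apply ObjectProperty.hom_ext
  apply SheafOfModules.hom_ext
  apply PresheafOfModules.hom_ext
  intro X
  apply ModuleCat.hom_ext
  apply LinearMap.ext
  exact h X.unop

/-- A morphism given by compatible maps on sections. -/
def homOfSections {E E' : Coh θ F}
    (f : ∀ σ : Opens F, sections E.obj σ →ₗ[(chart θ σ.1)ᵐᵒᵖ] sections E'.obj σ)
    (hf : ∀ {τ σ : Opens F} (h : τ ≤ σ) (e : sections E.obj σ),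
      f τ (res h e) = res h (f σ e)) : E ⟶ E' :=
  ObjectProperty.homMk
    { val :=
        { app := fun X => ModuleCat.ofHom (f X.unop)
          naturality := fun g => ModuleCat.hom_ext (LinearMap.ext (hf (leOfHom g.unop))) } }

/-- A linear map given by an additive map that commutes with the right action. -/
def linearOfAct {σ : Opens F} {M M' : Type} [AddCommGroup M] [Module (chart θ σ.1)ᵐᵒᵖ M]
    [AddCommGroup M'] [Module (chart θ σ.1)ᵐᵒᵖ M'] (f : M →+ M')
    (hf : ∀ e (a : chart θ σ.1), f (e ◃ a) = f e ◃ a) : M →ₗ[(chart θ σ.1)ᵐᵒᵖ] M' :=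
  { f with map_smul' := fun r e => hf e r.unop }

end NCToric

namespace NCToric

/-! ## Integral supporting functionals of faces -/

/-- In coordinates for a rational basis of `W`, the inclusion into `ℝ` is a real vector at which
finitely many strict rational inequalities hold. These define an open set, and rational vectors are
dense. -/
lemma exists_rational_functional (W : Submodule ℚ ℝ) [FiniteDimensional ℚ W] (T : Finset W)
    (hT : ∀ w ∈ T, 0 < (w : ℝ)) : ∃ φ : W →ₗ[ℚ] ℚ, ∀ w ∈ T, 0 < φ w := by
  set b := Module.finBasis ℚ W
  have hw : ∀ w : W, (w : ℝ) = ∑ k, (b.repr w k : ℝ) * (b k : ℝ) := fun w => by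
    have h := congrArg Subtype.val (b.sum_repr w)
    refine h.symm.trans ?_
    simp only [Submodule.coe_sum, Submodule.coe_smul, Rat.smul_def]
  set U : Set (Fin (Module.finrank ℚ W) → ℝ) :=
    ⋂ w ∈ T, {x | 0 < ∑ k, (b.repr w k : ℝ) * x k} with hU
  have hUo : IsOpen U := by
    refine isOpen_biInter_finset fun w _ => ?_
    exact isOpen_lt continuous_const (by fun_prop)
  have hUn : U.Nonempty := ⟨fun k => (b k : ℝ), by
    simp only [hU, Set.mem_iInter, Set.mem_ofPred_eq]
    intro w hwT
    rw [← hw w]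
    exact hT w hwT⟩
  have hd : DenseRange (fun (q : Fin (Module.finrank ℚ W) → ℚ) k => (q k : ℝ)) :=
    DenseRange.piMap (fun _ => Rat.denseRange_cast)
  obtain ⟨q, hq⟩ := hd.exists_mem_open hUo hUn
  simp only [hU, Set.mem_iInter, Set.mem_ofPred_eq] at hq
  refine ⟨b.constr ℚ q, fun w hwT => ?_⟩
  have h := hq w hwT
  rw [Module.Basis.constr_apply_fintype (S := ℚ)]
  simp only [smul_eq_mul, Module.Basis.equivFun_apply]
  exact_mod_cast h

variable {n : ℕ}

lemma charVec_dotProduct_charVec (p q : Fin n → ℤ) :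
    charVec p ⬝ᵥ charVec q = ((p ⬝ᵥ q : ℤ) : ℝ) := by
  simp [charVec, dotProduct]

/-- A real functional that is nonnegative on finitely many lattice vectors can be replaced by an
integral one with the same zeros among them. -/
lemma exists_integral_functional (m : Fin n → ℝ) (G : Finset (Fin n → ℤ))
    (hm : ∀ v ∈ G, 0 ≤ m ⬝ᵥ charVec v) :
    ∃ p : Fin n → ℤ, ∀ v ∈ G, 0 ≤ p ⬝ᵥ v ∧ (p ⬝ᵥ v = 0 ↔ m ⬝ᵥ charVec v = 0) := by
  classical
  -- All values of `m` on lattice vectors lie in this finite-dimensional rational space. A rational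
  -- functional that is positive on the finitely many positive values, scaled by a common
  -- denominator, keeps both zeros and signs.
  set W : Submodule ℚ ℝ := Submodule.span ℚ (Set.range m)
  have hmW : ∀ i, m i ∈ W := fun i => Submodule.subset_span ⟨i, rfl⟩
  have : FiniteDimensional ℚ W := FiniteDimensional.span_of_finite ℚ (Set.finite_range m)
  set ev : (Fin n → ℤ) → W := fun v => ∑ i, (v i : ℚ) • ⟨m i, hmW i⟩
  have hev : ∀ v, ((ev v : W) : ℝ) = m ⬝ᵥ charVec v := fun v => by
    simp [ev, dotProduct, charVec, Rat.smul_def, mul_comm]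
  obtain ⟨φ, hφ⟩ := exists_rational_functional W
    ((G.image ev).filter fun w => 0 < (w : ℝ)) (fun w hw => (Finset.mem_filter.1 hw).2)
  set N : ℕ := ∏ i, (φ ⟨m i, hmW i⟩).den
  have hN : 0 < N := Finset.prod_pos fun i _ => (φ ⟨m i, hmW i⟩).den_pos
  have hint : ∀ i, ∃ z : ℤ, (z : ℚ) = N * φ ⟨m i, hmW i⟩ := fun i => by
    obtain ⟨c, hc⟩ : (φ ⟨m i, hmW i⟩).den ∣ N := Finset.dvd_prod_of_mem _ (Finset.mem_univ i)
    refine ⟨c * (φ ⟨m i, hmW i⟩).num, ?_⟩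
    rw [hc]
    push_cast
    rw [mul_comm ((φ ⟨m i, hmW i⟩).den : ℚ), mul_assoc, Rat.den_mul_eq_num]
  choose p hp using hint
  have key : ∀ v, ((p ⬝ᵥ v : ℤ) : ℚ) = N * φ (ev v) := fun v => by
    simp only [ev, dotProduct, map_sum, map_smul, smul_eq_mul, Finset.mul_sum, Int.cast_sum,
      Int.cast_mul, hp]
    exact Finset.sum_congr rfl fun i _ => by ring
  refine ⟨p, fun v hv => ?_⟩
  rcases (hm v hv).eq_or_lt with h0 | h0
  · have : ev v = 0 := Subtype.ext ((hev v).trans h0.symm)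
    have h1 := key v
    rw [this, map_zero, mul_zero] at h1
    have h2 : p ⬝ᵥ v = 0 := by exact_mod_cast h1
    simp [h2, ← h0]
  · have h1 : 0 < φ (ev v) := hφ _ (Finset.mem_filter.2
      ⟨Finset.mem_image_of_mem _ hv, by rw [hev]; exact h0⟩)
    have h2 : 0 < ((p ⬝ᵥ v : ℤ) : ℚ) := by
      rw [key]; exact mul_pos (by exact_mod_cast hN) h1
    have h3 : 0 < p ⬝ᵥ v := by exact_mod_cast h2
    exact ⟨h3.le, ⟨fun h => absurd h h3.ne', fun h => absurd h h0.ne'⟩⟩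

lemma mem_dualCone_hull {G : Finset (Fin n → ℤ)} {m : Fin n → ℝ}
    (h : ∀ v ∈ G, 0 ≤ m ⬝ᵥ charVec v) :
    m ∈ dualCone (PointedCone.hull ℝ (charVec '' (G : Set (Fin n → ℤ)))) := by
  intro u hu
  induction hu using Submodule.span_induction with
  | mem u hu => obtain ⟨v, hv, rfl⟩ := hu; exact h v hv
  | zero => simp
  | add u v _ _ hu hv => rw [dotProduct_add]; exact add_nonneg hu hv
  | smul c u _ hu =>
    rw [show c • u = (c : ℝ) • u from rfl, dotProduct_smul, smul_eq_mul]
    exact mul_nonneg c.2 hu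

lemma dualCone_anti {σ τ : Cone n} (h : τ ≤ σ) {m : Fin n → ℝ} (hm : m ∈ dualCone σ) :
    m ∈ dualCone τ := fun u hu => hm u (h hu)

/-- `m` is an integral functional that is nonnegative on `σ` and cuts out the face `τ`. -/
structure IsCutter (m : Fin n → ℤ) (τ σ : Cone n) : Prop where
  mem_dual : charVec m ∈ dualCone σ
  mem_iff : ∀ u, u ∈ τ ↔ u ∈ σ ∧ charVec m ⬝ᵥ u = 0

/-- Two functionals that are nonnegative on the generators and vanish on the same generators cut out
the same face, so the real functional defining the face may be replaced by an integral one. -/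
lemma exists_isCutter {σ τ : Cone n} (hσ : IsRationalPolyhedral σ) (h : IsFace τ σ) :
    ∃ m : Fin n → ℤ, IsCutter m τ σ := by
  obtain ⟨G, rfl⟩ := hσ
  obtain ⟨m, hm, hf⟩ := h
  have hmem : ∀ v ∈ G, charVec v ∈ PointedCone.hull ℝ (charVec '' (G : Set (Fin n → ℤ))) :=
    fun v hv => Submodule.subset_span ⟨v, hv, rfl⟩
  obtain ⟨p, hp⟩ := exists_integral_functional m G fun v hv => hm _ (hmem v hv)
  have hp' : ∀ v ∈ G, 0 ≤ charVec p ⬝ᵥ charVec v := fun v hv => by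
    rw [charVec_dotProduct_charVec]; exact_mod_cast (hp v hv).1
  have hz : ∀ v ∈ G, charVec p ⬝ᵥ charVec v = 0 ↔ m ⬝ᵥ charVec v = 0 := fun v hv => by
    rw [charVec_dotProduct_charVec, ← (hp v hv).2]; norm_cast
  have bound : ∀ a b : Fin n → ℝ, (∀ v ∈ G, 0 ≤ a ⬝ᵥ charVec v) → (∀ v ∈ G, 0 ≤ b ⬝ᵥ charVec v) →
      (∀ v ∈ G, b ⬝ᵥ charVec v = 0 → a ⬝ᵥ charVec v = 0) →
      ∀ u ∈ PointedCone.hull ℝ (charVec '' (G : Set (Fin n → ℤ))), b ⬝ᵥ u = 0 →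
        a ⬝ᵥ u ≤ 0 := by
    intro a b ha hb hab u hu hbu
    -- The sum `C` of the ratios `a·v / b·v` bounds each of them, so `C b - a` is nonnegative on the
    -- cone. Generators with `b·v = 0` contribute `0` to `C`, and there `a` vanishes too.
    have := mem_dualCone_hull (G := G)
      (m := (∑ v ∈ G, (a ⬝ᵥ charVec v) / (b ⬝ᵥ charVec v)) • b - a) (fun v hv => by
        rw [sub_dotProduct, smul_dotProduct, smul_eq_mul, sub_nonneg]
        rcases (hb v hv).eq_or_lt with h0 | h0
        · rw [← h0, hab v hv h0.symm, mul_zero]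
        · rw [← div_le_iff₀ h0]
          exact Finset.single_le_sum (f := fun v => (a ⬝ᵥ charVec v) / (b ⬝ᵥ charVec v))
            (fun w hw => div_nonneg (ha w hw) (hb w hw)) hv) u hu
    rw [sub_dotProduct, smul_dotProduct, hbu, smul_zero] at this
    linarith
  refine ⟨p, mem_dualCone_hull hp', fun u => (hf u).trans (and_congr_right fun hu => ?_)⟩
  constructor
  · intro h
    exact le_antisymm (bound _ _ hp' (fun v hv => hm _ (hmem v hv)) (fun v hv => (hz v hv).2) u hu h)
      (mem_dualCone_hull hp' u hu)
  · intro h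
    exact le_antisymm (bound _ _ (fun v hv => hm _ (hmem v hv)) hp' (fun v hv => (hz v hv).1) u hu h)
      (hm u hu)

/-- Adding a multiple of a cutter of `τ` moves a functional on `κ ∩ τ` into the dual of `κ`. -/
lemma IsCutter.exists_add_mem {m p : Fin n → ℤ} {κ τ σ : Cone n} (h : IsCutter m τ σ)
    (hκ : IsRationalPolyhedral κ) (hle : κ ≤ σ) (hp : charVec p ∈ dualCone (κ ⊓ τ)) :
    ∃ k₀ : ℕ, ∀ k, k₀ ≤ k → charVec (p + k • m) ∈ dualCone κ := by
  obtain ⟨G, rfl⟩ := hκ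
  have hmem : ∀ v ∈ G, charVec v ∈ PointedCone.hull ℝ (charVec '' (G : Set (Fin n → ℤ))) :=
    fun v hv => Submodule.subset_span ⟨v, hv, rfl⟩
  -- On a generator with `m·v ≥ 1`, this many copies of `m` outweigh `p·v`. A generator with `m·v =
  -- 0` lies in `τ`, where `p` is already nonnegative.
  refine ⟨∑ v ∈ G, (p ⬝ᵥ v).natAbs, fun k hk => mem_dualCone_hull fun v hv => ?_⟩
  rw [charVec_dotProduct_charVec, add_dotProduct, smul_dotProduct]
  have hm0 : 0 ≤ m ⬝ᵥ v := by
    have := h.mem_dual _ (hle (hmem v hv))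
    rw [charVec_dotProduct_charVec] at this
    exact_mod_cast this
  rcases hm0.eq_or_lt with h0 | h0
  · have : charVec v ∈ τ := (h.mem_iff _).2 ⟨hle (hmem v hv), by
      rw [charVec_dotProduct_charVec, ← h0, Int.cast_zero]⟩
    have := hp _ ⟨hmem v hv, this⟩
    rw [charVec_dotProduct_charVec] at this
    rw [← h0, smul_zero, add_zero]
    exact this
  · have h1 : (p ⬝ᵥ v).natAbs ≤ k := le_trans (Finset.single_le_sum
      (f := fun v => (p ⬝ᵥ v).natAbs) (fun _ _ => Nat.zero_le _) hv) hk
    have h2 : (k : ℤ) ≤ k • (m ⬝ᵥ v) := by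
      rw [nsmul_eq_mul]; nlinarith
    have h3 : 0 ≤ p ⬝ᵥ v + k • (m ⬝ᵥ v) := by omega
    exact_mod_cast h3

lemma isRationalPolyhedral_of_mem {F : Fan n} (σ : Opens F) : IsRationalPolyhedral σ.1 :=
  F.rational σ.1 σ.2

lemma isFace_of_le {F : Fan n} {τ σ : Opens F} (h : τ ≤ σ) : IsFace τ.1 σ.1 := by
  have := (F.inter_face σ.1 σ.2 τ.1 τ.2).1
  rwa [inf_eq_right.2 (show τ.1 ≤ σ.1 from h)] at this

/-- The face of a cone of the fan cut out by an integral functional. -/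
lemma exists_face {F : Fan n} (σ : Opens F) {m : Fin n → ℤ} (hm : charVec m ∈ dualCone σ.1) :
    ∃ τ : Opens F, τ ≤ σ ∧ IsCutter m τ.1 σ.1 := by
  let τ : Cone n :=
    { carrier := {u | u ∈ σ.1 ∧ charVec m ⬝ᵥ u = 0}
      add_mem' := fun {u v} hu hv => ⟨add_mem hu.1 hv.1, by rw [dotProduct_add, hu.2, hv.2, add_zero]⟩
      zero_mem' := ⟨zero_mem _, dotProduct_zero _⟩
      smul_mem' := fun c u hu => ⟨Submodule.smul_mem σ.1 c hu.1, by
        rw [show c • u = (c : ℝ) • u from rfl, dotProduct_smul, hu.2, smul_zero]⟩ }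
  exact ⟨⟨τ, F.face_mem σ.1 σ.2 τ ⟨charVec m, hm, fun u => Iff.rfl⟩⟩, fun u hu => hu.1,
    ⟨hm, fun u => Iff.rfl⟩⟩

end NCToric

namespace NCToric

/-! ## Chains of leading terms: a noetherian criterion -/

/-- Dickson's lemma: the minimal values of `Φ` on `S` form an antichain in `ι → ℕ`, hence a finite
set, and `T` picks one preimage of each. -/
lemma exists_finite_lower_basis {ι Γ : Type*} [Finite ι] (Φ : Γ → ι → ℕ) (S : Set Γ) :
    ∃ T : Set Γ, T.Finite ∧ T ⊆ S ∧ ∀ g ∈ S, ∃ t ∈ T, Φ t ≤ Φ g := by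
  set M : Set (ι → ℕ) := {x | Minimal (· ∈ Φ '' S) x}
  have hM : M.Finite := WellQuasiOrderedLE.finite_of_isAntichain
    (setOfPred_minimal_antichain _)
  have hpre : ∀ x ∈ M, ∃ t ∈ S, Φ t = x := fun x hx => hx.prop
  choose f hfS hf using hpre
  have := hM.to_subtype
  refine ⟨Set.range fun x : M => f x x.2, Set.finite_range _, ?_, fun g hg => ?_⟩
  · rintro _ ⟨x, rfl⟩
    exact hfS x x.2
  · obtain ⟨x, hxg, hx⟩ := exists_minimal_le_of_wellFoundedLT (· ∈ Φ '' S) (Φ g) ⟨g, hg, rfl⟩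
    exact ⟨f x hx, ⟨⟨x, hx⟩, rfl⟩, (hf x hx).le.trans hxg⟩

/-- A module spanned by elements indexed by a well-ordered set is noetherian if leading terms can be
reduced by finitely many others. -/
lemma isNoetherian_of_leading_terms {k A M Γ ι : Type*} [Field k] [Ring A] [Algebra k A]
    [AddCommGroup M] [Module A M] [Module k M] [IsScalarTower k A M] [LinearOrder Γ]
    [WellFoundedLT Γ] [Finite ι] (Φ : Γ → ι → ℕ) (b : Γ → M)
    (hb : Submodule.span k (Set.range b) = ⊤)
    (hstep : ∀ g h, Φ g ≤ Φ h → ∃ r : A, r • b g - b h ∈ Submodule.span k (b '' Set.Iio h) ∧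
      ∀ x < g, r • b x ∈ Submodule.span k (b '' Set.Iio h)) :
    IsNoetherian A M := by
  classical
  refine ⟨fun J => ?_⟩
  -- The leading indices of `J`. The family `b` need not be independent, so an index may qualify
  -- merely because `b g` is a combination of lower elements; the reduction below is indifferent to
  -- this.
  set L : Set Γ := {g | ∃ f ∈ J, f - b g ∈ Submodule.span k (b '' Set.Iio g)}
  obtain ⟨T, hTf, hTL, hT⟩ := exists_finite_lower_basis Φ L
  choose! w hwJ hw using (fun g (hg : g ∈ T) => hTL hg)
  have hk : ∀ {N : Submodule A M} (c : k) {x : M}, x ∈ N → c • x ∈ N := fun {N} c x hx => by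
    rw [← algebraMap_smul A c x]; exact N.smul_mem _ hx
  set J' : Submodule A M := Submodule.span A (w '' T)
  have hJ'J : J' ≤ J := Submodule.span_le.2 (by rintro _ ⟨t, ht, rfl⟩; exact hwJ t ht)
  suffices hJ : J ≤ J' by
    rw [le_antisymm hJ hJ'J]
    exact Submodule.fg_span (hTf.image w)
  -- A combination of elements below `g` involves finitely many of them, so it is bounded by some
  -- index strictly below `g`, to which the induction hypothesis applies.
  have lt_of_mem : ∀ g : Γ, (∀ h < g, ∀ f ∈ J, f ∈ Submodule.span k (b '' Set.Iic h) → f ∈ J') →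
      ∀ f ∈ J, f ∈ Submodule.span k (b '' Set.Iio g) → f ∈ J' := by
    intro g ih f hfJ hf
    obtain ⟨s, hs, hfs⟩ := Submodule.mem_span_image_iff_exists_fun k |>.1 hf
    obtain ⟨c, rfl⟩ := hfs
    rcases s.eq_empty_or_nonempty with rfl | hne
    · simp
    · refine ih (s.max' hne) (hs (s.max'_mem hne)) _ hfJ (Submodule.sum_mem _ fun i hi =>
        Submodule.smul_mem _ _ (Submodule.subset_span ⟨i, s.le_max' i.1 i.2, rfl⟩))
  have main : ∀ g : Γ, ∀ f ∈ J, f ∈ Submodule.span k (b '' Set.Iic g) → f ∈ J' := by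
    intro g
    induction g using WellFoundedLT.induction with
    | ind g ih =>
      intro f hfJ hf
      rw [← Set.Iio_insert, Set.image_insert_eq, Submodule.mem_span_insert] at hf
      obtain ⟨c, z, hz, rfl⟩ := hf
      by_cases hc : c = 0
      · refine lt_of_mem g ih _ hfJ ?_
        rwa [hc, zero_smul, zero_add]
      · have hgL : g ∈ L := by
          refine ⟨c⁻¹ • (c • b g + z), hk _ hfJ, ?_⟩
          rw [smul_add, inv_smul_smul₀ hc, add_sub_cancel_left]
          exact Submodule.smul_mem _ _ hz
        -- A multiple of the chosen element with leading index `t` has the same leading term as `b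
        -- g`; subtracting it lowers the leading index of `f`.
        obtain ⟨t, htT, hΦ⟩ := hT g hgL
        obtain ⟨r, hr, hr'⟩ := hstep t g hΦ
        have h1 : r • w t - b g ∈ Submodule.span k (b '' Set.Iio g) := by
          have h2 : r • (w t - b t) ∈ Submodule.span k (b '' Set.Iio g) := by
            obtain ⟨s, hs, d, hd⟩ := Submodule.mem_span_image_iff_exists_fun k |>.1 (hw t htT)
            rw [← hd, Finset.smul_sum]
            refine Submodule.sum_mem _ fun i _ => ?_
            rw [← algebraMap_smul A (d i), ← mul_smul, ← Algebra.commutes, mul_smul,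
              algebraMap_smul]
            exact Submodule.smul_mem _ _ (hr' _ (hs i.2))
          have h3 := Submodule.add_mem _ h2 hr
          rwa [smul_sub, sub_add_sub_cancel] at h3
        have hrw : r • w t ∈ J' := J'.smul_mem _ (Submodule.subset_span ⟨t, htT, rfl⟩)
        have h4 : c • b g + z - c • (r • w t) ∈ J' := by
          refine lt_of_mem g ih _ (J.sub_mem hfJ (hk c (hJ'J hrw))) ?_
          have : c • b g + z - c • (r • w t) = z - c • (r • w t - b g) := by
            rw [smul_sub]; abel
          rw [this]
          exact Submodule.sub_mem _ hz (Submodule.smul_mem _ _ h1)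
        have h5 := J'.add_mem h4 (hk c hrw)
        rwa [sub_add_cancel] at h5
  intro f hf
  have hft : f ∈ Submodule.span k (b '' Set.univ) := by rw [Set.image_univ, hb]; trivial
  obtain ⟨s, -, c, rfl⟩ := Submodule.mem_span_image_iff_exists_fun k |>.1 hft
  rcases s.eq_empty_or_nonempty with rfl | hne
  · simp
  · exact main (s.max' hne) _ hf (Submodule.sum_mem _ fun i _ =>
      Submodule.smul_mem _ _ (Submodule.subset_span ⟨i, s.le_max' i.1 i.2, rfl⟩))

end NCToric

/-! ### The chart algebras: normality of monomials, localization at faces, finiteness -/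

namespace NCToric

variable {n : ℕ} {θ : Matrix (Fin n) (Fin n) ℂ} {F : Fan n}

/-! ## Monomials -/

lemma phase_ne_zero (p q : Fin n → ℤ) : phase θ p q ≠ 0 := Complex.exp_ne_zero _

lemma phase_neg_comm (p : Fin n → ℤ) : phase θ (-p) p = phase θ p (-p) := by
  have h1 := phase_add_left θ p (-p) p
  have h2 := phase_add_right θ p p (-p)
  rw [add_neg_cancel, phase_zero_left] at h1
  rw [add_neg_cancel, phase_zero_right] at h2
  exact mul_left_cancel₀ (phase_ne_zero p p) (h1.symm.trans h2)

open QuantumLaurent in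
lemma exists_term_pow (m : Fin n → ℤ) (k : ℕ) :
    ∃ c : ℂ, c ≠ 0 ∧ (term m 1 : QuantumLaurent θ) ^ k = term (k • m) c := by
  induction k with
  | zero => exact ⟨1, one_ne_zero, by rw [pow_zero, zero_smul]; rfl⟩
  | succ k ih =>
    obtain ⟨c, hc, h⟩ := ih
    exact ⟨c * 1 * phase θ (k • m) m, mul_ne_zero (by simpa using hc) (phase_ne_zero _ _), by
      rw [pow_succ, h, term_mul_term, succ_nsmul]⟩

lemma term_mem_chart {σ : Cone n} {m : Fin n → ℤ} (hm : charVec m ∈ dualCone σ) (c : ℂ) :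
    (QuantumLaurent.term m c : QuantumLaurent θ) ∈ chart θ σ := by
  rw [← mul_one c, ← QuantumLaurent.smul_term]
  exact Submodule.smul_mem (coordSpace θ σ) _ (Submodule.subset_span ⟨m, hm, rfl⟩)

@[elab_as_elim]
lemma chart_induction {σ : Cone n} {P : QuantumLaurent θ → Prop} {f : QuantumLaurent θ}
    (hf : f ∈ chart θ σ) (hterm : ∀ m, charVec m ∈ dualCone σ → ∀ c, P (QuantumLaurent.term m c))
    (hadd : ∀ f g, P f → P g → P (f + g)) : P f := by
  have h0 : P 0 := by
    rw [← QuantumLaurent.term_zero 0]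
    exact hterm 0 (by simp [charVec_zero, dualCone]) 0
  suffices h : ∀ c : ℂ, P (c • f) by simpa using h 1
  change f ∈ coordSpace θ σ at hf
  induction hf using Submodule.span_induction with
  | mem f hf =>
    obtain ⟨m, hm, rfl⟩ := hf
    intro c
    rw [QuantumLaurent.smul_term]
    exact hterm m hm _
  | zero => intro c; rwa [smul_zero]
  | add f g _ _ hf hg => intro c; rw [smul_add]; exact hadd _ _ (hf c) (hg c)
  | smul a f _ hf => intro c; rw [smul_smul]; exact hf _

/-- The monomial `t^m`, for `m ∈ σ^∨`. -/
def mon (σ : Opens F) (m : Fin n → ℤ) (hm : charVec m ∈ dualCone σ.1) : chart θ σ.1 :=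
  ⟨QuantumLaurent.term m 1, term_mem_chart hm 1⟩

lemma incl_mon {τ σ : Opens F} (h : τ ≤ σ) {m : Fin n → ℤ} (hm : charVec m ∈ dualCone σ.1) :
    incl h (mon (θ := θ) σ m hm) = mon τ m (dualCone_anti h hm) := rfl

lemma isUnit_mon {σ : Opens F} {m : Fin n → ℤ} (hm : charVec m ∈ dualCone σ.1)
    (hm' : charVec (-m) ∈ dualCone σ.1) : IsUnit (mon (θ := θ) σ m hm) := by
  refine ⟨⟨mon σ m hm, ⟨QuantumLaurent.term (-m) (phase θ m (-m))⁻¹, term_mem_chart hm' _⟩,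
    Subtype.ext ?_, Subtype.ext ?_⟩, rfl⟩
  · change (QuantumLaurent.term m 1 * QuantumLaurent.term (-m) _ : QuantumLaurent θ) = 
      QuantumLaurent.term 0 1
    rw [QuantumLaurent.term_mul_term, add_neg_cancel, one_mul,
      inv_mul_cancel₀ (phase_ne_zero _ _)]
  · change (QuantumLaurent.term (-m) _ * QuantumLaurent.term m 1 : QuantumLaurent θ) = 
      QuantumLaurent.term 0 1
    rw [QuantumLaurent.term_mul_term, neg_add_cancel, mul_one, phase_neg_comm,
      inv_mul_cancel₀ (phase_ne_zero _ _)]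

/-- Moving `t^m` across a monomial only multiplies by a nonzero phase, so the exponents of `a` do
not change and stay in the dual cone, whatever `m` is. -/
lemma exists_mul_term_eq {σ : Cone n} (m : Fin n → ℤ) {a : QuantumLaurent θ} (ha : a ∈ chart θ σ) :
    ∃ b ∈ chart θ σ, a * QuantumLaurent.term m 1 = QuantumLaurent.term m 1 * b := by
  refine chart_induction ha (fun p hp c => ?_) (fun f g hf hg => ?_)
  · refine ⟨QuantumLaurent.term p (c * phase θ p m / phase θ m p), term_mem_chart hp _, ?_⟩
    rw [QuantumLaurent.term_mul_term, QuantumLaurent.term_mul_term, add_comm]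
    congr 1
    field_simp [phase_ne_zero m p]
  · obtain ⟨b, hb, h⟩ := hf
    obtain ⟨b', hb', h'⟩ := hg
    exact ⟨b + b', add_mem hb hb', by rw [add_mul, mul_add, h, h']⟩

lemma exists_term_mul_eq {σ : Cone n} (m : Fin n → ℤ) {a : QuantumLaurent θ} (ha : a ∈ chart θ σ) :
    ∃ b ∈ chart θ σ, QuantumLaurent.term m 1 * a = b * QuantumLaurent.term m 1 := by
  refine chart_induction ha (fun p hp c => ?_) (fun f g hf hg => ?_)
  · refine ⟨QuantumLaurent.term p (c * phase θ m p / phase θ p m), term_mem_chart hp _, ?_⟩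
    rw [QuantumLaurent.term_mul_term, QuantumLaurent.term_mul_term, add_comm]
    congr 1
    field_simp [phase_ne_zero p m]
  · obtain ⟨b, hb, h⟩ := hf
    obtain ⟨b', hb', h'⟩ := hg
    exact ⟨b + b', add_mem hb hb', by rw [add_mul, mul_add, h, h']⟩

lemma mon_mul_mon {σ : Opens F} {p q : Fin n → ℤ} (hp : charVec p ∈ dualCone σ.1)
    (hq : charVec q ∈ dualCone σ.1) (hpq : charVec (p + q) ∈ dualCone σ.1) :
    mon (θ := θ) σ p hp * mon σ q hq = phase θ p q • mon σ (p + q) hpq := by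
  refine Subtype.ext ?_
  rw [MulMemClass.coe_mul, Subalgebra.coe_smul]
  change QuantumLaurent.term p 1 * QuantumLaurent.term q 1 = phase θ p q • QuantumLaurent.term _ 1
  rw [QuantumLaurent.term_mul_term, QuantumLaurent.smul_term, one_mul, one_mul, mul_one]

/-- An element is normal if left and right multiples agree. -/
structure IsNormalElement {A : Type*} [Mul A] (s : A) : Prop where
  right : ∀ a, ∃ b, a * s = s * b
  left : ∀ a, ∃ b, s * a = b * s

lemma IsNormalElement.pow {A : Type*} [Monoid A] {s : A} (h : IsNormalElement s) (k : ℕ) :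
    IsNormalElement (s ^ k) := by
  induction k with
  | zero => exact ⟨fun a => ⟨a, by simp⟩, fun a => ⟨a, by simp⟩⟩
  | succ k ih =>
    refine ⟨fun a => ?_, fun a => ?_⟩
    · obtain ⟨b, hb⟩ := ih.right a
      obtain ⟨c, hc⟩ := h.right b
      exact ⟨c, by rw [pow_succ, ← mul_assoc, hb, mul_assoc, hc, mul_assoc]⟩
    · obtain ⟨b, hb⟩ := h.left a
      obtain ⟨c, hc⟩ := ih.left b
      exact ⟨c, by rw [pow_succ, mul_assoc, hb, ← mul_assoc, hc, mul_assoc]⟩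

lemma isNormalElement_mon {σ : Opens F} {m : Fin n → ℤ} (hm : charVec m ∈ dualCone σ.1) :
    IsNormalElement (mon (θ := θ) σ m hm) := by
  refine ⟨fun a => ?_, fun a => ?_⟩
  · obtain ⟨b, hb, h⟩ := exists_mul_term_eq m a.2
    exact ⟨⟨b, hb⟩, Subtype.ext h⟩
  · obtain ⟨b, hb, h⟩ := exists_term_mul_eq m a.2
    exact ⟨⟨b, hb⟩, Subtype.ext h⟩

/-! ## Denominators for the localization of a chart at a face -/

/-- An integral functional cutting out a face. -/
def cutter {τ σ : Opens F} (h : τ ≤ σ) : Fin n → ℤ :=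
  (exists_isCutter (isRationalPolyhedral_of_mem σ) (isFace_of_le h)).choose

lemma isCutter_cutter {τ σ : Opens F} (h : τ ≤ σ) : IsCutter (cutter h) τ.1 σ.1 :=
  (exists_isCutter (isRationalPolyhedral_of_mem σ) (isFace_of_le h)).choose_spec

/-- The monomial whose inversion turns `ℂ_θ[σ]` into `ℂ_θ[τ]`. -/
def den (θ : Matrix (Fin n) (Fin n) ℂ) {τ σ : Opens F} (h : τ ≤ σ) : chart θ σ.1 :=
  mon σ (cutter h) (isCutter_cutter h).mem_dual

lemma IsCutter.neg_mem {m : Fin n → ℤ} {τ σ : Cone n} (h : IsCutter m τ σ) :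
    charVec (-m) ∈ dualCone τ := fun u hu => by
  have h1 := ((h.mem_iff u).1 hu).2
  have h2 : charVec (-m) = -charVec m := by ext i; simp [charVec]
  rw [h2, neg_dotProduct, h1, neg_zero]

lemma isUnit_den {τ σ : Opens F} (h : τ ≤ σ) : IsUnit (incl h (den θ h)) :=
  isUnit_mon (dualCone_anti h (isCutter_cutter h).mem_dual) (isCutter_cutter h).neg_mem

lemma isNormalElement_den {τ σ : Opens F} (h : τ ≤ σ) : IsNormalElement (den θ h) :=
  isNormalElement_mon (isCutter_cutter h).mem_dual

/-- A generator of `κ` on which the cutter of `τ` vanishes lies in `κ ∩ τ ⊆ κ'`, so a high power of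
the denominator of `τ` in `σ` brings every character of `κ'` into the dual of `κ`. The version with
four cones is needed for direct images, where a denominator chosen on `σ` must serve on a smaller
cone. -/
lemma exists_mul_den_pow_mem {κ κ' τ σ : Opens F} (h : τ ≤ σ) (hκ : κ ≤ σ) (hκ' : κ' ≤ κ)
    (hle : κ.1 ⊓ τ.1 ≤ κ'.1) (a : chart θ κ'.1) :
    ∃ k₀ : ℕ, ∀ k, k₀ ≤ k → ∃ b : chart θ κ.1,
      a * incl (hκ'.trans hκ) (den θ h) ^ k = incl hκ' b := by
  suffices H : ∃ k₀ : ℕ, ∀ k, k₀ ≤ k →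
      a.1 * (QuantumLaurent.term (cutter h) 1) ^ k ∈ chart θ κ.1 by
    obtain ⟨k₀, H⟩ := H
    exact ⟨k₀, fun k hk => ⟨⟨_, H k hk⟩, Subtype.ext (by
      rw [MulMemClass.coe_mul, SubmonoidClass.coe_pow]; rfl)⟩⟩
  refine chart_induction a.2 (fun p hp c => ?_) (fun f g hf hg => ?_)
  · obtain ⟨k₀, hk₀⟩ := (isCutter_cutter h).exists_add_mem (isRationalPolyhedral_of_mem κ) hκ
      (dualCone_anti hle hp)
    refine ⟨k₀, fun k hk => ?_⟩
    obtain ⟨d, -, hd⟩ := exists_term_pow (θ := θ) (cutter h) k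
    rw [hd, QuantumLaurent.term_mul_term]
    exact term_mem_chart (hk₀ k hk) _
  · obtain ⟨k₁, h₁⟩ := hf
    obtain ⟨k₂, h₂⟩ := hg
    refine ⟨max k₁ k₂, fun k hk => ?_⟩
    rw [add_mul]
    exact add_mem (h₁ k (le_trans (le_max_left _ _) hk)) (h₂ k (le_trans (le_max_right _ _) hk))

lemma exists_mul_den_pow {τ σ : Opens F} (h : τ ≤ σ) (a : chart θ τ.1) :
    ∃ k₀ : ℕ, ∀ k, k₀ ≤ k → ∃ b : chart θ σ.1, a * incl h (den θ h) ^ k = incl h b :=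
  exists_mul_den_pow_mem h le_rfl h inf_le_right a

/-! ## The charts are noetherian -/

/-- The vector of `ℤⁿ` that is the difference of two vectors of natural numbers. -/
def natDiff (x : Fin (n + n) → ℕ) : Fin n → ℤ :=
  fun i => (x (Fin.castAdd n i) : ℤ) - x (Fin.natAdd n i)

lemma natDiff_add (x y : Fin (n + n) → ℕ) : natDiff (x + y) = natDiff x + natDiff y := by
  ext i; simp [natDiff]; ring

lemma exists_natDiff_eq (m : Fin n → ℤ) : ∃ x, natDiff x = m := by
  refine ⟨Fin.append (fun i => (m i).toNat) (fun i => (-m i).toNat), funext fun i => ?_⟩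
  simp only [natDiff, Fin.append_left, Fin.append_right]
  omega

/-- Exponents are written as differences of natural vectors, ordered lexicographically;
multiplication by a monomial respects this order and changes coefficients only by nonzero phases, so
the leading-term criterion applies. -/
instance isNoetherian_chart (σ : Opens F) : IsNoetherian (chart θ σ.1)ᵐᵒᵖ (chart θ σ.1) := by
  classical
  obtain ⟨G, hG⟩ := isRationalPolyhedral_of_mem σ
  have hmem : ∀ v ∈ G, charVec v ∈ σ.1 := fun v hv => by
    rw [hG]; exact Submodule.subset_span ⟨v, hv, rfl⟩
  have hdual : ∀ m : Fin n → ℤ, charVec m ∈ dualCone σ.1 ↔ ∀ v ∈ G, 0 ≤ m ⬝ᵥ v := by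
    intro m
    constructor
    · intro h v hv
      have := h _ (hmem v hv)
      rw [charVec_dotProduct_charVec] at this
      exact_mod_cast this
    · intro h
      rw [hG]
      exact mem_dualCone_hull fun v hv => by
        rw [charVec_dotProduct_charVec]; exact_mod_cast h v hv
  let Γ := {x : Lex (Fin (n + n) → ℕ) // charVec (natDiff (ofLex x)) ∈ dualCone σ.1}
  -- Besides the coordinates, `Φ` records the pairings with the generators of `σ`, which are
  -- nonnegative on `Γ`, so `toNat` loses nothing. Then `Φ g ≤ Φ h` forces the difference of the two
  -- exponents to lie in the dual cone.
  let Φ : Γ → (Fin (n + n) ⊕ G) → ℕ := fun x =>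
    Sum.elim (ofLex x.1) (fun v => (natDiff (ofLex x.1) ⬝ᵥ v.1).toNat)
  let b : Γ → chart θ σ.1 := fun x => mon σ (natDiff (ofLex x.1)) x.2
  refine isNoetherian_of_leading_terms (k := ℂ) Φ b ?_ ?_
  · rw [eq_top_iff]
    intro a _
    suffices H : ∀ (f : QuantumLaurent θ) (hf : f ∈ chart θ σ.1),
        (⟨f, hf⟩ : chart θ σ.1) ∈ Submodule.span ℂ (Set.range b) from H a.1 a.2
    intro f hf
    have H : ∃ x ∈ Submodule.span ℂ (Set.range b), x.1 = f := by
      refine chart_induction hf (fun p hp c => ?_) (fun f g hf hg => ?_)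
      · obtain ⟨x, rfl⟩ := exists_natDiff_eq p
        refine ⟨c • b ⟨toLex x, hp⟩, Submodule.smul_mem _ _ (Submodule.subset_span ⟨_, rfl⟩), ?_⟩
        change c • QuantumLaurent.term _ 1 = _
        rw [QuantumLaurent.smul_term, mul_one]
        rfl
      · obtain ⟨x, hx, rfl⟩ := hf
        obtain ⟨y, hy, rfl⟩ := hg
        exact ⟨x + y, Submodule.add_mem _ hx hy, rfl⟩
    obtain ⟨x, hx, rfl⟩ := H
    exact hx
  · intro g h hgh
    let d : Fin (n + n) → ℕ := ofLex h.1 - ofLex g.1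
    have hd : ofLex g.1 + d = ofLex h.1 := add_tsub_cancel_of_le fun i => hgh (Sum.inl i)
    have hdm : charVec (natDiff d) ∈ dualCone σ.1 := by
      rw [hdual]
      intro v hv
      have h1 := hgh (Sum.inr ⟨v, hv⟩)
      simp only [Φ, Sum.elim_inr] at h1
      have h2 := (hdual _).1 g.2 v hv
      have h3 := (hdual _).1 h.2 v hv
      rw [← hd, natDiff_add, add_dotProduct] at h1 h3
      omega
    have hadd : ∀ x : Γ, charVec (natDiff (ofLex x.1) + natDiff d) ∈ dualCone σ.1 := fun x u hu => by
      rw [charVec_add, add_dotProduct]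
      exact add_nonneg (x.2 u hu) (hdm u hu)
    have hmul : ∀ (c : ℂ) (x y : Γ), ofLex x.1 + d = ofLex y.1 →
        MulOpposite.op (c • mon (θ := θ) σ (natDiff d) hdm) • b x =
          (c * phase θ (natDiff (ofLex x.1)) (natDiff d)) • b y := fun c x y hxy => by
      rw [MulOpposite.op_smul, smul_assoc, op_smul_eq_mul, mul_smul,
        mon_mul_mon _ _ (hadd x)]
      simp only [b, ← hxy, natDiff_add]
    refine ⟨MulOpposite.op ((phase θ (natDiff (ofLex g.1)) (natDiff d))⁻¹ • mon σ (natDiff d) hdm),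
      ?_, fun x hx => ?_⟩
    · rw [hmul _ g h hd, inv_mul_cancel₀ (phase_ne_zero _ _), one_smul, sub_self]
      exact zero_mem _
    · rw [hmul _ x ⟨toLex (ofLex x.1 + d), by
        rw [ofLex_toLex, natDiff_add]; exact hadd x⟩ rfl]
      refine Submodule.smul_mem _ _ (Submodule.subset_span ⟨_, ?_, rfl⟩)
      have h2 : toLex (ofLex g.1 + d) = h.1 := by rw [hd, toLex_ofLex]
      change toLex (ofLex x.1 + d) < h.1
      rw [← h2]
      exact add_lt_add_left (show x.1 < g.1 from hx) (toLex d)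

end NCToric

namespace NCToric

/-! ## Extension of scalars to a localization -/

section Localization

variable {R S M N : Type} [Ring R] [Ring S] [AddCommGroup M] [AddCommGroup N] [Module R M]
  [Module S N] {f : R →+* S}

/-- If `f : R → S` inverts `s` and every element of `S` is a fraction with a power of `s` as
denominator, then `N = S ⊗_R M` if and only if `N` is the localization of `M` at `s`. The additive
maps `π` extend multiplication by a power of `s` on the elements with that denominator. -/
lemma isExtensionOfScalars_iff_of_denominators (g : M →ₛₗ[f] N) (s : R) (hs : IsUnit (f s))
    (hclear : ∀ a : S, ∃ k₀ : ℕ, ∀ k, k₀ ≤ k → ∃ b, f s ^ k * a = f b)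
    (hπ : ∀ k : ℕ, ∃ π : S →+ R, ∀ a b, f s ^ k * a = f b → π a = b) :
    IsExtensionOfScalars g ↔ (∀ y : N, ∃ (k : ℕ) (x : M), f s ^ k • y = g x) ∧
      ∀ x : M, g x = 0 → ∃ k : ℕ, s ^ k • x = 0 := by
  constructor
  · rintro ⟨hsurj, hker⟩
    refine ⟨fun y => ?_, fun x hx => ?_⟩
    · obtain ⟨t, rfl⟩ := hsurj y
      suffices H : ∃ k₀ : ℕ, ∀ k, k₀ ≤ k → ∃ x, f s ^ k • baseChangeMap g t = g x by
        obtain ⟨k₀, h⟩ := H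
        exact ⟨k₀, h k₀ le_rfl⟩
      induction t using TensorProduct.induction_on with
      | zero => exact ⟨0, fun k _ => ⟨0, by simp⟩⟩
      | tmul a m =>
        obtain ⟨k₀, h⟩ := hclear a
        refine ⟨k₀, fun k hk => ?_⟩
        obtain ⟨b, hb⟩ := h k hk
        exact ⟨b • m, by rw [baseChangeMap_tmul, ← mul_smul, hb, g.map_smulₛₗ]⟩
      | add t t' ht ht' =>
        obtain ⟨k₁, h₁⟩ := ht
        obtain ⟨k₂, h₂⟩ := ht'
        refine ⟨max k₁ k₂, fun k hk => ?_⟩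
        obtain ⟨x, hx⟩ := h₁ k (le_trans (le_max_left _ _) hk)
        obtain ⟨x', hx'⟩ := h₂ k (le_trans (le_max_right _ _) hk)
        exact ⟨x + x', by rw [map_add, smul_add, hx, hx', map_add]⟩
    · choose π hπ using hπ
      -- Multiplication by `s^k` as a map defined on the whole tensor product over `ℤ`. It
      -- annihilates a given balancing relation only once `k` clears the denominators in it, hence
      -- the eventual statement in `key`.
      let ψ : ℕ → S ⊗[ℤ] M →ₗ[ℤ] M := fun k => TensorProduct.lift
        (LinearMap.mk₂ ℤ (fun a m => π k a • m) (fun a a' m => by rw [map_add, add_smul])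
          (fun c a m => by rw [map_zsmul, smul_assoc]) (fun a m m' => smul_add _ _ _)
          (fun c a m => smul_comm _ _ _))
      have hψ : ∀ k a m, ψ k (a ⊗ₜ m) = π k a • m := fun _ _ _ => rfl
      have hmem : (1 : S) ⊗ₜ[ℤ] x ∈ LinearMap.ker (baseChangeMap g) := by
        rw [LinearMap.mem_ker, baseChangeMap_tmul, hx, smul_zero]
      rw [hker] at hmem
      have key : ∀ t ∈ Submodule.span ℤ {x : S ⊗[ℤ] M | ∃ (s : S) (r : R) (m : M),
          x = (s * f r) ⊗ₜ[ℤ] m - s ⊗ₜ[ℤ] (r • m)}, ∃ k₀ : ℕ, ∀ k, k₀ ≤ k → ψ k t = 0 := by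
        intro t ht
        induction ht using Submodule.span_induction with
        | mem t ht =>
          obtain ⟨a, r, m, rfl⟩ := ht
          obtain ⟨k₀, h⟩ := hclear a
          refine ⟨k₀, fun k hk => ?_⟩
          obtain ⟨b, hb⟩ := h k hk
          rw [map_sub, hψ, hψ, hπ k a b hb,
            hπ k (a * f r) (b * r) (by rw [← mul_assoc, hb, map_mul]), mul_smul, sub_self]
        | zero => exact ⟨0, fun k _ => map_zero _⟩
        | add t t' _ _ ht ht' =>
          obtain ⟨k₁, h₁⟩ := ht
          obtain ⟨k₂, h₂⟩ := ht'
          refine ⟨max k₁ k₂, fun k hk => ?_⟩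
          rw [map_add, h₁ k (le_trans (le_max_left _ _) hk),
            h₂ k (le_trans (le_max_right _ _) hk), add_zero]
        | smul c t _ ht =>
          obtain ⟨k₁, h₁⟩ := ht
          exact ⟨k₁, fun k hk => by rw [map_smul, h₁ k hk, smul_zero]⟩
      obtain ⟨k, hk⟩ := key _ hmem
      refine ⟨k, ?_⟩
      have := hk k le_rfl
      rwa [hψ, hπ k 1 (s ^ k) (by rw [mul_one, map_pow])] at this
  · rintro ⟨h₁, h₂⟩
    obtain ⟨u, hu⟩ := hs
    have hu' : ∀ k : ℕ, (↑(u ^ k)⁻¹ : S) * f s ^ k = 1 := fun k => by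
      rw [← hu, ← Units.val_pow_eq_pow_val, Units.inv_mul]
    have hu'' : ∀ j k : ℕ, (↑(u ^ (k + j))⁻¹ : S) * f s ^ j = ↑(u ^ k)⁻¹ := fun j k => by
      rw [← hu, ← Units.val_pow_eq_pow_val, ← Units.val_mul, pow_add, mul_inv_rev,
        (Commute.pow_pow_self u k j).inv_inv.eq.symm, mul_assoc, inv_mul_cancel, mul_one]
    refine ⟨fun y => ?_, le_antisymm (fun t ht => ?_) (Submodule.span_le.2 ?_)⟩
    · obtain ⟨k, x, h⟩ := h₁ y
      exact ⟨(↑(u ^ k)⁻¹ : S) ⊗ₜ x, by rw [baseChangeMap_tmul, ← h, ← mul_smul, hu', one_smul]⟩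
    · set W := Submodule.span ℤ {x : S ⊗[ℤ] M | ∃ (s : S) (r : R) (m : M),
          x = (s * f r) ⊗ₜ[ℤ] m - s ⊗ₜ[ℤ] (r • m)} with hW
      have hrel : ∀ (a : S) (r : R) (m : M), (a * f r) ⊗ₜ[ℤ] m - a ⊗ₜ[ℤ] (r • m) ∈ W :=
        fun a r m => Submodule.subset_span ⟨a, r, m, rfl⟩
      -- Common denominators: modulo the balancing relations every tensor is a pure tensor `s^{-k} ⊗
      -- x`.
      have key : ∀ t : S ⊗[ℤ] M, ∃ k₀ : ℕ, ∀ k, k₀ ≤ k → ∃ x : M, t - (↑(u ^ k)⁻¹ : S) ⊗ₜ x ∈ W := by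
        intro t
        induction t using TensorProduct.induction_on with
        | zero => exact ⟨0, fun k _ => ⟨0, by simp⟩⟩
        | tmul a m =>
          obtain ⟨k₀, h⟩ := hclear a
          refine ⟨k₀, fun k hk => ?_⟩
          obtain ⟨b, hb⟩ := h k hk
          refine ⟨b • m, ?_⟩
          have := hrel (↑(u ^ k)⁻¹ : S) b m
          rwa [← hb, ← mul_assoc, hu', one_mul] at this
        | add t t' ht ht' =>
          obtain ⟨k₁, h₁⟩ := ht
          obtain ⟨k₂, h₂⟩ := ht'
          refine ⟨max k₁ k₂, fun k hk => ?_⟩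
          obtain ⟨x, hx⟩ := h₁ k (le_trans (le_max_left _ _) hk)
          obtain ⟨x', hx'⟩ := h₂ k (le_trans (le_max_right _ _) hk)
          exact ⟨x + x', by
            rw [TensorProduct.tmul_add, add_sub_add_comm]; exact W.add_mem hx hx'⟩
      have hWker : W ≤ LinearMap.ker (baseChangeMap g) := Submodule.span_le.2 (by
        rintro _ ⟨a, r, m, rfl⟩
        rw [SetLike.mem_coe, LinearMap.mem_ker, map_sub, baseChangeMap_tmul, baseChangeMap_tmul,
          g.map_smulₛₗ, mul_smul, sub_self])
      obtain ⟨k, hk⟩ := key t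
      obtain ⟨x, hx⟩ := hk k le_rfl
      have hgx : g x = 0 := by
        have h3 := hWker hx
        rw [LinearMap.mem_ker, map_sub, LinearMap.mem_ker.1 ht, zero_sub, neg_eq_zero,
          baseChangeMap_tmul] at h3
        have h4 : (↑(u ^ k) : S) • (↑(u ^ k)⁻¹ : S) • g x = 0 := by rw [h3, smul_zero]
        rwa [← mul_smul, Units.mul_inv, one_smul] at h4
      obtain ⟨j, hj⟩ := h₂ x hgx
      -- Modulo the relations, `s^{-k} ⊗ x = s^{-(k+j)} s^j ⊗ x` equals `s^{-(k+j)} ⊗ s^j x`, which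
      -- is zero.
      have h5 := hrel (↑(u ^ (k + j))⁻¹ : S) (s ^ j) x
      rw [hj, TensorProduct.tmul_zero, sub_zero, map_pow, hu''] at h5
      have h6 := W.add_mem hx h5
      rwa [sub_add_cancel] at h6
    · rintro _ ⟨a, r, m, rfl⟩
      rw [SetLike.mem_coe, LinearMap.mem_ker, map_sub, baseChangeMap_tmul, baseChangeMap_tmul,
        g.map_smulₛₗ, mul_smul, sub_self]

end Localization

variable {n : ℕ} {θ : Matrix (Fin n) (Fin n) ℂ} {F : Fan n}

/-- The map `a ↦ a d^k`, with `d` the denominator, lands in the smaller algebra only on a subspace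
of the larger one. Over the field `ℂ` this partial map extends linearly to the whole space, and the
extension is otherwise arbitrary. -/
lemma exists_addMonoidHom_of_den {τ σ : Opens F} (h : τ ≤ σ) (k : ℕ) :
    ∃ π : chart θ τ.1 →+ chart θ σ.1, ∀ a b, a * incl h (den θ h) ^ k = incl h b → π a = b := by
  set r : chart θ τ.1 →ₗ[ℂ] chart θ τ.1 := LinearMap.mulRight ℂ (incl h (den θ h) ^ k)
  set e := LinearEquiv.ofInjective (incl (θ := θ) h).toLinearMap (incl_injective h)
  set p : Submodule ℂ (chart θ τ.1) := (LinearMap.range (incl (θ := θ) h).toLinearMap).comap r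
  obtain ⟨π, hπ⟩ := LinearMap.exists_extend
    (e.symm.toLinearMap ∘ₗ (r.restrict (p := p) (fun x hx => hx)))
  refine ⟨π.toAddMonoidHom, fun a b hab => ?_⟩
  have ha : a ∈ p := ⟨b, hab.symm⟩
  have h1 := LinearMap.congr_fun hπ ⟨a, ha⟩
  refine h1.trans ?_
  change e.symm _ = b
  rw [LinearEquiv.symm_apply_eq]
  exact Subtype.ext hab

/-- A sheaf is quasi-coherent if and only if its restriction maps are localizations. -/
lemma isQuasiCoherent_iff {E : RightMod θ F} : IsQuasiCoherent θ F E ↔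
    ∀ (τ σ : Opens F) (h : τ ≤ σ),
      (∀ y : sections E τ, ∃ (k : ℕ) (x : sections E σ), y ◃ incl h (den θ h) ^ k = res h x) ∧
      ∀ x : sections E σ, res h x = 0 → ∃ k : ℕ, x ◃ den θ h ^ k = 0 := by
  refine forall_congr' fun τ => forall_congr' fun σ => forall_congr' fun h => ?_
  refine isExtensionOfScalars_iff_of_denominators (restrict E h)
    (MulOpposite.op (den θ h) : (chart θ σ.1)ᵐᵒᵖ) ?_ ?_ ?_
  · exact (isUnit_den h).op
  · intro a
    obtain ⟨k₀, H⟩ := exists_mul_den_pow h (MulOpposite.unop a)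
    refine ⟨k₀, fun k hk => ?_⟩
    obtain ⟨b, hb⟩ := H k hk
    exact ⟨MulOpposite.op b, MulOpposite.unop_injective hb⟩
  · intro k
    obtain ⟨π, hπ⟩ := exists_addMonoidHom_of_den (θ := θ) h k
    refine ⟨(MulOpposite.opAddEquiv.toAddMonoidHom.comp π).comp
      MulOpposite.opAddEquiv.symm.toAddMonoidHom, fun a b hab => ?_⟩
    exact congrArg MulOpposite.op (hπ _ _ (congrArg MulOpposite.unop hab))

end NCToric

/-! ### Fractions in quasi-coherent sheaves; subsheaves, quotients, kernels, images -/

namespace NCToric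

variable {n : ℕ} {θ : Matrix (Fin n) (Fin n) ℂ} {F : Fan n}

/-! ## Sections of quasi-coherent sheaves -/

lemma isUnit_den_pow {τ σ : Opens F} (h : τ ≤ σ) (k : ℕ) :
    ∃ u : chart θ τ.1, incl h (den θ h) ^ k * u = 1 ∧ u * incl h (den θ h) ^ k = 1 := by
  obtain ⟨u, hu⟩ := (isUnit_den (θ := θ) h).pow k
  exact ⟨↑u⁻¹, by rw [← hu, Units.mul_inv], by rw [← hu, Units.inv_mul]⟩

lemma act_den_pow_injective {τ σ : Opens F} (h : τ ≤ σ) (k : ℕ) {M : Type} [AddCommGroup M]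
    [Module (chart θ τ.1)ᵐᵒᵖ M] {y y' : M}
    (hy : y ◃ incl h (den θ h) ^ k = y' ◃ incl h (den θ h) ^ k) : y = y' := by
  obtain ⟨u, hu, -⟩ := isUnit_den_pow (θ := θ) h k
  have := congrArg (· ◃ u) hy
  simpa only [← act_mul, hu, act_one] using this

lemma mem_of_act_den_pow_mem {τ σ : Opens F} (h : τ ≤ σ) (k : ℕ) {M : Type} [AddCommGroup M]
    [Module (chart θ τ.1)ᵐᵒᵖ M] {N : Submodule (chart θ τ.1)ᵐᵒᵖ M} {y : M}
    (hy : y ◃ incl h (den θ h) ^ k ∈ N) : y ∈ N := by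
  obtain ⟨u, hu, -⟩ := isUnit_den_pow (θ := θ) h k
  have := act_mem hy u
  rwa [← act_mul, hu, act_one] at this

section Coh

variable (E : Coh θ F) {τ σ : Opens F} (h : τ ≤ σ)

lemma exists_act_den_pow_eq_res (y : sections E.obj τ) :
    ∃ k₀ : ℕ, ∀ k, k₀ ≤ k → ∃ x : sections E.obj σ, y ◃ incl h (den θ h) ^ k = res h x := by
  obtain ⟨k₀, x, hx⟩ := (isQuasiCoherent_iff.1 E.property τ σ h).1 y
  refine ⟨k₀, fun k hk => ⟨x ◃ den θ h ^ (k - k₀), ?_⟩⟩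
  rw [res_act, ← hx, map_pow, ← act_mul, ← pow_add, Nat.add_sub_cancel' hk]

variable {E} in
lemma exists_act_den_pow_eq_zero {x : sections E.obj σ} (hx : res h x = 0) :
    ∃ k₀ : ℕ, ∀ k, k₀ ≤ k → x ◃ den θ h ^ k = 0 := by
  obtain ⟨k₀, hx⟩ := (isQuasiCoherent_iff.1 E.property τ σ h).2 x hx
  refine ⟨k₀, fun k hk => ?_⟩
  rw [← Nat.add_sub_cancel' hk, pow_add, act_mul, hx, zero_act]

variable {E} in
lemma res_eq_zero_of_act_den_pow {x : sections E.obj σ} {k : ℕ} (hx : x ◃ den θ h ^ k = 0) :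
    res h x = 0 := by
  refine act_den_pow_injective (θ := θ) h k ?_
  rw [zero_act, ← map_pow, ← res_act, hx, map_zero]

end Coh

/-! ## Quasi-coherent subsheaves and quotients -/

/-- A quasi-coherent subsheaf of modules. -/
@[ext]
structure Subsheaf (E : Coh θ F) where
  mod : ∀ σ : Opens F, Submodule (chart θ σ.1)ᵐᵒᵖ (sections E.obj σ)
  res_mem : ∀ {τ σ : Opens F} (h : τ ≤ σ) {e : sections E.obj σ}, e ∈ mod σ → res h e ∈ mod τ
  exists_res : ∀ {τ σ : Opens F} (h : τ ≤ σ) {y : sections E.obj τ}, y ∈ mod τ →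
    ∃ (k : ℕ) (x : sections E.obj σ), x ∈ mod σ ∧ y ◃ incl h (den θ h) ^ k = res h x

namespace Subsheaf

variable {E : Coh θ F} (N : Subsheaf E)

lemma exists_res_of_le {τ σ : Opens F} (h : τ ≤ σ) {y : sections E.obj τ} (hy : y ∈ N.mod τ) :
    ∃ k₀ : ℕ, ∀ k, k₀ ≤ k → ∃ x ∈ N.mod σ, y ◃ incl h (den θ h) ^ k = res h x := by
  obtain ⟨k₀, x, hxN, hx⟩ := N.exists_res h hy
  refine ⟨k₀, fun k hk => ⟨x ◃ den θ h ^ (k - k₀), act_mem hxN _, ?_⟩⟩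
  rw [res_act, ← hx, map_pow, ← act_mul, ← pow_add, Nat.add_sub_cancel' hk]

/-- The data of a subsheaf as a sheaf of its own. -/
def data : SheafData θ F where
  carrier := fun σ => N.mod σ
  res := fun h => ((res h).comp (N.mod _).subtype.toAddMonoidHom).codRestrict (N.mod _)
    (fun x => N.res_mem h x.2)
  res_act h x a := Subtype.ext (res_act h x.1 a)
  res_refl _ x := Subtype.ext (NCToric.res_refl x.1)
  res_trans h h' x := Subtype.ext (res_res h h' x.1)

/-- A subsheaf as a quasi-coherent sheaf. -/
def obj : Coh θ F where
  obj := N.data.sheaf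
  property := by
    rw [isQuasiCoherent_iff]
    intro τ σ h
    refine ⟨fun y => ?_, fun x hx => ?_⟩
    · obtain ⟨k, x, hxN, hx⟩ := N.exists_res h (show N.mod τ from y).2
      exact ⟨k, (⟨x, hxN⟩ : N.mod σ), Subtype.ext hx⟩
    · obtain ⟨k, hk⟩ := exists_act_den_pow_eq_zero (E := E) h (x := (show N.mod σ from x).1)
        (congrArg Subtype.val hx)
      exact ⟨k, Subtype.ext (hk k le_rfl)⟩

/-- The inclusion of a subsheaf. -/
def ι : N.obj ⟶ E :=
  homOfSections (fun σ => (N.mod σ).subtype) (fun _ _ => rfl)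

lemma ι_injective (σ : Opens F) : Function.Injective (onSections N.ι σ) :=
  Subtype.val_injective

lemma ι_mem (σ : Opens F) (x : sections N.obj.obj σ) : onSections N.ι σ x ∈ N.mod σ :=
  (show N.mod σ from x).2

lemma exists_ι_eq {σ : Opens F} {e : sections E.obj σ} (he : e ∈ N.mod σ) :
    ∃ x, onSections N.ι σ x = e := ⟨(⟨e, he⟩ : N.mod σ), rfl⟩

/-- A morphism with values in a subsheaf. -/
def lift {E' : Coh θ F} (f : E' ⟶ E) (hf : ∀ σ x, onSections f σ x ∈ N.mod σ) : E' ⟶ N.obj :=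
  homOfSections (fun σ => (onSections f σ).codRestrict (N.mod σ) (hf σ))
    (fun h x => Subtype.ext (onSections_res f h x))

lemma lift_ι {E' : Coh θ F} (f : E' ⟶ E) (hf : ∀ σ x, onSections f σ x ∈ N.mod σ) :
    N.lift f hf ≫ N.ι = f := hom_ext_sections fun _ _ => rfl

/-- The data of the quotient by a subsheaf. -/
def quotData : SheafData θ F where
  carrier σ := sections E.obj σ ⧸ N.mod σ
  res {τ σ} h := QuotientAddGroup.map (N.mod σ).toAddSubgroup (N.mod τ).toAddSubgroup (res h)
    (fun _ hx => N.res_mem h hx)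
  res_act h x a := by
    obtain ⟨x, rfl⟩ := Submodule.Quotient.mk_surjective _ x
    exact congrArg (Submodule.Quotient.mk) (res_act h x a)
  res_refl σ x := by
    obtain ⟨x, rfl⟩ := Submodule.Quotient.mk_surjective _ x
    exact congrArg (Submodule.Quotient.mk) (NCToric.res_refl x)
  res_trans h h' x := by
    obtain ⟨x, rfl⟩ := Submodule.Quotient.mk_surjective _ x
    exact congrArg (Submodule.Quotient.mk) (res_res h h' x)

/-- The quotient by a subsheaf. -/
def quot : Coh θ F where
  obj := N.quotData.sheaf
  property := by
    rw [isQuasiCoherent_iff]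
    intro τ σ h
    refine ⟨fun y => ?_, fun x hx => ?_⟩
    · obtain ⟨y, rfl⟩ := Submodule.Quotient.mk_surjective (N.mod τ) y
      obtain ⟨k, hk⟩ := exists_act_den_pow_eq_res E h y
      obtain ⟨x, hx⟩ := hk k le_rfl
      exact ⟨k, Submodule.Quotient.mk (p := N.mod σ) x, congrArg (Submodule.Quotient.mk) hx⟩
    · obtain ⟨x, rfl⟩ := Submodule.Quotient.mk_surjective (N.mod σ) x
      have hx' : res h x ∈ N.mod τ := (Submodule.Quotient.mk_eq_zero _).1 hx
      obtain ⟨k, x', hx'N, hx'⟩ := N.exists_res h hx'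
      have h0 : res h (x ◃ den θ h ^ k - x') = 0 := by
        rw [map_sub, res_act, map_pow, hx', sub_self]
      obtain ⟨j, hj⟩ := exists_act_den_pow_eq_zero h h0
      refine ⟨k + j, (Submodule.Quotient.mk_eq_zero (N.mod σ)).2 ?_⟩
      have := hj j le_rfl
      rw [sub_act, sub_eq_zero, ← act_mul, ← pow_add] at this
      change x ◃ den θ h ^ (k + j) ∈ N.mod σ
      rw [this]
      exact act_mem hx'N _

/-- The projection to the quotient. -/
def π : E ⟶ N.quot :=
  homOfSections (E' := N.quot) (fun σ => (N.mod σ).mkQ) (fun _ _ => rfl)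

lemma π_surjective (σ : Opens F) : Function.Surjective (onSections N.π σ) :=
  Submodule.Quotient.mk_surjective _

lemma π_eq_zero_iff {σ : Opens F} {e : sections E.obj σ} :
    onSections N.π σ e = 0 ↔ e ∈ N.mod σ :=
  Submodule.Quotient.mk_eq_zero (N.mod σ)

/-- A morphism out of a quotient. -/
def desc {E' : Coh θ F} (f : E ⟶ E') (hf : ∀ σ, ∀ x ∈ N.mod σ, onSections f σ x = 0) :
    N.quot ⟶ E' :=
  homOfSections (E := N.quot) (fun σ => (N.mod σ).liftQ (onSections f σ) (hf σ)) (by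
    intro τ σ h x
    obtain ⟨x, rfl⟩ := Submodule.Quotient.mk_surjective (N.mod σ) x
    exact onSections_res f h x)

lemma π_desc {E' : Coh θ F} (f : E ⟶ E') (hf : ∀ σ, ∀ x ∈ N.mod σ, onSections f σ x = 0) :
    N.π ≫ N.desc f hf = f := hom_ext_sections fun _ _ => rfl

/-- The sum of a set of subsheaves. -/
def sSup (S : Set (Subsheaf E)) : Subsheaf E where
  mod σ := ⨆ N ∈ S, N.mod σ
  res_mem {τ σ} h e he := by
    rw [iSup_subtype'] at he ⊢
    induction he using Submodule.iSup_induction' with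
    | mem N x hx => exact Submodule.mem_iSup_of_mem N (N.1.res_mem h hx)
    | zero => rw [map_zero]; exact zero_mem _
    | add x y _ _ hx hy => rw [map_add]; exact add_mem hx hy
  exists_res {τ σ} h y hy := by
    suffices H : ∃ k₀ : ℕ, ∀ k, k₀ ≤ k → ∃ x ∈ ⨆ N ∈ S, N.mod σ,
        y ◃ incl h (den θ h) ^ k = res h x by
      obtain ⟨k, hk⟩ := H
      exact ⟨k, hk k le_rfl⟩
    rw [iSup_subtype'] at hy ⊢
    induction hy using Submodule.iSup_induction' with
    | mem N x hx =>
      obtain ⟨k₀, hk⟩ := N.1.exists_res_of_le h hx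
      refine ⟨k₀, fun k hk' => ?_⟩
      obtain ⟨x, hx, hxy⟩ := hk k hk'
      exact ⟨x, Submodule.mem_iSup_of_mem N hx, hxy⟩
    | zero => exact ⟨0, fun k _ => ⟨0, zero_mem _, by rw [zero_act, map_zero]⟩⟩
    | add x y _ _ hx hy =>
      obtain ⟨k₁, h₁⟩ := hx
      obtain ⟨k₂, h₂⟩ := hy
      refine ⟨max k₁ k₂, fun k hk => ?_⟩
      obtain ⟨x, hx, hx'⟩ := h₁ k (le_trans (le_max_left _ _) hk)
      obtain ⟨y, hy, hy'⟩ := h₂ k (le_trans (le_max_right _ _) hk)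
      exact ⟨x + y, add_mem hx hy, by rw [add_act, hx', hy', map_add]⟩

end Subsheaf

/-- The kernel of a morphism. -/
def kernelSubsheaf {E E' : Coh θ F} (f : E ⟶ E') : Subsheaf E where
  mod σ := LinearMap.ker (onSections f σ)
  res_mem h e he := by
    rw [LinearMap.mem_ker] at he ⊢
    rw [onSections_res, he, map_zero]
  exists_res {τ σ} h y hy := by
    obtain ⟨k, hk⟩ := exists_act_den_pow_eq_res E h y
    obtain ⟨x, hx⟩ := hk k le_rfl
    have h0 : res h (onSections f σ x) = 0 := by
      rw [← onSections_res, ← hx, map_act, LinearMap.mem_ker.1 hy, zero_act]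
    obtain ⟨j, hj⟩ := exists_act_den_pow_eq_zero h h0
    refine ⟨k + j, x ◃ den θ h ^ j, ?_, ?_⟩
    · rw [LinearMap.mem_ker, map_act, hj j le_rfl]
    · rw [res_act, map_pow, pow_add, act_mul, hx]

/-- The image of a morphism. -/
def imageSubsheaf {E E' : Coh θ F} (f : E ⟶ E') : Subsheaf E' where
  mod σ := LinearMap.range (onSections f σ)
  res_mem h e he := by
    obtain ⟨x, rfl⟩ := he
    exact ⟨res h x, onSections_res f h x⟩
  exists_res {τ σ} h y hy := by
    obtain ⟨y, rfl⟩ := hy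
    obtain ⟨k, hk⟩ := exists_act_den_pow_eq_res E h y
    obtain ⟨x, hx⟩ := hk k le_rfl
    exact ⟨k, onSections f σ x, ⟨x, rfl⟩, by rw [← map_act, hx, onSections_res]⟩

/-- Monomorphisms of quasi-coherent sheaves are injective on sections. -/
lemma injective_of_mono {E E' : Coh θ F} (f : E ⟶ E') [Mono f] (σ : Opens F) :
    Function.Injective (onSections f σ) := by
  set N := kernelSubsheaf f
  have hz : ∀ τ (x : sections N.obj.obj τ), onSections N.ι τ x ∈ LinearMap.ker (onSections f τ) :=
    N.ι_mem
  let z : N.obj ⟶ E := homOfSections (fun _ => 0) (fun h x => by simp)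
  have h1 : N.ι ≫ f = z ≫ f := hom_ext_sections fun τ x => by
    rw [onSections_comp, onSections_comp, LinearMap.mem_ker.1 (hz τ x)]
    exact (map_zero _).symm
  have h2 := (cancel_mono f).1 h1
  rw [← LinearMap.ker_eq_bot, eq_bot_iff]
  intro x hx
  obtain ⟨y, rfl⟩ := N.exists_ι_eq hx
  rw [h2]
  exact Submodule.zero_mem _

lemma mono_of_injective {E E' : Coh θ F} (f : E ⟶ E')
    (hf : ∀ σ, Function.Injective (onSections f σ)) : Mono f where
  right_cancellation g g' h := hom_ext_sections fun σ e => hf σ (by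
    rw [← onSections_comp, h, onSections_comp])

lemma isIso_of_bijective {E E' : Coh θ F} (f : E ⟶ E')
    (hf : ∀ σ, Function.Bijective (onSections f σ)) : IsIso f := by
  let g : ∀ σ, sections E.obj σ ≃ₗ[(chart θ σ.1)ᵐᵒᵖ] sections E'.obj σ := fun σ =>
    LinearEquiv.ofBijective (onSections f σ) (hf σ)
  have hg : ∀ σ x, (g σ).symm (onSections f σ x) = x := fun σ x => (g σ).symm_apply_apply x
  have hg' : ∀ σ x, onSections f σ ((g σ).symm x) = x := fun σ x => (g σ).apply_symm_apply x
  refine ⟨homOfSections (fun σ => (g σ).symm) ?_, ?_, ?_⟩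
  · intro τ σ h x
    apply (hf τ).1
    rw [onSections_res]
    exact (hg' τ _).trans (congrArg _ (hg' σ x).symm)
  · exact hom_ext_sections fun σ x => hg σ x
  · exact hom_ext_sections fun σ x => hg' σ x

end NCToric

/-! ### Extension of subsheaves, and approximation by coherent ones -/

namespace NCToric

variable {n : ℕ} {θ : Matrix (Fin n) (Fin n) ℂ} {F : Fan n}

instance finite_opens : Finite (Opens F) := F.finite.to_subtype

/-! ## Comparison of denominators -/

/-- The inverse of the denominator of `κ'` in `κ` becomes an element of the algebra of `κ` after
multiplication by a high power of the denominator of `τ` in `σ`. Fractions over `κ'` can thus be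
written with the outer denominator. -/
lemma exists_den_pow_eq_mul {κ κ' τ σ : Opens F} (h : τ ≤ σ) (hκ : κ ≤ σ) (hκ' : κ' ≤ κ)
    (hle : κ.1 ⊓ τ.1 ≤ κ'.1) (j : ℕ) :
    ∃ k₀ : ℕ, ∀ k, k₀ ≤ k → ∃ b : chart θ κ.1,
      incl hκ (den θ h) ^ k = den θ hκ' ^ j * b := by
  obtain ⟨u, hu, -⟩ := isUnit_den_pow (θ := θ) hκ' j
  obtain ⟨k₀, hk⟩ := exists_mul_den_pow_mem h hκ hκ' hle u
  refine ⟨k₀, fun k hk' => ?_⟩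
  obtain ⟨b, hb⟩ := hk k hk'
  refine ⟨b, incl_injective hκ' ?_⟩
  rw [map_mul, map_pow, map_pow, ← hb, ← mul_assoc, hu, one_mul, incl_incl]

lemma exists_act_den_pow_eq_res_of_inter {E : Coh θ F} {κ κ' τ σ : Opens F} (h : τ ≤ σ)
    (hκ : κ ≤ σ) (hκ' : κ' ≤ κ) (hle : κ.1 ⊓ τ.1 ≤ κ'.1)
    {M : Submodule (chart θ κ.1)ᵐᵒᵖ (sections E.obj κ)}
    {y : sections E.obj κ'} {j : ℕ} {x : sections E.obj κ} (hx : x ∈ M)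
    (hy : y ◃ incl hκ' (den θ hκ') ^ j = res hκ' x) :
    ∃ k₀ : ℕ, ∀ k, k₀ ≤ k → ∃ x' ∈ M, y ◃ incl (hκ'.trans hκ) (den θ h) ^ k = res hκ' x' := by
  obtain ⟨k₀, hk⟩ := exists_den_pow_eq_mul (θ := θ) h hκ hκ' hle j
  refine ⟨k₀, fun k hk' => ?_⟩
  obtain ⟨b, hb⟩ := hk k hk'
  refine ⟨x ◃ b, act_mem hx b, ?_⟩
  have hb' := congrArg (incl hκ') hb
  rw [map_mul, map_pow, map_pow, incl_incl] at hb'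
  rw [res_act, ← hy, ← act_mul, hb']

lemma exists_act_den_pow_eq_zero_of_inter {E : Coh θ F} {κ κ' τ σ : Opens F} (h : τ ≤ σ)
    (hκ : κ ≤ σ) (hκ' : κ' ≤ κ) (hle : κ.1 ⊓ τ.1 ≤ κ'.1)
    {x : sections E.obj κ} (hx : res hκ' x = 0) :
    ∃ k₀ : ℕ, ∀ k, k₀ ≤ k → x ◃ incl hκ (den θ h) ^ k = 0 := by
  obtain ⟨j, hj⟩ := exists_act_den_pow_eq_zero hκ' hx
  obtain ⟨k₀, hk⟩ := exists_den_pow_eq_mul (θ := θ) h hκ hκ' hle j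
  refine ⟨k₀, fun k hk' => ?_⟩
  obtain ⟨b, hb⟩ := hk k hk'
  rw [hb, act_mul, hj j le_rfl, zero_act]

/-- Moving a denominator to the right of a section over the smaller open set. -/
lemma exists_act_eq_res {E : Coh θ F} {τ σ : Opens F} (h : τ ≤ σ) {y : sections E.obj τ} {k : ℕ}
    {x : sections E.obj σ} (hy : y ◃ incl h (den θ h) ^ k = res h x) (a : chart θ τ.1) :
    ∃ j₀ : ℕ, ∀ j, j₀ ≤ j → ∃ b b' : chart θ σ.1, a * incl h (den θ h) ^ j = incl h b ∧
      b * den θ h ^ k = den θ h ^ k * b' ∧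
      (y ◃ a) ◃ incl h (den θ h) ^ (j + k) = res h (x ◃ b') := by
  obtain ⟨j₀, hj⟩ := exists_mul_den_pow h a
  refine ⟨j₀, fun j hj' => ?_⟩
  obtain ⟨b, hb⟩ := hj j hj'
  obtain ⟨b', hb'⟩ := ((isNormalElement_den (θ := θ) h).pow k).right b
  refine ⟨b, b', hb, hb', ?_⟩
  rw [← act_mul, pow_add, ← mul_assoc, hb, ← map_pow, ← map_mul, hb', map_mul, act_mul, map_pow,
    hy, res_act]

/-- Elements of the submodule generated by restrictions are fractions. -/
lemma exists_res_of_mem_span {E : Coh θ F} {τ σ : Opens F} (h : τ ≤ σ)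
    {M : Submodule (chart θ σ.1)ᵐᵒᵖ (sections E.obj σ)} {y : sections E.obj τ}
    (hy : y ∈ Submodule.span (chart θ τ.1)ᵐᵒᵖ (res h '' (M : Set (sections E.obj σ)))) :
    ∃ k₀ : ℕ, ∀ k, k₀ ≤ k → ∃ x ∈ M, y ◃ incl h (den θ h) ^ k = res h x := by
  induction hy using Submodule.span_induction with
  | mem y hy =>
    obtain ⟨x, hx, rfl⟩ := hy
    exact ⟨0, fun k _ => ⟨x ◃ den θ h ^ k, act_mem hx _, by rw [res_act, map_pow]⟩⟩
  | zero => exact ⟨0, fun k _ => ⟨0, zero_mem _, by rw [zero_act, map_zero]⟩⟩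
  | add x y _ _ hx hy =>
    obtain ⟨k₁, h₁⟩ := hx
    obtain ⟨k₂, h₂⟩ := hy
    refine ⟨max k₁ k₂, fun k hk => ?_⟩
    obtain ⟨x, hx, hx'⟩ := h₁ k (le_trans (le_max_left _ _) hk)
    obtain ⟨y, hy, hy'⟩ := h₂ k (le_trans (le_max_right _ _) hk)
    exact ⟨x + y, add_mem hx hy, by rw [add_act, hx', hy', map_add]⟩
  | smul a y _ hy =>
    obtain ⟨k, hk⟩ := hy
    obtain ⟨x, hx, hxy⟩ := hk k le_rfl
    obtain ⟨j₀, hj⟩ := exists_act_eq_res h hxy a.unop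
    refine ⟨j₀ + k, fun i hi => ?_⟩
    obtain ⟨b, b', -, -, hb⟩ := hj (i - k) (by omega)
    rw [Nat.sub_add_cancel (by omega)] at hb
    exact ⟨x ◃ b', act_mem hx _, hb⟩

/-! ## Extension of subsheaves from an open subset -/

/-- A quasi-coherent subsheaf of the restriction of `E` to an open subset. -/
structure IsSubsheafOn (E : Coh θ F) (U : Set (Opens F))
    (M : ∀ κ : Opens F, Submodule (chart θ κ.1)ᵐᵒᵖ (sections E.obj κ)) : Prop where
  down : ∀ {τ σ : Opens F}, τ ≤ σ → σ ∈ U → τ ∈ U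
  res_mem : ∀ {τ σ : Opens F} (h : τ ≤ σ), σ ∈ U → ∀ e ∈ M σ, res h e ∈ M τ
  exists_res : ∀ {τ σ : Opens F} (h : τ ≤ σ), σ ∈ U → ∀ y ∈ M τ, ∃ (k : ℕ) (x : sections E.obj σ),
    x ∈ M σ ∧ y ◃ incl h (den θ h) ^ k = res h x

/-- The largest extension of a subsheaf from an open subset. -/
def IsSubsheafOn.extend {E : Coh θ F} {U : Set (Opens F)}
    {M : ∀ κ : Opens F, Submodule (chart θ κ.1)ᵐᵒᵖ (sections E.obj κ)} (H : IsSubsheafOn E U M) :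
    Subsheaf E where
  mod ρ :=
    { carrier := {y | ∀ κ (h : κ ≤ ρ), κ ∈ U → res h y ∈ M κ}
      add_mem' := fun hx hy κ h hκ => by rw [map_add]; exact add_mem (hx κ h hκ) (hy κ h hκ)
      zero_mem' := fun κ h hκ => by rw [map_zero]; exact zero_mem _
      smul_mem' := fun a x hx κ h hκ => by
        have : res h (x ◃ a.unop) ∈ M κ := by rw [res_act]; exact act_mem (hx κ h hκ) _
        exact this }
  res_mem h e he κ hκ hκU := by rw [res_res]; exact he κ _ hκU
  exists_res {τ σ} h y hy := by
    obtain ⟨k, hk⟩ := exists_act_den_pow_eq_res E h y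
    obtain ⟨z, hz⟩ := hk k le_rfl
    -- Over `κ ∩ τ` the restriction of `z` lies in `M` because `y` satisfies the defining condition.
    -- Clearing denominators on `κ` puts `z d^j` into `M κ`, where `d` is the denominator of `τ` in
    -- `σ`; since the fan is finite, one exponent works for all `κ`.
    have key : ∀ κ : Opens F, ∃ j₀ : ℕ, ∀ j, j₀ ≤ j → ∀ hκ : κ ≤ σ, κ ∈ U →
        res hκ (z ◃ den θ h ^ j) ∈ M κ := by
      intro κ
      by_cases hc : κ ≤ σ ∧ κ ∈ U
      swap
      · exact ⟨0, fun j _ hκ hκU => absurd ⟨hκ, hκU⟩ hc⟩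
      obtain ⟨hκ, hκU⟩ := hc
      have h' : κ.inter τ ≤ κ := κ.inter_le_left τ
      have hmem : res h' (res hκ z) ∈ M (κ.inter τ) := by
        rw [res_res, ← res_res h (κ.inter_le_right τ), ← hz, res_act]
        exact act_mem (hy _ _ (H.down h' hκU)) _
      obtain ⟨i, x, hxM, hx⟩ := H.exists_res h' hκU _ hmem
      obtain ⟨i₁, hi⟩ := exists_act_den_pow_eq_res_of_inter h hκ h' (le_refl _) hxM hx
      obtain ⟨x', hx'M, hx'⟩ := hi i₁ le_rfl
      have h0 : res h' (res hκ z ◃ incl hκ (den θ h) ^ i₁ - x') = 0 := by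
        rw [map_sub, ← hx', res_act, map_pow, incl_incl, sub_self]
      obtain ⟨i₂, hi₂⟩ := exists_act_den_pow_eq_zero_of_inter h hκ h' (le_refl _) h0
      refine ⟨i₁ + i₂, fun j hj _ _ => ?_⟩
      have := hi₂ (j - i₁) (by omega)
      rw [sub_act, sub_eq_zero, ← act_mul, ← pow_add, Nat.add_sub_cancel' (by omega)] at this
      rw [res_act, map_pow, this]
      exact act_mem hx'M _
    choose j₀ hj₀ using key
    have := Fintype.ofFinite (Opens F)
    set J := Finset.univ.sup j₀
    refine ⟨k + J, z ◃ den θ h ^ J, fun κ hκ hκU =>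
      hj₀ κ J (Finset.le_sup (Finset.mem_univ κ)) hκ hκU, ?_⟩
    rw [pow_add, act_mul, hz, res_act, map_pow]

lemma IsSubsheafOn.mem_extend {E : Coh θ F} {U : Set (Opens F)}
    {M : ∀ κ : Opens F, Submodule (chart θ κ.1)ᵐᵒᵖ (sections E.obj κ)} (H : IsSubsheafOn E U M)
    {ρ : Opens F} {y : sections E.obj ρ} :
    y ∈ H.extend.mod ρ ↔ ∀ κ (h : κ ≤ ρ), κ ∈ U → res h y ∈ M κ := Iff.rfl

lemma IsSubsheafOn.extend_mod {E : Coh θ F} {U : Set (Opens F)}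
    {M : ∀ κ : Opens F, Submodule (chart θ κ.1)ᵐᵒᵖ (sections E.obj κ)} (H : IsSubsheafOn E U M)
    {ρ : Opens F} (hρ : ρ ∈ U) : H.extend.mod ρ = M ρ := by
  ext y
  rw [H.mem_extend]
  exact ⟨fun h => by simpa only [res_refl] using h ρ le_rfl hρ,
    fun hy κ h _ => H.res_mem h hρ y hy⟩

/-- The localizations of a submodule of the sections over an affine open set. -/
def localize {E : Coh θ F} {σ : Opens F} (N : Submodule (chart θ σ.1)ᵐᵒᵖ (sections E.obj σ))
    (κ : Opens F) : Submodule (chart θ κ.1)ᵐᵒᵖ (sections E.obj κ) :=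
  Submodule.span _ {y | ∃ (h : κ ≤ σ) (x : sections E.obj σ), x ∈ N ∧ res h x = y}

lemma localize_eq {E : Coh θ F} {κ σ : Opens F} (h : κ ≤ σ)
    (N : Submodule (chart θ σ.1)ᵐᵒᵖ (sections E.obj σ)) :
    localize N κ = Submodule.span _ (res h '' (N : Set (sections E.obj σ))) := by
  refine congrArg _ (Set.ext fun y => ⟨?_, ?_⟩)
  · rintro ⟨_, x, hx, rfl⟩; exact ⟨x, hx, rfl⟩
  · rintro ⟨x, hx, rfl⟩; exact ⟨h, x, hx, rfl⟩

lemma localize_self {E : Coh θ F} {σ : Opens F}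
    (N : Submodule (chart θ σ.1)ᵐᵒᵖ (sections E.obj σ)) : localize N σ = N := by
  rw [localize_eq le_rfl]
  have : res (le_refl σ) '' (N : Set (sections E.obj σ)) = N := by
    simp only [res_refl, Set.image_id']
  rw [this, Submodule.span_eq]

lemma res_mem_localize {E : Coh θ F} {κ σ : Opens F} (h : κ ≤ σ)
    {N : Submodule (chart θ σ.1)ᵐᵒᵖ (sections E.obj σ)} {x : sections E.obj σ} (hx : x ∈ N) :
    res h x ∈ localize N κ := Submodule.subset_span ⟨h, x, hx, rfl⟩

lemma isSubsheafOn_localize {E : Coh θ F} {σ : Opens F}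
    (N : Submodule (chart θ σ.1)ᵐᵒᵖ (sections E.obj σ)) :
    IsSubsheafOn E {κ | κ ≤ σ} (localize N) where
  down h hσ := h.trans hσ
  res_mem {τ κ} h hκ e he := by
    induction he using Submodule.span_induction with
    | mem e he =>
      obtain ⟨hκ, x, hx, rfl⟩ := he
      rw [res_res]
      exact res_mem_localize _ hx
    | zero => rw [map_zero]; exact zero_mem _
    | add x y _ _ hx hy => rw [map_add]; exact add_mem hx hy
    | smul a x _ hx =>
      have : res h (x ◃ a.unop) ∈ localize N τ := by rw [res_act]; exact act_mem hx _
      exact this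
  exists_res {τ κ} h hκ y hy := by
    have hy' : y ∈ Submodule.span (chart θ τ.1)ᵐᵒᵖ
        (res h '' (localize N κ : Set (sections E.obj κ))) := by
      refine Submodule.span_mono ?_ hy
      rintro _ ⟨hτ, x, hx, rfl⟩
      exact ⟨res hκ x, res_mem_localize _ hx, res_res _ _ _⟩
    obtain ⟨k, hk⟩ := exists_res_of_mem_span h hy'
    obtain ⟨x, hx, hxy⟩ := hk k le_rfl
    exact ⟨k, x, hx, hxy⟩

/-- The largest subsheaf with given sections over an affine open set. -/
def extendFrom {E : Coh θ F} {σ : Opens F}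
    (N : Submodule (chart θ σ.1)ᵐᵒᵖ (sections E.obj σ)) : Subsheaf E :=
  (isSubsheafOn_localize N).extend

lemma extendFrom_mod {E : Coh θ F} {σ : Opens F}
    (N : Submodule (chart θ σ.1)ᵐᵒᵖ (sections E.obj σ)) : (extendFrom N).mod σ = N :=
  ((isSubsheafOn_localize N).extend_mod (le_refl σ)).trans (localize_self N)

/-! ## Coherent subsheaves -/

/-- Induction on the number of cones outside `U`. A minimal such cone `ρ` has all its proper faces
in `U`; over `ρ` it suffices to take finitely many sections whose localizations generate `M` on
those faces. -/
lemma IsSubsheafOn.exists_coherent {E : Coh θ F} {U : Set (Opens F)}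
    {M : ∀ κ : Opens F, Submodule (chart θ κ.1)ᵐᵒᵖ (sections E.obj κ)} (H : IsSubsheafOn E U M)
    (hM : ∀ κ ∈ U, (M κ).FG) :
    ∃ N : Subsheaf E, (∀ κ ∈ U, N.mod κ = M κ) ∧ ∀ κ, (N.mod κ).FG := by
  classical
  induction hc : Uᶜ.ncard using Nat.strong_induction_on generalizing U M with
  | _ c ih =>
  rcases Uᶜ.eq_empty_or_nonempty with hU | hU
  · have hU' : ∀ κ, κ ∈ U := fun κ => by
      rw [Set.compl_empty_iff] at hU; rw [hU]; trivial
    exact ⟨H.extend, fun κ hκ => H.extend_mod hκ, fun κ => by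
      rw [H.extend_mod (hU' κ)]; exact hM κ (hU' κ)⟩
  obtain ⟨ρ, hρ⟩ := (Set.toFinite Uᶜ).exists_minimal hU
  have hlt : ∀ κ, κ ≤ ρ → κ ≠ ρ → κ ∈ U := fun κ hκ hne => by
    by_contra hκU
    exact hne (le_antisymm hκ (hρ.2 hκU hκ))
  have hsec : ∀ κ : Opens F, ∃ Z : Set (sections E.obj ρ), Z.Finite ∧ Z ⊆ H.extend.mod ρ ∧
      ∀ h : κ ≤ ρ, κ ∈ U → M κ ≤ Submodule.span _ (res h '' Z) := by
    intro κ
    by_cases hκ : κ ≤ ρ ∧ κ ∈ U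
    swap
    · exact ⟨∅, Set.finite_empty, Set.empty_subset _, fun h hκU => absurd ⟨h, hκU⟩ hκ⟩
    obtain ⟨hκ, hκU⟩ := hκ
    obtain ⟨G, hG⟩ := hM κ hκU
    have hGM : ∀ g ∈ G, g ∈ H.extend.mod κ := fun g hg => by
      rw [H.extend_mod hκU, ← hG]; exact Submodule.subset_span hg
    choose! k x hx hgx using fun g hg => H.extend.exists_res hκ (hGM g hg)
    refine ⟨x '' G, G.finite_toSet.image x, ?_, fun _ _ => ?_⟩
    · rintro _ ⟨g, hg, rfl⟩; exact hx g hg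
    · rw [← hG, Submodule.span_le]
      intro g hg
      refine mem_of_act_den_pow_mem hκ (k g) ?_
      rw [hgx g hg]
      exact Submodule.subset_span ⟨x g, ⟨g, hg, rfl⟩, rfl⟩
  choose Z hZf hZX hZ using hsec
  set Zρ := ⋃ κ, Z κ
  -- The lifts in `Zρ` are taken inside the maximal extension, so that the module they generate
  -- still restricts into `M` on every face.
  set Mρ : Submodule (chart θ ρ.1)ᵐᵒᵖ (sections E.obj ρ) := Submodule.span _ Zρ
  have hMρ : Mρ ≤ H.extend.mod ρ := Submodule.span_le.2 (Set.iUnion_subset hZX)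
  set M' := Function.update M ρ Mρ
  have hM'ρ : M' ρ = Mρ := Function.update_self _ _ _
  have hM' : ∀ κ, κ ≠ ρ → M' κ = M κ := fun κ hκ => Function.update_of_ne hκ _ _
  have hne : ∀ κ ∈ U, κ ≠ ρ := fun κ hκ h => hρ.1 (h ▸ hκ)
  have H' : IsSubsheafOn E (insert ρ U) M' := by
    refine ⟨?_, ?_, ?_⟩
    · rintro τ σ h (rfl | hσ)
      · by_cases hτ : τ = σ
        · exact Or.inl hτ
        · exact Or.inr (hlt τ h hτ)
      · exact Or.inr (H.down h hσ)
    · intro τ σ h hσ e he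
      rcases hσ with hσ | hσ
      · subst hσ
        by_cases hτ : τ = σ
        · subst hτ; rwa [res_refl]
        · rw [hM' τ hτ]
          rw [hM'ρ] at he
          exact hMρ he τ h (hlt τ h hτ)
      · rw [hM' σ (hne σ hσ)] at he
        rw [hM' τ (hne τ (H.down h hσ))]
        exact H.res_mem h hσ e he
    · intro τ σ h hσ y hy
      rcases hσ with hσ | hσ
      · subst hσ
        by_cases hτ : τ = σ
        · subst hτ; exact ⟨0, y, hy, by rw [pow_zero, act_one, res_refl]⟩
        · rw [hM' τ hτ] at hy
          have h1 := hZ τ h (hlt τ h hτ) hy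
          have h2 : y ∈ Submodule.span (chart θ τ.1)ᵐᵒᵖ
              (res h '' (Mρ : Set (sections E.obj σ))) :=
            Submodule.span_mono (Set.image_mono
              ((Set.subset_iUnion Z τ).trans Submodule.subset_span)) h1
          obtain ⟨k, hk⟩ := exists_res_of_mem_span h h2
          obtain ⟨x, hx, hxy⟩ := hk k le_rfl
          exact ⟨k, x, by rwa [hM'ρ], hxy⟩
      · rw [hM' τ (hne τ (H.down h hσ))] at hy
        rw [hM' σ (hne σ hσ)]
        exact H.exists_res h hσ y hy
  obtain ⟨N, hN, hNf⟩ := ih _ (by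
    rw [← hc]
    refine Set.ncard_lt_ncard ?_ (Set.toFinite _)
    exact compl_lt_compl_iff_lt.2 (Set.ssubset_insert hρ.1)) H' (by
      rintro κ (rfl | hκ)
      · rw [hM'ρ]; exact Submodule.fg_span (Set.finite_iUnion hZf)
      · rw [hM' κ (hne κ hκ)]; exact hM κ hκ) rfl
  exact ⟨N, fun κ hκ => (hN κ (Or.inr hκ)).trans (hM' κ (hne κ hκ)), hNf⟩

/-- Every section of a quasi-coherent sheaf lies in a coherent subsheaf. -/
lemma exists_coherent_subsheaf {E : Coh θ F} {σ : Opens F} (e : sections E.obj σ) :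
    ∃ N : Subsheaf E, e ∈ N.mod σ ∧ ∀ κ, (N.mod κ).FG := by
  set M := Submodule.span (chart θ σ.1)ᵐᵒᵖ {e}
  obtain ⟨N, hN, hNf⟩ := (isSubsheafOn_localize M).exists_coherent (fun κ hκ => by
    have hκ' : κ ≤ σ := hκ
    refine ⟨{res hκ' e}, le_antisymm ?_ ?_⟩
    · rw [Finset.coe_singleton, Submodule.span_le, Set.singleton_subset_iff]
      exact res_mem_localize hκ' (Submodule.mem_span_singleton_self e)
    · rw [localize_eq hκ', Submodule.span_le, Finset.coe_singleton]
      rintro _ ⟨x, hx, rfl⟩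
      obtain ⟨a, rfl⟩ := Submodule.mem_span_singleton.1 hx
      have : res hκ' (e ◃ a.unop) ∈ Submodule.span (chart θ κ.1)ᵐᵒᵖ {res hκ' e} := by
        rw [res_act]; exact act_mem (Submodule.mem_span_singleton_self _) _
      exact this)
  refine ⟨N, ?_, hNf⟩
  rw [hN σ (le_refl σ), localize_self]
  exact Submodule.mem_span_singleton_self e

end NCToric

/-! ### Direct images from charts and the structure sheaf -/

namespace NCToric

variable {n : ℕ} {θ : Matrix (Fin n) (Fin n) ℂ} {F : Fan n}

/-! ## The direct image from an affine open set -/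

lemma inter_mono (σ : Opens F) {ρ' ρ : Opens F} (h : ρ' ≤ ρ) : σ.inter ρ' ≤ σ.inter ρ :=
  (inf_le_inf_left σ.1 h : σ.1 ⊓ ρ'.1 ≤ σ.1 ⊓ ρ.1)

lemma le_inter {κ σ ρ : Opens F} (h : κ ≤ σ) (h' : κ ≤ ρ) : κ ≤ σ.inter ρ :=
  (le_inf h h' : κ.1 ≤ σ.1 ⊓ ρ.1)

/-- The sections of `E` over `U[σ ∩ ρ]` as a module over the coordinate algebra of `U[ρ]`. -/
@[ext]
structure InterSections (E : Coh θ F) (σ ρ : Opens F) : Type where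
  val : sections E.obj (σ.inter ρ)

namespace InterSections

variable {E : Coh θ F} {σ ρ : Opens F}

/-- The sections over the intersection, as a wrapped set. -/
def equiv : InterSections E σ ρ ≃ sections E.obj (σ.inter ρ) :=
  ⟨InterSections.val, InterSections.mk, fun _ => rfl, fun _ => rfl⟩

instance : AddCommGroup (InterSections E σ ρ) := equiv.addCommGroup

lemma val_add (x y : InterSections E σ ρ) : (x + y).val = x.val + y.val := rfl

instance : Module (chart θ ρ.1)ᵐᵒᵖ (InterSections E σ ρ) where
  smul a x := ⟨x.val ◃ incl (σ.inter_le_right ρ) a.unop⟩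
  one_smul x := InterSections.ext (by
    change x.val ◃ incl (σ.inter_le_right ρ) 1 = x.val
    rw [map_one, act_one])
  mul_smul a b x := InterSections.ext (by
    change x.val ◃ incl (σ.inter_le_right ρ) (b.unop * a.unop) =
      x.val ◃ incl (σ.inter_le_right ρ) b.unop ◃ incl (σ.inter_le_right ρ) a.unop
    rw [map_mul, act_mul])
  smul_zero a := InterSections.ext (zero_act _)
  smul_add a x y := InterSections.ext (add_act _ _ _)
  add_smul a b x := InterSections.ext (by
    change x.val ◃ incl (σ.inter_le_right ρ) (a.unop + b.unop) =
      x.val ◃ incl (σ.inter_le_right ρ) a.unop + x.val ◃ incl (σ.inter_le_right ρ) b.unop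
    rw [map_add, act_add])
  zero_smul x := InterSections.ext (by
    change x.val ◃ incl (σ.inter_le_right ρ) 0 = 0
    rw [map_zero, act_zero])

lemma val_act (x : InterSections E σ ρ) (a : chart θ ρ.1) :
    (x ◃ a).val = x.val ◃ incl (σ.inter_le_right ρ) a := rfl

/-- The wrapping as an additive equivalence. -/
def addEquiv : InterSections E σ ρ ≃+ sections E.obj (σ.inter ρ) :=
  { equiv with map_add' := val_add }

end InterSections

/-- The data of the direct image of the restriction of `E` to `U[σ]`. -/
def directData (E : Coh θ F) (σ : Opens F) : SheafData θ F where
  carrier ρ := InterSections E σ ρ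
  res {ρ' ρ} h := (InterSections.addEquiv.symm.toAddMonoidHom.comp
    (res (E := E.obj) (inter_mono σ h))).comp InterSections.addEquiv.toAddMonoidHom
  res_act {ρ' ρ} h x a := InterSections.ext (by
    change res (inter_mono σ h) (x ◃ a).val =
      res (inter_mono σ h) x.val ◃ incl (σ.inter_le_right _) (incl h a)
    rw [InterSections.val_act, res_act, incl_incl, incl_incl])
  res_refl _ x := InterSections.ext (res_refl x.val)
  res_trans h h' x := InterSections.ext (res_res (inter_mono σ h) (inter_mono σ h') x.val)

/-- Sections of a direct image. -/
def directDataSections (E : Coh θ F) (σ ρ : Opens F) :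
    sections (directData E σ).sheaf ρ ≃+ sections E.obj (σ.inter ρ) :=
  InterSections.addEquiv

lemma directDataSections_act {E : Coh θ F} {σ ρ : Opens F}
    (x : sections (directData E σ).sheaf ρ) (a : chart θ ρ.1) :
    directDataSections E σ ρ (x ◃ a) =
      directDataSections E σ ρ x ◃ incl (σ.inter_le_right ρ) a := rfl

lemma directDataSections_res {E : Coh θ F} {σ ρ ρ' : Opens F} (h : ρ' ≤ ρ)
    (x : sections (directData E σ).sheaf ρ) :
    directDataSections E σ ρ' (res h x) = res (inter_mono σ h) (directDataSections E σ ρ x) := rfl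

/-- The direct image of the restriction of `E` to `U[σ]`, with sections `E(σ ∩ ρ)` over `U[ρ]`. -/
def direct (E : Coh θ F) (σ : Opens F) : Coh θ F where
  obj := (directData E σ).sheaf
  property := by
    rw [isQuasiCoherent_iff]
    intro ρ' ρ h
    -- This inclusion allows the denominator of `ρ'` in `ρ`, which acts on the direct image, to
    -- replace the denominator of `σ ∩ ρ'` in `σ ∩ ρ`, for which fractions in `E` are known.
    have hle : (σ.inter ρ).1 ⊓ ρ'.1 ≤ (σ.inter ρ').1 := fun u hu => ⟨hu.1.1, hu.2⟩
    refine ⟨fun y => ?_, fun x hx => ?_⟩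
    · obtain ⟨k, hk⟩ := exists_act_den_pow_eq_res E (inter_mono σ h) (directDataSections E σ ρ' y)
      obtain ⟨x, hx⟩ := hk k le_rfl
      obtain ⟨j, hj⟩ := exists_act_den_pow_eq_res_of_inter h (σ.inter_le_right ρ)
        (inter_mono σ h) hle (M := ⊤) Submodule.mem_top hx
      obtain ⟨x', -, hx'⟩ := hj j le_rfl
      refine ⟨j, (directDataSections E σ ρ).symm x', (directDataSections E σ ρ').injective ?_⟩
      rw [directDataSections_res, AddEquiv.apply_symm_apply, directDataSections_act, ← hx', map_pow,
        incl_incl]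
    · rw [← (directDataSections E σ ρ').injective.eq_iff, directDataSections_res, map_zero] at hx
      obtain ⟨k, hk⟩ := exists_act_den_pow_eq_zero_of_inter (E := E) h (σ.inter_le_right ρ)
        (inter_mono σ h) hle hx
      refine ⟨k, (directDataSections E σ ρ).injective ?_⟩
      rw [directDataSections_act, map_zero, map_pow, hk k le_rfl]

/-- Sections of a direct image. -/
def directSections (E : Coh θ F) (σ ρ : Opens F) :
    sections (direct E σ).obj ρ ≃+ sections E.obj (σ.inter ρ) := directDataSections E σ ρ

lemma directSections_act {E : Coh θ F} {σ ρ : Opens F} (x : sections (direct E σ).obj ρ)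
    (a : chart θ ρ.1) :
    directSections E σ ρ (x ◃ a) = directSections E σ ρ x ◃ incl (σ.inter_le_right ρ) a :=
  directDataSections_act x a

lemma directSections_res {E : Coh θ F} {σ ρ ρ' : Opens F} (h : ρ' ≤ ρ)
    (x : sections (direct E σ).obj ρ) :
    directSections E σ ρ' (res h x) = res (inter_mono σ h) (directSections E σ ρ x) :=
  directDataSections_res h x

/-- A morphism to a direct image. -/
def homToDirect {E E' : Coh θ F} {σ : Opens F}
    (f : ∀ ρ : Opens F, sections E'.obj ρ →+ sections E.obj (σ.inter ρ))
    (hf : ∀ ρ (x : sections E'.obj ρ) (a : chart θ ρ.1),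
      f ρ (x ◃ a) = f ρ x ◃ incl (σ.inter_le_right ρ) a)
    (hf' : ∀ {ρ' ρ : Opens F} (h : ρ' ≤ ρ) (x : sections E'.obj ρ),
      f ρ' (res h x) = res (inter_mono σ h) (f ρ x)) :
    E' ⟶ direct E σ :=
  homOfSections (fun ρ => linearOfAct ((directSections E σ ρ).symm.toAddMonoidHom.comp (f ρ))
    (fun x a => (directSections E σ ρ).injective (by
      rw [directSections_act]
      exact ((directSections E σ ρ).apply_symm_apply _).trans ((hf ρ x a).trans
        (congrArg (· ◃ incl (σ.inter_le_right ρ) a)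
          ((directSections E σ ρ).apply_symm_apply (f ρ x)).symm)))))
    (fun {ρ' ρ} h x => (directSections E σ ρ').injective (by
      rw [directSections_res]
      exact ((directSections E σ ρ').apply_symm_apply _).trans ((hf' h x).trans
        (congrArg (res (inter_mono σ h)) ((directSections E σ ρ).apply_symm_apply (f ρ x)).symm))))

/-- The canonical morphism to the direct image. -/
def toDirect (E : Coh θ F) (σ : Opens F) : E ⟶ direct E σ :=
  homToDirect (fun ρ => res (σ.inter_le_right ρ)) (fun ρ x a => res_act (σ.inter_le_right ρ) x a)
    (fun h x => by rw [res_res, res_res])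

lemma directSections_toDirect (E : Coh θ F) (σ ρ : Opens F) (x : sections E.obj ρ) :
    directSections E σ ρ (onSections (toDirect E σ) ρ x) = res (σ.inter_le_right ρ) x :=
  (directSections E σ ρ).apply_symm_apply (res (σ.inter_le_right ρ) x)

/-! ## Localization of linear maps -/

section Loc

variable {E E' : Coh θ F} {σ : Opens F}
  (f : sections E.obj σ →ₗ[(chart θ σ.1)ᵐᵒᵖ] sections E'.obj σ)

/-- With `s` the denominator, the fraction `x s^{-k}` is sent to `f(x) s^{-k}`. Two expressions of
the same section agree on the larger set after a power of `s`, and `f` preserves that relation, so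
the value does not depend on the expression. -/
lemma exists_loc {τ : Opens F} (h : τ ≤ σ) (y : sections E.obj τ) :
    ∃ z : sections E'.obj τ, ∀ (k : ℕ) (x : sections E.obj σ),
      y ◃ incl h (den θ h) ^ k = res h x → z ◃ incl h (den θ h) ^ k = res h (f x) := by
  obtain ⟨j, hj⟩ := exists_act_den_pow_eq_res E h y
  obtain ⟨x', hx'⟩ := hj j le_rfl
  obtain ⟨u, -, hu⟩ := isUnit_den_pow (θ := θ) h j
  refine ⟨res h (f x') ◃ u, fun k x hx => ?_⟩
  have h0 : res h (x ◃ den θ h ^ j - x' ◃ den θ h ^ k) = 0 := by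
    rw [map_sub, res_act, res_act, ← hx, ← hx', map_pow, map_pow, ← act_mul, ← act_mul, ← pow_add,
      ← pow_add, add_comm, sub_self]
  obtain ⟨i, hi⟩ := exists_act_den_pow_eq_zero h h0
  have h1 := congrArg f (hi i le_rfl)
  rw [map_act, map_zero] at h1
  have h2 := res_eq_zero_of_act_den_pow h h1
  rw [map_sub, map_sub, map_act, map_act, sub_eq_zero, res_act, res_act, map_pow, map_pow] at h2
  refine act_den_pow_injective (θ := θ) h j ?_
  rw [h2, ← act_mul, ← pow_add, add_comm, pow_add, ← act_mul, ← mul_assoc, hu, one_mul]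

/-- The underlying map of the localization of a linear map. -/
def locFun {τ : Opens F} (h : τ ≤ σ) (y : sections E.obj τ) : sections E'.obj τ :=
  (exists_loc f h y).choose

lemma locFun_spec {τ : Opens F} (h : τ ≤ σ) {y : sections E.obj τ} {k : ℕ} {x : sections E.obj σ}
    (hx : y ◃ incl h (den θ h) ^ k = res h x) :
    locFun f h y ◃ incl h (den θ h) ^ k = res h (f x) := (exists_loc f h y).choose_spec k x hx

lemma locFun_add {τ : Opens F} (h : τ ≤ σ) (y y' : sections E.obj τ) :
    locFun f h (y + y') = locFun f h y + locFun f h y' := by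
  obtain ⟨k, hk⟩ := exists_act_den_pow_eq_res E h y
  obtain ⟨k', hk'⟩ := exists_act_den_pow_eq_res E h y'
  obtain ⟨x, hx⟩ := hk (k + k') (Nat.le_add_right _ _)
  obtain ⟨x', hx'⟩ := hk' (k + k') (Nat.le_add_left _ _)
  refine act_den_pow_injective (θ := θ) h (k + k') ?_
  rw [locFun_spec f h (y := y + y') (k := k + k') (x := x + x')
    (by rw [add_act, hx, hx', map_add]), add_act, locFun_spec f h hx,
    locFun_spec f h hx', map_add, map_add]

lemma locFun_act {τ : Opens F} (h : τ ≤ σ) (y : sections E.obj τ) (a : chart θ τ.1) :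
    locFun f h (y ◃ a) = locFun f h y ◃ a := by
  obtain ⟨k, hk⟩ := exists_act_den_pow_eq_res E h y
  obtain ⟨x, hx⟩ := hk k le_rfl
  obtain ⟨j, hj⟩ := exists_act_eq_res h hx a
  obtain ⟨b, b', hb, hb', hy⟩ := hj j le_rfl
  refine act_den_pow_injective (θ := θ) h (j + k) ?_
  rw [locFun_spec f h hy, map_act, res_act, ← locFun_spec f h hx, ← act_mul, ← act_mul, pow_add,
    ← mul_assoc, hb, ← map_pow, ← map_mul, ← map_mul, hb']

/-- The localization of a linear map. -/
def loc {τ : Opens F} (h : τ ≤ σ) :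
    sections E.obj τ →ₗ[(chart θ τ.1)ᵐᵒᵖ] sections E'.obj τ :=
  linearOfAct (AddMonoidHom.mk' (locFun f h) (locFun_add f h)) (locFun_act f h)

lemma loc_spec {τ : Opens F} (h : τ ≤ σ) {y : sections E.obj τ} {k : ℕ} {x : sections E.obj σ}
    (hx : y ◃ incl h (den θ h) ^ k = res h x) :
    loc f h y ◃ incl h (den θ h) ^ k = res h (f x) := locFun_spec f h hx

lemma loc_res {τ : Opens F} (h : τ ≤ σ) (x : sections E.obj σ) :
    loc f h (res h x) = res h (f x) := by
  have := loc_spec f h (y := res h x) (k := 0) (x := x) (by rw [pow_zero, act_one])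
  rwa [pow_zero, act_one] at this

lemma res_loc {κ τ : Opens F} (h : τ ≤ σ) (h' : κ ≤ τ) (y : sections E.obj τ) :
    loc f (h'.trans h) (res h' y) = res h' (loc f h y) := by
  obtain ⟨k, hk⟩ := exists_act_den_pow_eq_res E h y
  obtain ⟨x, hx⟩ := hk k le_rfl
  obtain ⟨u, hu, -⟩ := isUnit_den_pow (θ := θ) h k
  have h1 : loc f (h'.trans h) (res h' y) ◃ incl h' (incl h (den θ h) ^ k) =
      res h' (loc f h y) ◃ incl h' (incl h (den θ h) ^ k) := by
    rw [← map_act, ← res_act, hx, res_res, loc_res, ← res_act, loc_spec f h hx, res_res]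
  have h2 := congrArg (· ◃ incl h' u) h1
  simpa only [← act_mul, ← map_mul, hu, map_one, act_one] using h2

/-- The morphism of direct images induced by a linear map of sections over `U[σ]`. -/
def directMap : direct E σ ⟶ direct E' σ :=
  homToDirect (fun ρ => (loc f (σ.inter_le_left ρ)).toAddMonoidHom.comp
    (directSections E σ ρ).toAddMonoidHom)
    (fun ρ x a => by
      change loc f _ (directSections E σ ρ (x ◃ a)) = loc f _ (directSections E σ ρ x) ◃ _
      rw [directSections_act, map_act])
    (fun {ρ' ρ} h x => by
      change loc f _ (directSections E σ ρ' (res h x)) =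
        res (inter_mono σ h) (loc f _ (directSections E σ ρ x))
      rw [directSections_res]
      exact res_loc f (σ.inter_le_left ρ) (inter_mono σ h) (directSections E σ ρ x))

lemma directSections_directMap (ρ : Opens F) (x : sections (direct E σ).obj ρ) :
    directSections E' σ ρ (onSections (directMap f) ρ x) =
      loc f (σ.inter_le_left ρ) (directSections E σ ρ x) :=
  (directSections E' σ ρ).apply_symm_apply (loc f (σ.inter_le_left ρ) (directSections E σ ρ x))

end Loc

/-! ## The structure sheaf -/

variable (θ F) in
/-- The data of the structure sheaf. -/
def unitData : SheafData θ F where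
  carrier σ := chart θ σ.1
  res h := (incl h : chart θ _ →ₐ[ℂ] chart θ _)
  res_act h x a := map_mul (incl h) x a
  res_refl _ x := incl_refl x
  res_trans h h' x := incl_incl h h' x

variable (θ F) in
/-- The structure sheaf as a quasi-coherent sheaf of right modules. -/
def unit : Coh θ F where
  obj := (unitData θ F).sheaf
  property := by
    rw [isQuasiCoherent_iff]
    intro τ σ h
    refine ⟨fun y => ?_, fun x hx => ?_⟩
    · obtain ⟨k, hk⟩ := exists_mul_den_pow h (show chart θ τ.1 from y)
      obtain ⟨b, hb⟩ := hk k le_rfl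
      exact ⟨k, b, hb⟩
    · have : (show chart θ σ.1 from x) = 0 := incl_injective h (hx.trans (map_zero (incl h)).symm)
      exact ⟨0, by rw [show x = 0 from this, zero_act]⟩

/-- Sections of the structure sheaf. -/
def unitSections (σ : Opens F) : sections (unit θ F).obj σ ≃ₗ[(chart θ σ.1)ᵐᵒᵖ] chart θ σ.1 :=
  LinearEquiv.refl _ _

lemma unitSections_act {σ : Opens F} (x : sections (unit θ F).obj σ) (a : chart θ σ.1) :
    unitSections σ (x ◃ a) = unitSections σ x * a := rfl

end NCToric

/-! ### What the two adjoints give, and cyclic modules -/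

namespace NCToric

variable {n : ℕ} {θ : Matrix (Fin n) (Fin n) ℂ} {F : Fan n}

lemma act_sub {σ : Opens F} {M : Type} [AddCommGroup M] [Module (chart θ σ.1)ᵐᵒᵖ M]
    (e : M) (a b : chart θ σ.1) : e ◃ (a - b) = e ◃ a - e ◃ b := by
  simp only [act, MulOpposite.op_sub, sub_smul]

/-! ## Membership criteria for closed subschemes -/

namespace IsClosedSubscheme

variable {Y : ObjectProperty (Coh θ F)}

lemma prop_of_injective (hY : IsClosedSubscheme Y) {E E' : Coh θ F} (f : E ⟶ E')
    (hf : ∀ σ, Function.Injective (onSections f σ)) (h : Y E') : Y E := by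
  have := hY.subobjects
  have := mono_of_injective f hf
  exact Y.prop_of_mono f h

lemma prop_of_bijective (hY : IsClosedSubscheme Y) {E E' : Coh θ F} (f : E ⟶ E')
    (hf : ∀ σ, Function.Bijective (onSections f σ)) (h : Y E) : Y E' := by
  have := isIso_of_bijective f hf
  have := hY.subobjects
  exact Y.prop_of_mono (inv f) h

/-- A sheaf whose sections are separated by morphisms to members is a member. -/
lemma prop_of_separated (hY : IsClosedSubscheme Y) {Q : Coh θ F}
    (hQ : ∀ N : Subsheaf Q, (∀ E (_ : Y E) (f : Q ⟶ E) σ, ∀ x ∈ N.mod σ, onSections f σ x = 0) →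
      ∀ σ, ∀ x ∈ N.mod σ, x = 0) : Y Q := by
  have := hY.exists_leftAdjoint
  let adj := Adjunction.ofIsRightAdjoint Y.ι
  -- Every morphism from `Q` to a member factors through the unit, so it vanishes on the kernel of
  -- the unit; by hypothesis this kernel is zero, and `Q` is a subobject of a member.
  refine hY.prop_of_injective (adj.unit.app Q) (fun σ => ?_) (ObjectProperty.FullSubcategory.property _)
  rw [injective_iff_map_eq_zero]
  intro x hx
  refine hQ (kernelSubsheaf (adj.unit.app Q)) (fun E hE f τ y hy => ?_) σ x hx
  obtain ⟨g, rfl⟩ := (adj.homEquiv Q ⟨E, hE⟩).surjective f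
  rw [adj.homEquiv_unit, onSections_comp]
  exact (congrArg _ (LinearMap.mem_ker.1 hy)).trans (map_zero _)

/-- A sheaf generated by images of members is a member. -/
lemma prop_of_generated (hY : IsClosedSubscheme Y) {Q : Coh θ F}
    (hQ : ∀ N : Subsheaf Q, (∀ E (_ : Y E) (f : E ⟶ Q) σ x, onSections f σ x ∈ N.mod σ) →
      ∀ σ x, x ∈ N.mod σ) : Y Q := by
  have := hY.exists_rightAdjoint
  let adj := Adjunction.ofIsLeftAdjoint Y.ι
  set ε := adj.counit.app Q
  refine hY.prop_of_bijective ε (fun σ => ⟨?_, fun x => ?_⟩) (ObjectProperty.FullSubcategory.property _)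
  -- The kernel of the counit is a subobject of a member, hence a member. Its inclusion and the zero
  -- map have the same composite with the counit, so the adjunction identifies them.
  · let K : Y.FullSubcategory := ⟨(kernelSubsheaf ε).obj,
      hY.prop_of_injective _ (kernelSubsheaf ε).ι_injective (ObjectProperty.FullSubcategory.property _)⟩
    let a : K ⟶ (Y.ι.rightAdjoint.obj Q) := ObjectProperty.homMk (kernelSubsheaf ε).ι
    let b : K ⟶ (Y.ι.rightAdjoint.obj Q) :=
      ObjectProperty.homMk (homOfSections (fun _ => 0) (fun h x => by simp))
    have hab : a = b := by
      apply (adj.homEquiv K Q).symm.injective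
      rw [adj.homEquiv_counit, adj.homEquiv_counit]
      refine hom_ext_sections fun τ x => ?_
      rw [onSections_comp, onSections_comp]
      exact (LinearMap.mem_ker.1 ((kernelSubsheaf ε).ι_mem τ x)).trans
        (map_zero (onSections ε τ)).symm
    rw [injective_iff_map_eq_zero]
    intro x hx
    obtain ⟨y, rfl⟩ := (kernelSubsheaf ε).exists_ι_eq (LinearMap.mem_ker.2 hx)
    have h1 : (kernelSubsheaf ε).ι = homOfSections (fun _ => 0) (fun h x => by simp) :=
      congrArg (fun f => f.hom) hab
    rw [h1]
    rfl
  -- Every morphism from a member to `Q` factors through the counit, so the image of the counit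
  -- contains all the generating images.
  · refine hQ (imageSubsheaf ε) (fun E hE f τ y => ?_) σ x
    obtain ⟨g, rfl⟩ := (adj.homEquiv ⟨E, hE⟩ Q).symm.surjective f
    rw [adj.homEquiv_counit, onSections_comp]
    exact ⟨_, rfl⟩

end IsClosedSubscheme

/-! ## More on direct images -/

lemma res_injective_of_ge {E : Coh θ F} {τ σ : Opens F} (h : τ ≤ σ) (h' : σ ≤ τ) :
    Function.Injective (res (E := E.obj) h) := fun x y hxy => by
  simpa only [res_res, res_refl] using congrArg (res h') hxy

lemma res_surjective_of_ge {E : Coh θ F} {τ σ : Opens F} (h : τ ≤ σ) (h' : σ ≤ τ) :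
    Function.Surjective (res (E := E.obj) h) := fun x =>
  ⟨res h' x, by rw [res_res, res_refl]⟩

/-- Sections of a direct image over a smaller open set. -/
def directEval (E : Coh θ F) {τ σ : Opens F} (h : τ ≤ σ) :
    sections (direct E σ).obj τ →ₗ[(chart θ τ.1)ᵐᵒᵖ] sections E.obj τ :=
  linearOfAct ((res (le_inter h le_rfl)).comp (directSections E σ τ).toAddMonoidHom)
    (fun x a => by
      change res _ (directSections E σ τ (x ◃ a)) = res _ (directSections E σ τ x) ◃ a
      rw [directSections_act, res_act, incl_incl, incl_refl])

lemma directEval_eq {E : Coh θ F} {τ σ : Opens F} (h : τ ≤ σ)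
    (x : sections (direct E σ).obj τ) :
    directEval E h x = res (le_inter h le_rfl) (directSections E σ τ x) := rfl

lemma directEval_bijective (E : Coh θ F) {τ σ : Opens F} (h : τ ≤ σ) :
    Function.Bijective (directEval E h) :=
  ⟨(res_injective_of_ge _ (σ.inter_le_right τ)).comp (directSections E σ τ).injective,
    (res_surjective_of_ge _ (σ.inter_le_right τ)).comp (directSections E σ τ).surjective⟩

/-- Both modules consist of sections of `E` over the same cone, since `σ ∩ ρ = σ ∩ τ`. -/
lemma direct_res_bijective (E : Coh θ F) {τ ρ σ : Opens F} (h : τ ≤ ρ) (h' : σ.inter ρ ≤ τ) :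
    Function.Bijective (res (E := (direct E σ).obj) h) := by
  have h1 : (directSections E σ τ) ∘ (res (E := (direct E σ).obj) h) =
      res (inter_mono σ h) ∘ directSections E σ ρ := funext fun x => directSections_res h x
  have h2 : σ.inter ρ ≤ σ.inter τ := le_inter (σ.inter_le_left ρ) h'
  rw [← Function.Bijective.of_comp_iff' (directSections E σ τ).bijective, h1]
  exact Function.Bijective.comp ⟨res_injective_of_ge _ h2, res_surjective_of_ge _ h2⟩
    (directSections E σ ρ).bijective

/-- A subsheaf of a direct image from an affine open set vanishes if it has no sections there. -/
lemma subsheaf_direct_eq_zero {E : Coh θ F} {σ : Opens F} {N : Subsheaf (direct E σ)}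
    (hN : ∀ x ∈ N.mod σ, x = 0) {ρ : Opens F} {x : sections (direct E σ).obj ρ}
    (hx : x ∈ N.mod ρ) : x = 0 := by
  apply (direct_res_bijective E (σ.inter_le_right ρ) le_rfl).1
  obtain ⟨k, z, hz, hz'⟩ := N.exists_res (σ.inter_le_left ρ) (N.res_mem (σ.inter_le_right ρ) hx)
  refine act_den_pow_injective (θ := θ) (σ.inter_le_left ρ) k ?_
  rw [hz', hN z hz, map_zero, map_zero, zero_act]

/-- A direct image from `U[τ]` is its own direct image from any larger `U[σ]`. This is what relates
the ideals of `Y` on different cones. -/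
lemma toDirect_bijective_of_le (E : Coh θ F) {τ σ : Opens F} (h : τ ≤ σ) (ρ : Opens F) :
    Function.Bijective (onSections (toDirect (direct E τ) σ) ρ) := by
  rw [← Function.Bijective.of_comp_iff' (directSections (direct E τ) σ ρ).bijective]
  have : directSections (direct E τ) σ ρ ∘ onSections (toDirect (direct E τ) σ) ρ =
      res (σ.inter_le_right ρ) := funext fun x => directSections_toDirect _ _ _ x
  rw [this]
  exact direct_res_bijective E _ (le_inter ((τ.inter_le_left ρ).trans h) (τ.inter_le_right ρ))

lemma toDirect_injective (E : Coh θ F) {ρ σ : Opens F} (h : ρ ≤ σ) :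
    Function.Injective (onSections (toDirect E σ) ρ) := fun x y hxy => by
  have := congrArg (directSections E σ ρ) hxy
  rw [directSections_toDirect, directSections_toDirect] at this
  exact res_injective_of_ge _ (le_inter h le_rfl) this

/-! ## Cyclic sheaves -/

/-- The largest subsheaf of the structure sheaf with a given right ideal of sections. -/
def rightIdealSubsheaf {σ : Opens F} (J : Submodule (chart θ σ.1)ᵐᵒᵖ (chart θ σ.1)) :
    Subsheaf (unit θ F) :=
  extendFrom (J.comap (unitSections σ).toLinearMap)

/-- The class of `1` in `A_σ / J`. -/
def cyclicGen {σ : Opens F} (J : Submodule (chart θ σ.1)ᵐᵒᵖ (chart θ σ.1)) :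
    sections (rightIdealSubsheaf J).quot.obj σ :=
  onSections (rightIdealSubsheaf J).π σ ((unitSections σ).symm 1)

lemma cyclicGen_act_eq_zero_iff {σ : Opens F} {J : Submodule (chart θ σ.1)ᵐᵒᵖ (chart θ σ.1)}
    {a : chart θ σ.1} : cyclicGen J ◃ a = 0 ↔ a ∈ J := by
  rw [cyclicGen, ← map_act, Subsheaf.π_eq_zero_iff, rightIdealSubsheaf, extendFrom_mod,
    Submodule.mem_comap]
  change unitSections σ ((unitSections σ).symm 1 ◃ a) ∈ J ↔ a ∈ J
  rw [unitSections_act, LinearEquiv.apply_symm_apply, one_mul]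

lemma exists_eq_cyclicGen_act {σ : Opens F} {J : Submodule (chart θ σ.1)ᵐᵒᵖ (chart θ σ.1)}
    (x : sections (rightIdealSubsheaf J).quot.obj σ) : ∃ a : chart θ σ.1, x = cyclicGen J ◃ a := by
  obtain ⟨y, rfl⟩ := (rightIdealSubsheaf J).π_surjective σ x
  refine ⟨unitSections σ y, ?_⟩
  rw [cyclicGen, ← map_act]
  congr 1
  apply (unitSections σ).injective
  rw [unitSections_act, LinearEquiv.apply_symm_apply, one_mul]

/-- The linear map out of `A_σ / J` given by an element killed by `J`. -/
lemma exists_linearMap_cyclicGen {σ : Opens F} {J : Submodule (chart θ σ.1)ᵐᵒᵖ (chart θ σ.1)}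
    {M : Type} [AddCommGroup M] [Module (chart θ σ.1)ᵐᵒᵖ M] {e : M} (he : ∀ a ∈ J, e ◃ a = 0) :
    ∃ f : sections (rightIdealSubsheaf J).quot.obj σ →ₗ[(chart θ σ.1)ᵐᵒᵖ] M,
      f (cyclicGen J) = e := by
  choose c hc using fun x => exists_eq_cyclicGen_act (J := J) x
  have key : ∀ x a, x = cyclicGen J ◃ a → e ◃ c x = e ◃ a := fun x a hx => by
    rw [← sub_eq_zero, ← act_sub]
    apply he
    rw [← cyclicGen_act_eq_zero_iff, act_sub, ← hc, ← hx, sub_self]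
  refine ⟨linearOfAct (AddMonoidHom.mk' (fun x => e ◃ c x) fun x y => ?_) fun x a => ?_, ?_⟩
  · rw [← act_add]; exact key _ _ (by rw [act_add, ← hc, ← hc])
  · change e ◃ c (x ◃ a) = e ◃ c x ◃ a
    rw [← act_mul]; exact key _ _ (by rw [act_mul, ← hc])
  · exact (key _ 1 (act_one _).symm).trans (act_one e)

end NCToric

/-! ### The ideal sheaf attached to a closed subscheme -/

namespace NCToric

variable {n : ℕ} {θ : Matrix (Fin n) (Fin n) ℂ} {F : Fan n}

/-! ## Localization of two-sided ideals -/

/-- A two-sided ideal as a right ideal. -/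
def rightIdeal {σ : Opens F} (I : TwoSidedIdeal (chart θ σ.1)) :
    Submodule (chart θ σ.1)ᵐᵒᵖ (chart θ σ.1) where
  carrier := {a | a ∈ I}
  add_mem' := I.add_mem
  zero_mem' := I.zero_mem
  smul_mem' b a ha := I.mul_mem_right a b.unop ha

lemma mem_rightIdeal {σ : Opens F} {I : TwoSidedIdeal (chart θ σ.1)} {a : chart θ σ.1} :
    a ∈ rightIdeal I ↔ a ∈ I := Iff.rfl

/-- The right ideal of `A_τ` generated by a two-sided ideal of `A_σ`. -/
def extendRight {τ σ : Opens F} (h : τ ≤ σ) (I : TwoSidedIdeal (chart θ σ.1)) :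
    Submodule (chart θ τ.1)ᵐᵒᵖ (chart θ τ.1) :=
  Submodule.span (chart θ τ.1)ᵐᵒᵖ (incl h '' {a | a ∈ I})

lemma incl_mem_extendRight {τ σ : Opens F} (h : τ ≤ σ) {I : TwoSidedIdeal (chart θ σ.1)}
    {a : chart θ σ.1} (ha : a ∈ I) : incl h a ∈ extendRight h I :=
  Submodule.subset_span ⟨a, ha, rfl⟩

lemma mul_mem_extendRight {τ σ : Opens F} (h : τ ≤ σ) {I : TwoSidedIdeal (chart θ σ.1)}
    {x : chart θ τ.1} (hx : x ∈ extendRight h I) (a : chart θ τ.1) : x * a ∈ extendRight h I :=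
  act_mem hx a

lemma incl_mul_mem_extendRight {τ σ : Opens F} (h : τ ≤ σ) {I : TwoSidedIdeal (chart θ σ.1)}
    {x : chart θ τ.1} (hx : x ∈ extendRight h I) (c : chart θ σ.1) :
    incl h c * x ∈ extendRight h I := by
  induction hx using Submodule.span_induction with
  | mem x hx =>
    obtain ⟨a, ha, rfl⟩ := hx
    rw [← map_mul]
    exact incl_mem_extendRight h (I.mul_mem_left c a ha)
  | zero => rw [mul_zero]; exact zero_mem _
  | add x y _ _ hx hy => rw [mul_add]; exact add_mem hx hy
  | smul a x _ hx =>
    have := mul_mem_extendRight h hx a.unop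
    rw [mul_assoc] at this
    exact this

/-- With `d` the image of the denominator, the right ideals `{x | d^k x ∈ I A_τ}` increase with `k`,
because `I` is two-sided, and stabilize at some `N` by noetherianity. Applying this to `d^{-N} x`
removes the left factor. -/
lemma mem_extendRight_of_den_pow_mul {τ σ : Opens F} (h : τ ≤ σ) {I : TwoSidedIdeal (chart θ σ.1)}
    {x : chart θ τ.1} {k : ℕ} (hx : incl h (den θ h) ^ k * x ∈ extendRight h I) :
    x ∈ extendRight h I := by
  set d := incl h (den θ h)
  let J : ℕ → Submodule (chart θ τ.1)ᵐᵒᵖ (chart θ τ.1) := fun k =>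
    { carrier := {x | d ^ k * x ∈ extendRight h I}
      add_mem' := fun hx hy => by
        change d ^ k * (_ + _) ∈ extendRight h I
        rw [mul_add]; exact add_mem hx hy
      zero_mem' := by change d ^ k * 0 ∈ extendRight h I; rw [mul_zero]; exact zero_mem _
      smul_mem' := fun a x hx => by
        have := mul_mem_extendRight h hx a.unop
        rw [mul_assoc] at this
        exact this }
  have hmono : Monotone J := monotone_nat_of_le_succ fun k x hx => by
    change d ^ (k + 1) * x ∈ extendRight h I
    rw [pow_succ', mul_assoc]
    exact incl_mul_mem_extendRight h hx _
  obtain ⟨N, hN⟩ := monotone_stabilizes_iff_noetherian.2 (isNoetherian_chart τ) ⟨J, hmono⟩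
  obtain ⟨u, hu, -⟩ := isUnit_den_pow (θ := θ) h N
  have h1 : u * x ∈ J (N + k) := by
    change d ^ (N + k) * (u * x) ∈ extendRight h I
    rw [add_comm, pow_add, mul_assoc, ← mul_assoc _ u, hu, one_mul]
    exact hx
  have h2 : J N = J (N + k) := hN (N + k) (Nat.le_add_right _ _)
  rw [← h2] at h1
  have h3 : d ^ N * (u * x) ∈ extendRight h I := h1
  rwa [← mul_assoc, hu, one_mul] at h3

/-- Thus a two-sided ideal generates a two-sided ideal in the localization: the only new left
multipliers are inverses of denominators, which the previous lemma handles. -/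
lemma mul_mem_extendRight' {τ σ : Opens F} (h : τ ≤ σ) {I : TwoSidedIdeal (chart θ σ.1)}
    {x : chart θ τ.1} (hx : x ∈ extendRight h I) (b : chart θ τ.1) : b * x ∈ extendRight h I := by
  obtain ⟨k, hk⟩ := exists_mul_den_pow h b
  obtain ⟨c, hc⟩ := hk k le_rfl
  obtain ⟨u, hu, -⟩ := isUnit_den_pow (θ := θ) h k
  have h1 : u * x ∈ extendRight h I := mem_extendRight_of_den_pow_mul h (k := k) (by
    rwa [← mul_assoc, hu, one_mul])
  have h2 := incl_mul_mem_extendRight h h1 c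
  rwa [← hc, mul_assoc, ← mul_assoc _ u, hu, one_mul] at h2

lemma exists_mul_den_pow_eq_of_mem_extendRight {τ σ : Opens F} (h : τ ≤ σ)
    {I : TwoSidedIdeal (chart θ σ.1)} {x : chart θ τ.1} (hx : x ∈ extendRight h I) :
    ∃ (k : ℕ) (a : chart θ σ.1), a ∈ I ∧ x * incl h (den θ h) ^ k = incl h a := by
  have hx' : (unitSections τ).symm x ∈ Submodule.span (chart θ τ.1)ᵐᵒᵖ
      (res h '' (((rightIdeal I).comap (unitSections σ).toLinearMap :
        Submodule _ (sections (unit θ F).obj σ)) : Set (sections (unit θ F).obj σ))) := by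
    have h1 : x ∈ (Submodule.span (chart θ τ.1)ᵐᵒᵖ
      (res h '' (((rightIdeal I).comap (unitSections σ).toLinearMap :
        Submodule _ (sections (unit θ F).obj σ)) : Set (sections (unit θ F).obj σ)))).comap
        (unitSections τ).symm.toLinearMap := by
      refine (Submodule.span_le.2 ?_ : extendRight h I ≤ _) hx
      rintro _ ⟨a, ha, rfl⟩
      exact Submodule.subset_span ⟨(unitSections σ).symm a, ha, rfl⟩
    exact h1
  obtain ⟨k, hk⟩ := exists_res_of_mem_span h hx'
  obtain ⟨z, hz, hz'⟩ := hk k le_rfl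
  exact ⟨k, unitSections σ z, hz, hz'⟩

/-- If `I` kills the sections of `E` over `U[σ]`, then it kills the sections over smaller sets. -/
lemma act_incl_eq_zero {E : Coh θ F} {τ σ : Opens F} (h : τ ≤ σ) {I : TwoSidedIdeal (chart θ σ.1)}
    (hE : ∀ (e : sections E.obj σ) (a : chart θ σ.1), a ∈ I → e ◃ a = 0) (y : sections E.obj τ)
    {a : chart θ τ.1} (ha : a ∈ extendRight h I) : y ◃ a = 0 := by
  obtain ⟨k, hk⟩ := exists_act_den_pow_eq_res E h y
  obtain ⟨e, he⟩ := hk k le_rfl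
  obtain ⟨u, hu, -⟩ := isUnit_den_pow (θ := θ) h k
  -- Writing `y` as a restricted section times `u`, the inverse denominator `u` has to be absorbed
  -- on the left of `a`; this needs the extended ideal to be two-sided.
  have h1 := mul_mem_extendRight' h ha u
  have h2 : y ◃ a = res h e ◃ (u * a) := by rw [← he, ← act_mul, ← mul_assoc, hu, one_mul]
  rw [h2]
  generalize u * a = b at h1
  induction h1 using Submodule.span_induction with
  | mem x hx =>
    obtain ⟨c, hc, rfl⟩ := hx
    rw [← res_act, hE e c hc, map_zero]
  | zero => rw [act_zero]
  | add x y _ _ hx hy => rw [act_add, hx, hy, add_zero]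
  | smul c x _ hx =>
    have h3 : res h e ◃ (x * c.unop) = 0 := by rw [act_mul, hx, zero_act]
    exact h3

/-! ## The ideals of a closed subscheme -/

variable {Y : ObjectProperty (Coh θ F)}

/-- The elements of `A_σ` that kill the sections over `U[σ]` of the members of `Y` that are direct
images from `U[σ]`. -/
def killing (Y : ObjectProperty (Coh θ F)) (σ : Opens F) : TwoSidedIdeal (chart θ σ.1) :=
  TwoSidedIdeal.mk' {a | ∀ E, Y (direct E σ) → ∀ e : sections E.obj σ, e ◃ a = 0}
    (fun _ _ e => act_zero e)
    (fun hx hy E hE e => by rw [act_add, hx E hE e, hy E hE e, add_zero])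
    (fun {x} hx E hE e => by rw [← zero_sub, act_sub, act_zero, hx E hE e, sub_zero])
    (fun hy E hE e => by rw [act_mul, hy E hE])
    (fun hx E hE e => by rw [act_mul, hx E hE e, zero_act])

lemma mem_killing {σ : Opens F} {a : chart θ σ.1} :
    a ∈ killing Y σ ↔ ∀ E, Y (direct E σ) → ∀ e : sections E.obj σ, e ◃ a = 0 :=
  TwoSidedIdeal.mem_mk' _ _ _ _ _ _ _

namespace IsClosedSubscheme

/-- An element `a` separated from zero by no member kills every module whose direct image is a
member, because each section `e` of such a module is the image of the generator under a map out of
the cyclic module. Hence `a` lies in the ideal and its class is zero. Only the sections over `σ` of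
the chosen cyclic sheaf matter. -/
lemma prop_direct_cyclic (hY : IsClosedSubscheme Y) (σ : Opens F) :
    Y (direct (rightIdealSubsheaf (rightIdeal (killing Y σ))).quot σ) := by
  refine hY.prop_of_separated fun N hN ρ x hx => subsheaf_direct_eq_zero (fun x hx => ?_) hx
  apply (directEval_bijective _ (le_refl σ)).1
  rw [map_zero]
  obtain ⟨a, ha⟩ := exists_eq_cyclicGen_act (directEval _ (le_refl σ) x)
  rw [ha, cyclicGen_act_eq_zero_iff, mem_rightIdeal, mem_killing]
  intro E hE e
  obtain ⟨f, hf⟩ := exists_linearMap_cyclicGen (J := rightIdeal (killing Y σ)) (e := e)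
    (fun a ha => mem_killing.1 ha E hE e)
  have h1 := hN _ hE (directMap f) σ x hx
  have h2 : directEval _ (le_refl σ) (onSections (directMap f) σ x) = e ◃ a := by
    rw [directEval_eq, directSections_directMap,
      ← res_loc f (σ.inter_le_left σ) (le_inter le_rfl le_rfl), ← directEval_eq (le_refl σ), ha, map_act]
    have h3 := loc_res f le_rfl (cyclicGen (rightIdeal (killing Y σ)))
    rw [res_refl, res_refl, hf] at h3
    rw [h3]
  rw [← h2, h1, map_zero]

/-- A module killed by the ideal is generated by images of the cyclic module, and so is its direct
image after localization. -/
lemma prop_direct_iff (hY : IsClosedSubscheme Y) {E : Coh θ F} {σ : Opens F} :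
    Y (direct E σ) ↔ ∀ (e : sections E.obj σ) (a : chart θ σ.1), a ∈ killing Y σ → e ◃ a = 0 := by
  refine ⟨fun h e a ha => mem_killing.1 ha E h e, fun h => ?_⟩
  refine hY.prop_of_generated fun N hN ρ x => ?_
  obtain ⟨k, hk⟩ := exists_act_den_pow_eq_res E (σ.inter_le_left ρ) (directSections E σ ρ x)
  obtain ⟨e, he⟩ := hk k le_rfl
  obtain ⟨u, hu, -⟩ := isUnit_den_pow (θ := θ) (σ.inter_le_left ρ) k
  obtain ⟨f, hf⟩ := exists_linearMap_cyclicGen (J := rightIdeal (killing Y σ)) (e := e)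
    (fun a ha => h e a ha)
  convert hN _ (hY.prop_direct_cyclic σ) (directMap f) ρ ((directSections _ σ ρ).symm
    (res (σ.inter_le_left ρ) (cyclicGen (rightIdeal (killing Y σ))) ◃ u)) using 1
  apply (directSections E σ ρ).injective
  rw [directSections_directMap, AddEquiv.apply_symm_apply, map_act, loc_res, hf, ← he, ← act_mul,
    hu, act_one]

/-- The direct image from `U[τ]` is also a direct image from `U[σ]`, so the criterion on `σ` can be
applied and transported to sections over `τ`. -/
lemma prop_direct_iff_of_le (hY : IsClosedSubscheme Y) {E : Coh θ F} {τ σ : Opens F} (h : τ ≤ σ) :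
    Y (direct E τ) ↔ ∀ (e : sections E.obj τ), ∀ a ∈ extendRight h (killing Y σ), e ◃ a = 0 := by
  constructor
  · intro hE e a ha
    have h1 : Y (direct (direct E τ) σ) :=
      hY.prop_of_bijective _ (fun ρ => toDirect_bijective_of_le E h ρ) hE
    obtain ⟨x, rfl⟩ := (directEval_bijective E (le_refl τ)).2 e
    rw [← map_act, act_incl_eq_zero h (hY.prop_direct_iff.1 h1) x ha, map_zero]
  · intro hE
    refine hY.prop_of_injective _ (fun ρ => (toDirect_bijective_of_le E h ρ).1) ?_
    rw [hY.prop_direct_iff]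
    intro x a ha
    apply (direct_res_bijective E h (τ.inter_le_left σ)).1
    apply (directEval_bijective E (le_refl τ)).1
    rw [res_act, map_act, hE _ _ (incl_mem_extendRight h ha), map_zero, map_zero]

/-- The cyclic module over `τ` with relations `I_σ A_τ` is killed by these relations, which form a
two-sided ideal, so its direct image is in `Y`. An element of `I_τ` must kill its generator. -/
lemma mem_killing_iff (hY : IsClosedSubscheme Y) {τ σ : Opens F} (h : τ ≤ σ) {a : chart θ τ.1} :
    a ∈ killing Y τ ↔ a ∈ extendRight h (killing Y σ) := by
  constructor
  · intro ha
    rw [← cyclicGen_act_eq_zero_iff]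
    refine mem_killing.1 ha _ ((hY.prop_direct_iff_of_le h).2 fun e b hb => ?_) _
    obtain ⟨c, rfl⟩ := exists_eq_cyclicGen_act e
    rw [← act_mul, cyclicGen_act_eq_zero_iff]
    exact mul_mem_extendRight' h hb c
  · exact fun ha => mem_killing.2 fun E hE e => (hY.prop_direct_iff_of_le h).1 hE e a ha

end IsClosedSubscheme

/-! ## The ideal sheaf of a closed subscheme -/

namespace SubsheafOfIdeals

variable (S : SubsheafOfIdeals θ F)

/-- The element of the coordinate algebra that underlies a section. -/
def toChart {σ : Opens F} (x : NCToric.sections S.sheaf σ) : chart θ σ.1 :=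
  MulOpposite.unop (show (chart θ σ.1)ᵐᵒᵖ from (show S.module (op σ) from x).1)

lemma toChart_injective {σ : Opens F} : Function.Injective (S.toChart (σ := σ)) := fun _ _ h =>
  Subtype.ext (MulOpposite.unop_injective h)

lemma toChart_zero {σ : Opens F} : S.toChart (σ := σ) 0 = 0 := rfl

lemma toChart_add {σ : Opens F} (x y : NCToric.sections S.sheaf σ) :
    S.toChart (x + y) = S.toChart x + S.toChart y := rfl

lemma toChart_act {σ : Opens F} (x : NCToric.sections S.sheaf σ) (a : chart θ σ.1) :
    S.toChart (x ◃ a) = S.toChart x * a := rfl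

lemma toChart_res {τ σ : Opens F} (h : τ ≤ σ) (x : NCToric.sections S.sheaf σ) :
    S.toChart (NCToric.res h x) = incl h (S.toChart x) := rfl

lemma toChart_mem {σ : Opens F} (x : NCToric.sections S.sheaf σ) : S.toChart x ∈ S.ideal σ :=
  TwoSidedIdeal.mem_asIdealOpposite.1 (show S.module (op σ) from x).2

lemma exists_toChart_eq {σ : Opens F} {a : chart θ σ.1} (ha : a ∈ S.ideal σ) :
    ∃ x, S.toChart (σ := σ) x = a :=
  ⟨(⟨MulOpposite.op a, TwoSidedIdeal.mem_asIdealOpposite.2 ha⟩ : S.module (op σ)), rfl⟩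

/-- Restriction maps of ideals are injective and the charts are noetherian, so of the conditions for
coherence only the clearing of denominators remains. -/
lemma isCoherent_iff : IsCoherent θ F S.sheaf ↔
    ∀ (τ σ : Opens F) (h : τ ≤ σ), ∀ a ∈ S.ideal τ, ∃ (k : ℕ) (b : chart θ σ.1), b ∈ S.ideal σ ∧
      a * incl h (den θ h) ^ k = incl h b := by
  constructor
  · intro hS τ σ h a ha
    obtain ⟨x, rfl⟩ := S.exists_toChart_eq ha
    obtain ⟨k, y, hy⟩ := (isQuasiCoherent_iff.1 hS.1 τ σ h).1 x
    refine ⟨k, S.toChart y, S.toChart_mem y, ?_⟩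
    rw [← toChart_res, ← hy, toChart_act]
  · intro hS
    refine ⟨isQuasiCoherent_iff.2 fun τ σ h => ⟨fun y => ?_, fun x hx => ⟨0, ?_⟩⟩, fun σ => ?_⟩
    · obtain ⟨k, b, hb, hb'⟩ := hS τ σ h _ (S.toChart_mem y)
      obtain ⟨x, rfl⟩ := S.exists_toChart_eq hb
      exact ⟨k, x, S.toChart_injective (by rw [toChart_act, hb', toChart_res])⟩
    · rw [pow_zero, act_one]
      apply S.toChart_injective
      rw [toChart_zero]
      apply incl_injective h
      rw [← toChart_res, hx, toChart_zero, map_zero]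
    · let f : NCToric.sections S.sheaf σ →ₗ[(chart θ σ.1)ᵐᵒᵖ] chart θ σ.1 :=
        linearOfAct (AddMonoidHom.mk' S.toChart S.toChart_add) S.toChart_act
      have : IsNoetherian (chart θ σ.1)ᵐᵒᵖ (NCToric.sections S.sheaf σ) :=
        isNoetherian_of_injective f S.toChart_injective
      exact (inferInstance : Module.Finite (chart θ σ.1)ᵐᵒᵖ (NCToric.sections S.sheaf σ))

end SubsheafOfIdeals

/-- The ideal sheaf of a closed subscheme. -/
def IsClosedSubscheme.idealSheaf (hY : IsClosedSubscheme Y) : IdealSheaf θ F where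
  ideal := killing Y
  restrict_mem _ _ h _ ha := (hY.mem_killing_iff h).2 (incl_mem_extendRight h ha)
  coherent := by
    rw [SubsheafOfIdeals.isCoherent_iff]
    intro τ σ h a ha
    exact exists_mul_den_pow_eq_of_mem_extendRight h ((hY.mem_killing_iff h).1 ha)

lemma IsClosedSubscheme.agreesOnOverlaps_idealSheaf (hY : IsClosedSubscheme Y) :
    hY.idealSheaf.AgreesOnOverlaps := fun σ σ' => Submodule.ext fun _ =>
  (hY.mem_killing_iff (σ.inter_le_left σ')).symm.trans (hY.mem_killing_iff (σ.inter_le_right σ'))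

/-- Members of the subscheme of the ideal sheaf are members. -/
lemma IsClosedSubscheme.subscheme_idealSheaf_le (hY : IsClosedSubscheme Y) :
    hY.idealSheaf.subscheme ≤ Y := fun E hE => by
  -- The direct images of `E` from all charts are members by the ideal criterion, and the canonical
  -- map to the one from `U[σ]` is injective on sections over `σ`.
  refine hY.prop_of_separated fun N hN σ x hx => ?_
  have h1 : Y (direct E σ) := hY.prop_direct_iff.2 fun e a ha => hE σ e a ha
  apply toDirect_injective E (le_refl σ)
  rw [hN _ h1 (toDirect E σ) σ x hx, map_zero]

end NCToric

/-! ### Two tools: homogeneous generators and diagonal operators -/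

namespace NCToric

variable {n : ℕ} {θ : Matrix (Fin n) (Fin n) ℂ} {F : Fan n}

/-! ## Homogeneous generators of two-sided ideals -/

namespace QuantumLaurent

/-- The exponents that occur in an element of the quantum Laurent algebra. -/
def support (f : QuantumLaurent θ) : Finset (Fin n → ℤ) :=
  Finsupp.support (show (Fin n → ℤ) →₀ ℂ from f)

lemma mem_support {f : QuantumLaurent θ} {p : Fin n → ℤ} : p ∈ f.support ↔ f.coeff p ≠ 0 :=
  Finsupp.mem_support_iff

lemma ext_coeff {f g : QuantumLaurent θ} (h : ∀ p, f.coeff p = g.coeff p) : f = g :=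
  Finsupp.ext h

lemma coeff_add (f g : QuantumLaurent θ) (p : Fin n → ℤ) :
    (f + g).coeff p = f.coeff p + g.coeff p := rfl

lemma coeff_sub (f g : QuantumLaurent θ) (p : Fin n → ℤ) :
    (f - g).coeff p = f.coeff p - g.coeff p :=
  Finsupp.sub_apply (show (Fin n → ℤ) →₀ ℂ from f) (show (Fin n → ℤ) →₀ ℂ from g) p

lemma coeff_smul (c : ℂ) (f : QuantumLaurent θ) (p : Fin n → ℤ) :
    (c • f).coeff p = c * f.coeff p := rfl

lemma coeff_zero (p : Fin n → ℤ) : (0 : QuantumLaurent θ).coeff p = 0 := rfl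

lemma coeff_term_self (p : Fin n → ℤ) (c : ℂ) : (term p c : QuantumLaurent θ).coeff p = c :=
  Finsupp.single_eq_same

lemma coeff_term_of_ne {p q : Fin n → ℤ} (h : p ≠ q) (c : ℂ) :
    (term p c : QuantumLaurent θ).coeff q = 0 :=
  Finsupp.single_eq_of_ne' h

lemma coeff_mul_term (f : QuantumLaurent θ) (p q : Fin n → ℤ) (c : ℂ) :
    (f * term q c).coeff (p + q) = f.coeff p * c * phase θ p q := by
  induction f using QuantumLaurent.induction with
  | h0 => rw [zero_mul, coeff_zero, coeff_zero, zero_mul, zero_mul]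
  | hadd f g hf hg => rw [add_mul, coeff_add, coeff_add, hf, hg, add_mul, add_mul]
  | hterm r a =>
    rw [term_mul_term]
    by_cases h : r = p
    · subst h; rw [coeff_term_self, coeff_term_self]
    · rw [coeff_term_of_ne h, coeff_term_of_ne (fun h' => h (add_right_cancel h')), zero_mul,
        zero_mul]

lemma coeff_term_mul (f : QuantumLaurent θ) (p q : Fin n → ℤ) (c : ℂ) :
    (term q c * f).coeff (p + q) = c * f.coeff p * phase θ q p := by
  induction f using QuantumLaurent.induction with
  | h0 => rw [mul_zero, coeff_zero, coeff_zero, mul_zero, zero_mul]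
  | hadd f g hf hg => rw [mul_add, coeff_add, coeff_add, hf, hg, mul_add, add_mul]
  | hterm r a =>
    rw [term_mul_term, add_comm q r]
    by_cases h : r = p
    · subst h; rw [coeff_term_self, coeff_term_self]
    · rw [coeff_term_of_ne h, coeff_term_of_ne (fun h' => h (add_right_cancel h')), mul_zero,
        zero_mul]

end QuantumLaurent

/-- The scalar by which conjugation by `t^q` multiplies `t^p`. -/
def twist (θ : Matrix (Fin n) (Fin n) ℂ) (q p : Fin n → ℤ) : ℂ := phase θ q p / phase θ p q

lemma twist_ne_zero (q p : Fin n → ℤ) : twist θ q p ≠ 0 :=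
  div_ne_zero (phase_ne_zero _ _) (phase_ne_zero _ _)

/-- An element that is an eigenvector for the conjugation by the monomial units. -/
def IsHomogeneous {σ : Opens F} (a : chart θ σ.1) : Prop :=
  ∀ (q : Fin n → ℤ) (hq : charVec q ∈ dualCone σ.1), charVec (-q) ∈ dualCone σ.1 →
    ∃ χ : ℂ, χ ≠ 0 ∧ mon σ q hq * a = χ • (a * mon σ q hq)

lemma mon_mul_eq_smul {σ : Opens F} {a : chart θ σ.1} {q : Fin n → ℤ}
    (hq : charVec q ∈ dualCone σ.1) {χ : ℂ} (h : ∀ p ∈ a.1.support, twist θ q p = χ) :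
    mon σ q hq * a = χ • (a * mon σ q hq) := by
  refine Subtype.ext (QuantumLaurent.ext_coeff fun p => ?_)
  change (QuantumLaurent.term q 1 * a.1 : QuantumLaurent θ).coeff p =
    (χ • (a.1 * QuantumLaurent.term q 1) : QuantumLaurent θ).coeff p
  rw [← sub_add_cancel p q, QuantumLaurent.coeff_smul, QuantumLaurent.coeff_mul_term,
    QuantumLaurent.coeff_term_mul, one_mul, mul_one]
  by_cases hp : a.1.coeff (p - q) = 0
  · rw [hp]; ring
  · rw [← h _ (QuantumLaurent.mem_support.2 hp), twist]
    field_simp [phase_ne_zero]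

/-- Induction on the size of the support. If conjugation by a monomial unit has two different
eigenvalues on the terms of `a`, subtracting the multiple of `a` by one of them gives an element of
`I` with fewer terms. -/
lemma mem_span_isHomogeneous {σ : Opens F} (I : TwoSidedIdeal (chart θ σ.1)) (k : ℕ)
    (a : chart θ σ.1) (ha : a ∈ I) (hk : a.1.support.card ≤ k) :
    a ∈ Submodule.span (chart θ σ.1)ᵐᵒᵖ {b : chart θ σ.1 | b ∈ I ∧ IsHomogeneous b} := by
  induction k generalizing a with
  | zero =>
    have h0 : a = 0 := by
      refine Subtype.ext (QuantumLaurent.ext_coeff fun p => ?_)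
      by_contra hp
      have := QuantumLaurent.mem_support.2 hp
      rw [Finset.card_eq_zero.1 (Nat.le_zero.1 hk)] at this
      exact Finset.notMem_empty p this
    rw [h0]; exact zero_mem _
  | succ k ih =>
    by_cases hom : IsHomogeneous a
    · exact Submodule.subset_span ⟨ha, hom⟩
    unfold IsHomogeneous at hom
    push Not at hom
    obtain ⟨q, hq, hq', hom⟩ := hom
    set t := mon (θ := θ) σ q hq
    have key : ∃ p ∈ a.1.support, ∃ p' ∈ a.1.support, twist θ q p ≠ twist θ q p' := by
      by_contra hc
      push Not at hc
      rcases a.1.support.eq_empty_or_nonempty with he | ⟨p, hp⟩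
      · exact hom 1 one_ne_zero (mon_mul_eq_smul hq (fun p hp => by
          rw [he] at hp; exact absurd hp (Finset.notMem_empty p)))
      · exact hom _ (twist_ne_zero q p) (mon_mul_eq_smul hq fun p' hp' => hc p' hp' p hp)
    obtain ⟨p, hp, p', hp', hne⟩ := key
    obtain ⟨u, hu⟩ := (isUnit_mon (θ := θ) hq hq')
    have hu' : (u : chart θ σ.1) = t := hu
    have hI : ∀ r, (t * a - twist θ q r • (a * t)) * ↑u⁻¹ ∈ I := fun r => by
      refine I.mul_mem_right _ _ (I.sub_mem (I.mul_mem_left _ _ ha) ?_)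
      rw [Algebra.smul_def]
      exact I.mul_mem_left _ _ (I.mul_mem_right _ _ ha)
    have hcoeff : ∀ r s : Fin n → ℤ, ((t * a - twist θ q r • (a * t)) * ↑u⁻¹).1.coeff s =
        (twist θ q s - twist θ q r) * a.1.coeff s := fun r s => by
      have h1 : (t * a - twist θ q r • (a * t)) * ↑u⁻¹ * t =
        t * a - twist θ q r • (a * t) := by rw [← hu', Units.inv_mul_cancel_right]
      have h2 := congrArg (fun x : chart θ σ.1 => x.1.coeff (s + q)) h1
      change ((((t * a - twist θ q r • (a * t)) * ↑u⁻¹).1 * QuantumLaurent.term q 1 :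
        QuantumLaurent θ).coeff (s + q)) = (QuantumLaurent.term q 1 * a.1 -
          twist θ q r • (a.1 * QuantumLaurent.term q 1) : QuantumLaurent θ).coeff (s + q) at h2
      rw [QuantumLaurent.coeff_mul_term, QuantumLaurent.coeff_sub, QuantumLaurent.coeff_smul,
        QuantumLaurent.coeff_mul_term, QuantumLaurent.coeff_term_mul] at h2
      have h3 : twist θ q s * phase θ s q = phase θ q s := div_mul_cancel₀ _ (phase_ne_zero _ _)
      refine mul_right_cancel₀ (phase_ne_zero (θ := θ) s q) ?_
      rw [← h3] at h2
      linear_combination h2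
    have hcard : ∀ r ∈ a.1.support,
        ((t * a - twist θ q r • (a * t)) * ↑u⁻¹).1.support.card ≤ k := fun r hr => by
      have : ((t * a - twist θ q r • (a * t)) * ↑u⁻¹).1.support ⊂ a.1.support := by
        refine (Finset.ssubset_iff_of_subset fun s hs => ?_).2 ⟨r, hr, fun hr' => ?_⟩
        · rw [QuantumLaurent.mem_support, hcoeff] at hs
          exact QuantumLaurent.mem_support.2 (right_ne_zero_of_mul hs)
        · rw [QuantumLaurent.mem_support, hcoeff, sub_self, zero_mul] at hr'
          exact hr' rfl
      have := Finset.card_lt_card this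
      omega
    -- The two shortened elements, for the eigenvalues at `p` and `p'`, differ by a nonzero scalar
    -- multiple of `a`.
    have hsum : a = ((t * a - twist θ q p • (a * t)) * ↑u⁻¹) *
          algebraMap ℂ (chart θ σ.1) (twist θ q p' - twist θ q p)⁻¹ -
        ((t * a - twist θ q p' • (a * t)) * ↑u⁻¹) *
          algebraMap ℂ (chart θ σ.1) (twist θ q p' - twist θ q p)⁻¹ := by
      rw [← sub_mul, ← sub_mul, sub_sub_sub_cancel_left, ← sub_smul, ← hu', smul_mul_assoc,
        mul_assoc, Units.mul_inv, mul_one, ← Algebra.commutes, ← Algebra.smul_def, smul_smul,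
        inv_mul_cancel₀ (sub_ne_zero.2 hne.symm), one_smul]
    rw [hsum]
    exact sub_mem (act_mem (ih _ (hI p) (hcard p hp)) _) (act_mem (ih _ (hI p') (hcard p' hp')) _)

/-- A two-sided ideal of a chart has finitely many homogeneous generators as a right ideal. -/
lemma exists_homogeneous_generators {σ : Opens F} (I : TwoSidedIdeal (chart θ σ.1)) :
    ∃ (r : ℕ) (a : Fin r → chart θ σ.1), (∀ i, a i ∈ I) ∧ (∀ i, IsHomogeneous (a i)) ∧
      ∀ x ∈ I, x ∈ Submodule.span (chart θ σ.1)ᵐᵒᵖ (Set.range a) := by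
  obtain ⟨s, hs, hs'⟩ := Submodule.fg_span_iff_fg_span_finset_subset
    {b : chart θ σ.1 | b ∈ I ∧ IsHomogeneous b} |>.1 (IsNoetherian.noetherian
      (Submodule.span (chart θ σ.1)ᵐᵒᵖ {b : chart θ σ.1 | b ∈ I ∧ IsHomogeneous b}))
  refine ⟨s.card, fun i => s.equivFin.symm i, fun i => (hs (s.equivFin.symm i).2).1,
    fun i => (hs (s.equivFin.symm i).2).2, fun x hx => ?_⟩
  have : Set.range (fun i => (s.equivFin.symm i : chart θ σ.1)) = s := by
    ext y
    exact ⟨fun ⟨i, hi⟩ => hi ▸ (s.equivFin.symm i).2,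
      fun hy => ⟨s.equivFin ⟨y, hy⟩, by simp⟩⟩
  rw [this, ← hs']
  exact mem_span_isHomogeneous I _ x hx le_rfl

/-! ## Diagonal operators on powers of a simple object -/

/-- If each factor has no proper subgroups stable under the operators, a subgroup of the product
that is stable under the diagonal operators is stable under the inverse of any of them. -/
lemma exists_eq_diagonal_of_mem {V T : Type*} [AddCommGroup V] (m : T) :
    ∀ (r : ℕ) (R : T → Fin r → V →+ V)
    (_ : ∀ i (U : AddSubgroup V), (∀ t, ∀ v ∈ U, R t i v ∈ U) → U = ⊥ ∨ U = ⊤)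
    (_ : ∀ i, Function.Surjective (R m i)) (W : AddSubgroup (Fin r → V))
    (_ : ∀ t, ∀ w ∈ W, (fun i => R t i (w i)) ∈ W), ∀ w ∈ W, ∃ w' ∈ W,
      w = fun i => R m i (w' i) := by
  intro r
  induction r with
  | zero => exact fun R _ _ W _ w hw => ⟨w, hw, Subsingleton.elim _ _⟩
  | succ r ih =>
    intro R hR hm W hW
    -- The elements of `W` with vanishing first coordinate, viewed in the remaining factors, where
    -- induction applies.
    let W₀ : AddSubgroup (Fin r → V) :=
      { carrier := {v | (Fin.cons 0 v : Fin (r + 1) → V) ∈ W}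
        add_mem' := fun {v v'} hv hv' => by
          have := W.add_mem hv hv'
          rwa [← Matrix.vecCons, ← Matrix.vecCons, Matrix.cons_add_cons, add_zero] at this
        zero_mem' := by
          have : (Fin.cons 0 0 : Fin (r + 1) → V) = 0 := Matrix.cons_zero_zero
          change (Fin.cons 0 0 : Fin (r + 1) → V) ∈ W
          rw [this]; exact W.zero_mem
        neg_mem' := fun {v} hv => by
          have := W.neg_mem hv
          rwa [← Matrix.vecCons, Matrix.neg_cons, neg_zero] at this }
    have hcons : ∀ t (v : Fin r → V), (fun i => R t i ((Fin.cons 0 v : Fin (r + 1) → V) i)) =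
        Fin.cons 0 (fun i => R t i.succ (v i)) := fun t v => by
      ext i
      refine Fin.cases ?_ (fun j => ?_) i
      · exact map_zero _
      · rfl
    have h₀ := ih (fun t i => R t i.succ) (fun i => hR i.succ) (fun i => hm i.succ) W₀
      (fun t w hw => by
        have := hW t _ hw
        rwa [hcons] at this)
    have htail : ∀ w ∈ W, w 0 = 0 → ∃ w' ∈ W, w = fun i => R m i (w' i) := fun w hw h0 => by
      have h1 : w = Fin.cons 0 (Fin.tail w) := by rw [← h0, Fin.cons_self_tail]
      obtain ⟨v, hv, hv'⟩ := h₀ (Fin.tail w) (by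
        change Fin.cons 0 (Fin.tail w) ∈ W
        rwa [← h1])
      exact ⟨_, hv, by rw [hcons, ← hv', ← h1]⟩
    intro w hw
    rcases hR 0 (W.map (Pi.evalAddMonoidHom _ 0)) (by
      rintro t _ ⟨v, hv, rfl⟩
      exact ⟨_, hW t v hv, rfl⟩) with h | h
    · refine htail w hw ?_
      have : w 0 ∈ W.map (Pi.evalAddMonoidHom (fun _ => V) 0) := ⟨w, hw, rfl⟩
      rw [h] at this
      exact this
    -- When `W` projects onto the first factor, some `w' ∈ W` has an `m`-image with the same first
    -- coordinate as `w`; the difference falls under the case of vanishing first coordinate.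
    · obtain ⟨v, hv⟩ := hm 0 (w 0)
      have : v ∈ W.map (Pi.evalAddMonoidHom (fun _ => V) 0) := by rw [h]; trivial
      obtain ⟨w', hw', rfl⟩ := this
      obtain ⟨w'', hw'', h2⟩ := htail (w - fun i => R m i (w' i)) (W.sub_mem hw (hW m w' hw'))
        (sub_eq_zero.2 hv.symm)
      refine ⟨w'' + w', W.add_mem hw'' hw', ?_⟩
      rw [sub_eq_iff_eq_add] at h2
      rw [h2]
      ext i
      exact (map_add _ _ _).symm

end NCToric

/-! ### Members of a closed subscheme are killed by its ideals -/

namespace NCToric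

variable {n : ℕ} {θ : Matrix (Fin n) (Fin n) ℂ} {F : Fan n}

/-! ## Submodules given by normal elements -/

section Normal

variable {σ : Opens F} {M : Type} [AddCommGroup M] [Module (chart θ σ.1)ᵐᵒᵖ M]

/-- The elements killed by a normal element. -/
def kerAct (M : Type) [AddCommGroup M] [Module (chart θ σ.1)ᵐᵒᵖ M] {s : chart θ σ.1}
    (hs : IsNormalElement s) : Submodule (chart θ σ.1)ᵐᵒᵖ M where
  carrier := {x | x ◃ s = 0}
  add_mem' {x y} hx hy := by
    change (x + y) ◃ s = 0
    rw [add_act, hx, hy, add_zero]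
  zero_mem' := zero_act s
  smul_mem' a x hx := by
    obtain ⟨b, hb⟩ := hs.right a.unop
    change x ◃ a.unop ◃ s = 0
    rw [← act_mul, hb, act_mul, hx, zero_act]

lemma mem_kerAct {s : chart θ σ.1} {hs : IsNormalElement s} {x : M} :
    x ∈ kerAct M hs ↔ x ◃ s = 0 := Iff.rfl

/-- The multiples of the elements of a submodule by a normal element. -/
def mapAct (N : Submodule (chart θ σ.1)ᵐᵒᵖ M) {s : chart θ σ.1}
    (hs : IsNormalElement s) : Submodule (chart θ σ.1)ᵐᵒᵖ M where
  carrier := {x | ∃ y ∈ N, y ◃ s = x}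
  add_mem' := by
    rintro _ _ ⟨x, hx, rfl⟩ ⟨y, hy, rfl⟩
    exact ⟨x + y, add_mem hx hy, add_act _ _ _⟩
  zero_mem' := ⟨0, zero_mem _, zero_act s⟩
  smul_mem' := by
    rintro a _ ⟨x, hx, rfl⟩
    obtain ⟨b, hb⟩ := hs.left a.unop
    refine ⟨x ◃ b, act_mem hx b, ?_⟩
    change x ◃ b ◃ s = x ◃ s ◃ a.unop
    rw [← act_mul, ← act_mul, hb]

/-- The submodule generated by the products with elements of an ideal. -/
def mulIdeal (M : Type) [AddCommGroup M] [Module (chart θ σ.1)ᵐᵒᵖ M]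
    (I : TwoSidedIdeal (chart θ σ.1)) : Submodule (chart θ σ.1)ᵐᵒᵖ M :=
  Submodule.span _ {x | ∃ e : M, ∃ a ∈ I, x = e ◃ a}

lemma act_mem_mulIdeal {I : TwoSidedIdeal (chart θ σ.1)} (e : M) {a : chart θ σ.1} (ha : a ∈ I) :
    e ◃ a ∈ mulIdeal M I := Submodule.subset_span ⟨e, a, ha, rfl⟩

lemma mulIdeal_le {I : TwoSidedIdeal (chart θ σ.1)} {N : Submodule (chart θ σ.1)ᵐᵒᵖ M} :
    mulIdeal M I ≤ N ↔ ∀ (e : M), ∀ a ∈ I, e ◃ a ∈ N := by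
  refine Submodule.span_le.trans ⟨fun h e a ha => h ⟨e, a, ha, rfl⟩, ?_⟩
  rintro h _ ⟨e, a, ha, rfl⟩
  exact h e a ha

/-- The submodule of the elements killed by an ideal. -/
def killedBy (M : Type) [AddCommGroup M] [Module (chart θ σ.1)ᵐᵒᵖ M]
    (I : TwoSidedIdeal (chart θ σ.1)) : Submodule (chart θ σ.1)ᵐᵒᵖ M where
  carrier := {x | ∀ a ∈ I, x ◃ a = 0}
  add_mem' hx hy a ha := by rw [add_act, hx a ha, hy a ha, add_zero]
  zero_mem' a _ := zero_act a
  smul_mem' b x hx a ha := by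
    have h1 : x ◃ (b.unop * a) = 0 := hx _ (I.mul_mem_left _ _ ha)
    rwa [act_mul] at h1

end Normal

lemma exists_mon_pow_mul_eq {σ : Opens F} {p q : Fin n → ℤ} (hp : charVec p ∈ dualCone σ.1)
    (hq : charVec q ∈ dualCone σ.1) {k N : ℕ} (h : charVec (-(k • p) + N • q) ∈ dualCone σ.1) :
    ∃ b, mon (θ := θ) σ p hp ^ k * b = mon σ q hq ^ N := by
  obtain ⟨c, hc, h1⟩ := exists_term_pow (θ := θ) p k
  obtain ⟨c', -, h2⟩ := exists_term_pow (θ := θ) q N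
  refine ⟨⟨QuantumLaurent.term (-(k • p) + N • q) (c' / (c * phase θ (k • p) (-(k • p) + N • q))),
    term_mem_chart h _⟩, Subtype.ext ?_⟩
  change (QuantumLaurent.term p 1 : QuantumLaurent θ) ^ k * QuantumLaurent.term _ _ =
    QuantumLaurent.term q 1 ^ N
  rw [h1, h2, QuantumLaurent.term_mul_term, add_neg_cancel_left]
  congr 1
  field_simp [phase_ne_zero]

/-! ## Minimal sheaves that are not killed by the ideals of a closed subscheme -/

instance isNoetherianRing_chart (σ : Opens F) : IsNoetherianRing (chart θ σ.1)ᵐᵒᵖ :=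
  isNoetherian_of_injective (M := (chart θ σ.1)ᵐᵒᵖ) (P := chart θ σ.1)
    ({ toFun := MulOpposite.unop, map_add' := fun _ _ => rfl, map_smul' := fun _ _ => rfl } :
      (chart θ σ.1)ᵐᵒᵖ →ₗ[(chart θ σ.1)ᵐᵒᵖ] chart θ σ.1) MulOpposite.unop_injective

variable {Y : ObjectProperty (Coh θ F)}

/-- A coherent member of `Y` not killed by the ideals of `Y`, all of whose proper quotients are,
together with a minimal open set over which it is not killed. -/
structure IsMinimalUnkilled (Y : ObjectProperty (Coh θ F)) (E : Coh θ F) (τ : Opens F) : Prop where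
  mem : Y E
  noetherian : ∀ σ, IsNoetherian (chart θ σ.1)ᵐᵒᵖ (sections E.obj σ)
  unkilled : ∃ (e : sections E.obj τ), ∃ a ∈ killing Y τ, e ◃ a ≠ 0
  killed : ∀ κ ≤ τ, κ ≠ τ → ∀ (e : sections E.obj κ), ∀ a ∈ killing Y κ, e ◃ a = 0
  subsheaf : ∀ N : Subsheaf E, ∀ σ, ∀ x ∈ N.mod σ, x ≠ 0 →
    ∀ (ρ : Opens F) (e : sections E.obj ρ), ∀ a ∈ killing Y ρ, e ◃ a ∈ N.mod ρ

lemma IsClosedSubscheme.prop_quot (hY : IsClosedSubscheme Y) {E : Coh θ F} (hE : Y E)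
    (K : Subsheaf E) : Y K.quot :=
  hY.prop_of_generated fun N hN σ x => by
    obtain ⟨y, rfl⟩ := K.π_surjective σ x
    exact hN E hE K.π σ y

lemma Subsheaf.isNoetherian_obj {E : Coh θ F} (N : Subsheaf E) {σ : Opens F} (h : (N.mod σ).FG) :
    IsNoetherian (chart θ σ.1)ᵐᵒᵖ (sections N.obj.obj σ) := by
  have := isNoetherian_of_fg_of_noetherian (N.mod σ) h
  exact isNoetherian_of_injective ((onSections N.ι σ).codRestrict (N.mod σ) (N.ι_mem σ))
    (fun x y hxy => N.ι_injective σ (congrArg Subtype.val hxy))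

/-- Pass to a coherent subsheaf, divide by a maximal subsheaf for which the quotient is still not
killed, and choose a minimal cone detecting this. -/
lemma IsClosedSubscheme.exists_isMinimalUnkilled (hY : IsClosedSubscheme Y)
    (h : ∃ E, Y E ∧ ∃ (σ : Opens F) (e : sections E.obj σ), ∃ a ∈ killing Y σ, e ◃ a ≠ 0) :
    ∃ E τ, IsMinimalUnkilled Y E τ := by
  obtain ⟨E₀, hE₀, σ₀, e₀, a₀, ha₀, hne₀⟩ := h
  obtain ⟨N₀, hN₀, hfg⟩ := exists_coherent_subsheaf e₀
  obtain ⟨e₁, rfl⟩ := N₀.exists_ι_eq hN₀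
  let E := N₀.obj
  have hE : Y E := hY.prop_of_injective N₀.ι N₀.ι_injective hE₀
  have hnoeth : ∀ σ, IsNoetherian (chart θ σ.1)ᵐᵒᵖ (sections E.obj σ) := fun σ =>
    N₀.isNoetherian_obj (hfg σ)
  have hne₁ : e₁ ◃ a₀ ≠ 0 := fun h0 => hne₀ (by rw [← map_act, h0, map_zero])
  -- The order is reversed in each component, so ascending chains become descending ones; over the
  -- finitely many cones, noetherianity makes this well-founded, and a minimal element is a largest
  -- subsheaf.
  let B : Set (∀ σ : Opens F, (Submodule (chart θ σ.1)ᵐᵒᵖ (sections E.obj σ))ᵒᵈ) :=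
    {M | ∃ K : Subsheaf E, K.mod = M ∧ ∃ (σ : Opens F) (e : sections E.obj σ),
      ∃ a ∈ killing Y σ, e ◃ a ∉ K.mod σ}
  have hB : B.Nonempty := ⟨_, kernelSubsheaf (𝟙 E), rfl, σ₀, e₁, a₀, ha₀, hne₁⟩
  obtain ⟨_, ⟨K, rfl, hK⟩, hmax⟩ := (wellFounded_lt (α := ∀ σ : Opens F,
    (Submodule (chart θ σ.1)ᵐᵒᵖ (sections E.obj σ))ᵒᵈ)).has_min B hB
  let T : Set (Opens F) := {τ | ∃ (e : sections K.quot.obj τ), ∃ a ∈ killing Y τ, e ◃ a ≠ 0}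
  have hT : T.Nonempty := by
    obtain ⟨σ, e, a, ha, hea⟩ := hK
    refine ⟨σ, onSections K.π σ e, a, ha, ?_⟩
    rwa [← map_act, Ne, Subsheaf.π_eq_zero_iff]
  obtain ⟨τ, hτ, hmin⟩ := T.toFinite.exists_minimal hT
  refine ⟨K.quot, τ, hY.prop_quot hE K, fun σ => ?_, hτ, ?_, ?_⟩
  · have := hnoeth σ
    exact isNoetherian_of_surjective (onSections K.π σ) (LinearMap.range_eq_top.2
      (K.π_surjective σ))
  · intro κ hκ hne e a ha
    by_contra hea
    exact hne (le_antisymm hκ (hmin ⟨e, a, ha, hea⟩ hκ))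
  · intro N σ x hx hx0 ρ e a ha
    set K' := kernelSubsheaf (K.π ≫ N.π)
    have hK' : ∀ ν (y : sections E.obj ν), y ∈ K'.mod ν ↔ onSections K.π ν y ∈ N.mod ν :=
      fun ν y => N.π_eq_zero_iff
    -- A nonzero subsheaf of the quotient pulls back to one strictly larger than `K`. By maximality
    -- the quotient by it is killed, that is, the products with the ideals lie in `N`.
    have hle : @LT.lt (∀ σ : Opens F, (Submodule (chart θ σ.1)ᵐᵒᵖ (sections E.obj σ))ᵒᵈ) _
        K'.mod K.mod := by
      refine lt_of_le_of_ne (fun ν => ?_) (fun heq => ?_)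
      · change K.mod ν ≤ K'.mod ν
        intro y hy
        rw [hK', K.π_eq_zero_iff.2 hy]; exact zero_mem _
      · obtain ⟨y, rfl⟩ := K.π_surjective σ x
        refine hx0 (K.π_eq_zero_iff.2 ?_)
        rw [← show K'.mod = K.mod from heq, hK']
        exact hx
    obtain ⟨e, rfl⟩ := K.π_surjective ρ e
    by_contra hea
    refine hmax _ ⟨K', rfl, ρ, e, a, ha, fun h1 => hea ?_⟩ hle
    rw [hK', map_act] at h1
    exact h1

namespace IsMinimalUnkilled

variable {E : Coh θ F} {τ : Opens F}

/-- Applied through the largest subsheaf with sections `M` over `ρ`. This is the form in which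
minimality is used: every nonzero submodule of `E_ρ` contains `E_ρ I_ρ`. -/
lemma mulIdeal_le_of_mem (H : IsMinimalUnkilled Y E τ) {ρ : Opens F}
    {M : Submodule (chart θ ρ.1)ᵐᵒᵖ (sections E.obj ρ)} {x : sections E.obj ρ} (hx : x ∈ M)
    (hx0 : x ≠ 0) : mulIdeal (sections E.obj ρ) (killing Y ρ) ≤ M := by
  rw [mulIdeal_le]
  intro e a ha
  have := H.subsheaf (extendFrom M) ρ x (by rwa [extendFrom_mod]) hx0 ρ e a ha
  rwa [extendFrom_mod] at this

/-- The kernel of the map from `E` to its direct image from `U[τ]` vanishes over `τ`. If it were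
nonzero it would contain all products with the ideals, including the nonzero ones over `τ`. -/
lemma res_inter_injective (H : IsMinimalUnkilled Y E τ) (ρ : Opens F) :
    Function.Injective (res (E := E.obj) (τ.inter_le_right ρ)) := by
  rw [injective_iff_map_eq_zero]
  intro x hx
  by_contra hx0
  obtain ⟨e, a, ha, hea⟩ := H.unkilled
  have h1 := H.subsheaf (kernelSubsheaf (toDirect E τ)) ρ x (by
    refine LinearMap.mem_ker.2 ((directSections E τ ρ).injective ?_)
    rw [directSections_toDirect, hx, map_zero]) hx0 τ e a ha
  exact hea (toDirect_injective E (le_refl τ) ((LinearMap.mem_ker.1 h1).trans (map_zero _).symm))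

lemma res_injective (H : IsMinimalUnkilled Y E τ) {ρ : Opens F} (h : τ ≤ ρ) :
    Function.Injective (res (E := E.obj) h) := fun x y hxy =>
  H.res_inter_injective ρ (by
    rw [← res_res h (τ.inter_le_left ρ), hxy, res_res])

/-- A Fitting argument. Let `s` be a power of the denominator of `κ` at which the annihilators have
stabilized. It kills the products with `I_τ`, as these vanish over `κ`. If `E_τ s` were nonzero it
would contain these products; one of them, `e a = z s ≠ 0`, would satisfy `z s^2 = 0`, which forces
`z s = 0`. -/
lemma eq_zero_of_lt (hY : IsClosedSubscheme Y) (H : IsMinimalUnkilled Y E τ) {κ : Opens F}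
    (h : κ ≤ τ) (hne : κ ≠ τ) (y : sections E.obj κ) : y = 0 := by
  have hs := fun k => (isNormalElement_den (θ := θ) h).pow k
  let J : ℕ → Submodule (chart θ τ.1)ᵐᵒᵖ (sections E.obj τ) := fun k => kerAct _ (hs k)
  have hJ : Monotone J := monotone_nat_of_le_succ fun k x hx => by
    rw [mem_kerAct] at hx ⊢
    rw [pow_succ, act_mul, hx, zero_act]
  obtain ⟨k, hk⟩ := monotone_stabilizes_iff_noetherian.2 (H.noetherian τ) ⟨J, hJ⟩
  have hJk : ∀ {x : sections E.obj τ}, res h x = 0 → x ◃ den θ h ^ k = 0 := fun {x} hx => by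
    obtain ⟨j, hj⟩ := exists_act_den_pow_eq_zero h hx
    have h1 : x ∈ J (k + j) := hj (k + j) (Nat.le_add_left _ _)
    have h2 : J k = J (k + j) := hk (k + j) (Nat.le_add_right _ _)
    rw [← h2] at h1
    exact h1
  obtain ⟨e, a, ha, hea⟩ := H.unkilled
  have hker : (e ◃ a) ◃ den θ h ^ k = 0 := hJk (by
    rw [res_act]
    exact H.killed κ h hne _ _ ((hY.mem_killing_iff h).2 (incl_mem_extendRight h ha)))
  have hzero : ∀ x : sections E.obj τ, x ◃ den θ h ^ k = 0 := fun x => by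
    by_contra hx
    have h1 := H.mulIdeal_le_of_mem (M := mapAct ⊤ (hs k)) ⟨x, Submodule.mem_top, rfl⟩ hx
      (act_mem_mulIdeal e ha)
    obtain ⟨z, -, hz⟩ := h1
    rw [← hz] at hker
    have h2 : z ◃ den θ h ^ k = 0 := hJk (res_eq_zero_of_act_den_pow h (k := k + k) (by
      rw [pow_add, act_mul, hker]))
    exact hea (hz.symm.trans h2)
  obtain ⟨j, hj⟩ := exists_act_den_pow_eq_res E h y
  obtain ⟨x, hx⟩ := hj j le_rfl
  refine act_den_pow_injective (θ := θ) h j ?_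
  rw [hx, res_eq_zero_of_act_den_pow h (hzero x), zero_act]

lemma exists_mulIdeal_ne_zero (hY : IsClosedSubscheme Y) (H : IsMinimalUnkilled Y E τ)
    {ρ : Opens F} (h : τ ≤ ρ) :
    ∃ x ∈ mulIdeal (sections E.obj ρ) (killing Y ρ), x ≠ 0 := by
  by_contra! hc
  obtain ⟨e, a, ha, hea⟩ := H.unkilled
  exact hea (act_incl_eq_zero h (fun e a ha => hc _ (act_mem_mulIdeal e ha)) e
    ((hY.mem_killing_iff h).1 ha))

/-- A monomial that is invertible over `U[τ]` acts on `E_ρ I_ρ` surjectively. -/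
lemma exists_act_mon_eq (hY : IsClosedSubscheme Y) (H : IsMinimalUnkilled Y E τ) {ρ : Opens F}
    (h : τ ≤ ρ) {q : Fin n → ℤ} (hq : charVec q ∈ dualCone ρ.1) (hq' : charVec (-q) ∈ dualCone τ.1)
    {z : sections E.obj ρ} (hz : z ∈ mulIdeal (sections E.obj ρ) (killing Y ρ)) :
    ∃ z' ∈ mulIdeal (sections E.obj ρ) (killing Y ρ), z' ◃ mon (θ := θ) ρ q hq = z := by
  obtain ⟨x, hx, hx0⟩ := H.exists_mulIdeal_ne_zero hY h
  -- The multiples of `E_ρ I_ρ` by the normal monomial form a submodule, nonzero because the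
  -- monomial is invertible over `τ` and restriction to `τ` is injective. By minimality it contains
  -- `E_ρ I_ρ`.
  refine H.mulIdeal_le_of_mem (M := mapAct (mulIdeal _ (killing Y ρ)) (isNormalElement_mon hq))
    ⟨x, hx, rfl⟩ (fun h0 => hx0 (H.res_injective h ?_)) hz
  obtain ⟨u, hu⟩ := isUnit_mon (θ := θ) (dualCone_anti h hq) hq'
  have h1 := congrArg (fun w => res h w ◃ (↑u⁻¹ : chart θ τ.1)) h0
  rw [map_zero, zero_act, res_act, incl_mon, ← act_mul, ← hu, Units.mul_inv, act_one] at h1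
  rw [h1, map_zero]

/-- A monomial that is not invertible over `U[τ]` kills `E_ρ I_ρ`. -/
lemma act_mon_eq_zero (hY : IsClosedSubscheme Y) (H : IsMinimalUnkilled Y E τ) {ρ : Opens F}
    (h : τ ≤ ρ) {q : Fin n → ℤ} (hq : charVec q ∈ dualCone ρ.1)
    (hq' : charVec (-q) ∉ dualCone τ.1)
    {z : sections E.obj ρ} (hz : z ∈ mulIdeal (sections E.obj ρ) (killing Y ρ)) :
    z ◃ mon (θ := θ) ρ q hq = 0 := by
  classical
  -- The monomial cuts out a proper face `κ` of `τ`, over which `E` is zero. A power of it is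
  -- divisible by a power of the denominator of `κ`, so it acts nilpotently on any given section.
  obtain ⟨κ, hκ, hcut⟩ := exists_face τ (dualCone_anti h hq)
  have hne : κ ≠ τ := fun hκτ => hq' (by rw [← hκτ]; exact hcut.neg_mem)
  obtain ⟨x, hx, hx0⟩ := H.exists_mulIdeal_ne_zero hY h
  obtain ⟨k, hk⟩ := exists_act_den_pow_eq_zero (x := res h x) hκ (H.eq_zero_of_lt hY hκ hne _)
  have hmem : charVec (-(k • cutter hκ)) ∈ dualCone (τ.1 ⊓ κ.1) := fun u hu => by
    have h1 := (isCutter_cutter hκ).neg_mem u hu.2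
    have h2 : charVec (-(k • cutter hκ)) = (k : ℝ) • charVec (-cutter hκ) := by
      ext i; simp [charVec]
    rw [h2, smul_dotProduct]
    exact mul_nonneg (Nat.cast_nonneg k) h1
  obtain ⟨N, hN⟩ := hcut.exists_add_mem (isRationalPolyhedral_of_mem τ) le_rfl hmem
  obtain ⟨b, hb⟩ := exists_mon_pow_mul_eq (θ := θ) (σ := τ) (isCutter_cutter hκ).mem_dual
    (dualCone_anti h hq) (hN N le_rfl)
  have hex : ∃ N, x ◃ mon (θ := θ) ρ q hq ^ N = 0 := ⟨N, H.res_injective h (by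
    rw [res_act, map_pow, incl_mon, ← hb, act_mul]
    change res h x ◃ den θ hκ ^ k ◃ b = _
    rw [hk k le_rfl, zero_act, map_zero])⟩
  have hpos : Nat.find hex ≠ 0 := fun h0 => hx0 (by
    have := Nat.find_spec hex
    rwa [h0, pow_zero, act_one] at this)
  -- The last nonzero multiple of `x` lies in the kernel of the monomial, which is a submodule by
  -- normality and so contains `E_ρ I_ρ`.
  refine H.mulIdeal_le_of_mem (M := kerAct _ (isNormalElement_mon hq))
    (x := x ◃ mon (θ := θ) ρ q hq ^ (Nat.find hex - 1)) ?_ (Nat.find_min hex (Nat.sub_one_lt hpos)) hz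
  rw [mem_kerAct, ← act_mul, ← pow_succ, Nat.sub_add_cancel (Nat.one_le_iff_ne_zero.2 hpos)]
  exact Nat.find_spec hex

/-- `E_ρ I_ρ` is simple under the monomials that are invertible over `U[τ]`. -/
lemma eq_bot_or_eq_top (hY : IsClosedSubscheme Y) (H : IsMinimalUnkilled Y E τ) {ρ : Opens F}
    (h : τ ≤ ρ) (U : AddSubgroup (mulIdeal (sections E.obj ρ) (killing Y ρ)))
    (hU : ∀ (q : Fin n → ℤ) (hq : charVec q ∈ dualCone ρ.1), charVec (-q) ∈ dualCone τ.1 →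
      ∀ (c : ℂ), ∀ z ∈ U, z ◃ (c • mon (θ := θ) ρ q hq) ∈ U) : U = ⊥ ∨ U = ⊤ := by
  -- A monomial not invertible over `τ` acts as zero, so stability under the others already makes
  -- `U` a submodule, to which minimality applies.
  have hact : ∀ (a : chart θ ρ.1), ∀ z ∈ U, z ◃ a ∈ U := fun a z hz => by
    suffices ∃ ha : a.1 ∈ chart θ ρ.1, z ◃ (⟨a.1, ha⟩ : chart θ ρ.1) ∈ U by
      obtain ⟨_, h1⟩ := this
      exact h1
    refine chart_induction a.2 (fun m hm c => ⟨term_mem_chart hm c, ?_⟩) ?_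
    · have h1 : (⟨QuantumLaurent.term m c, term_mem_chart hm c⟩ : chart θ ρ.1) = c • mon (θ := θ) ρ m hm :=
        Subtype.ext (by
          change _ = c • (QuantumLaurent.term m 1 : QuantumLaurent θ)
          rw [QuantumLaurent.smul_term, mul_one])
      rw [h1]
      by_cases hm' : charVec (-m) ∈ dualCone τ.1
      · exact hU m hm hm' c z hz
      · have h2 : z ◃ (c • mon (θ := θ) ρ m hm) = 0 := by
          rw [Algebra.smul_def, act_mul]
          refine Subtype.ext ?_
          exact H.act_mon_eq_zero hY h hm hm' (z ◃ algebraMap ℂ (chart θ ρ.1) c).2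
        rw [h2]
        exact U.zero_mem
    · rintro f g ⟨hf, hf'⟩ ⟨hg, hg'⟩
      refine ⟨add_mem hf hg, ?_⟩
      have h1 : (⟨f + g, add_mem hf hg⟩ : chart θ ρ.1) = ⟨f, hf⟩ + ⟨g, hg⟩ := rfl
      rw [h1, act_add]
      exact U.add_mem hf' hg'
  let U' : Submodule (chart θ ρ.1)ᵐᵒᵖ (mulIdeal (sections E.obj ρ) (killing Y ρ)) :=
    { U with smul_mem' := fun a z hz => hact a.unop z hz }
  by_cases hbot : ∃ z ∈ U, z ≠ 0
  · right
    obtain ⟨z, hz, hz0⟩ := hbot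
    rw [eq_top_iff]
    rintro w -
    have h1 := H.mulIdeal_le_of_mem (M := U'.map (Submodule.subtype _)) (x := z.1)
      ⟨z, hz, rfl⟩ (fun h0 => hz0 (Subtype.ext h0)) w.2
    obtain ⟨w', hw', hww'⟩ := h1
    rwa [← show w' = w from Subtype.ext hww']
  · left
    push Not at hbot
    rw [eq_bot_iff]
    exact fun z hz => hbot z hz

/-- Products of sections over `U[τ]` with the ideal come from larger open sets. -/
lemma exists_act_eq_res_of_mem (hY : IsClosedSubscheme Y) (H : IsMinimalUnkilled Y E τ)
    {ρ : Opens F} (h : τ ≤ ρ) (y : sections E.obj τ) {a : chart θ τ.1} (ha : a ∈ killing Y τ) :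
    ∃ z ∈ mulIdeal (sections E.obj ρ) (killing Y ρ), y ◃ a = res h z := by
  obtain ⟨k, hk⟩ := exists_act_den_pow_eq_res E h y
  obtain ⟨x, hx⟩ := hk k le_rfl
  obtain ⟨u, hu, -⟩ := isUnit_den_pow (θ := θ) h k
  have h1 : u * a ∈ extendRight h (killing Y ρ) :=
    (hY.mem_killing_iff h).1 (TwoSidedIdeal.mul_mem_left _ _ _ ha)
  obtain ⟨j, b, hb, hab⟩ := exists_mul_den_pow_eq_of_mem_extendRight h h1
  -- With `y = x d^{-k}` and `d^{-k} a = b d^{-j}`, one has `y a = (x b) d^{-j}`, where `d` is the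
  -- denominator of `τ` in `ρ`. It remains to divide by `d^j` inside `E_ρ I_ρ`, where `d` acts
  -- surjectively.
  have hdiv : ∀ j, ∀ z ∈ mulIdeal (sections E.obj ρ) (killing Y ρ),
      ∃ z' ∈ mulIdeal (sections E.obj ρ) (killing Y ρ), z' ◃ den θ h ^ j = z := fun j => by
    induction j with
    | zero => exact fun z hz => ⟨z, hz, by rw [pow_zero, act_one]⟩
    | succ j ih =>
      intro z hz
      obtain ⟨z', hz', h1⟩ := H.exists_act_mon_eq hY h (isCutter_cutter h).mem_dual
        (isCutter_cutter h).neg_mem hz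
      obtain ⟨z'', hz'', h2⟩ := ih z' hz'
      exact ⟨z'', hz'', by rw [pow_succ, act_mul, h2]; exact h1⟩
  obtain ⟨z, hz, hz'⟩ := hdiv j (x ◃ b) (act_mem_mulIdeal x hb)
  refine ⟨z, hz, act_den_pow_injective (θ := θ) h j ?_⟩
  rw [← map_pow (incl h) (den θ h) j, ← res_act, hz', res_act, ← hab, ← hx, ← act_mul, ← act_mul,
    map_pow, ← mul_assoc, ← mul_assoc, hu, one_mul]

/-- Division by the denominator modulo the part killed by `I_τ`. A section is known modulo that part
through its products with homogeneous generators `a_i`; these products lie in the simple object `E_ρ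
I_ρ`, so divisibility of the tuple follows from the lemma on diagonal operators. -/
lemma exists_sub_act_den_act_eq_zero (hY : IsClosedSubscheme Y) (H : IsMinimalUnkilled Y E τ)
    {ρ : Opens F} (h : τ ≤ ρ) (x : sections E.obj ρ) :
    ∃ x' : sections E.obj ρ, ∀ a ∈ killing Y τ, res h (x - x' ◃ den θ h) ◃ a = 0 := by
  obtain ⟨r, a, haI, hom, hspan⟩ := exists_homogeneous_generators (killing Y τ)
  let T := {q : Fin n → ℤ // charVec q ∈ dualCone ρ.1 ∧ charVec (-q) ∈ dualCone τ.1} × ℂ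
  choose χ hχ0 hχ using fun i (q : {q : Fin n → ℤ // charVec q ∈ dualCone ρ.1 ∧
    charVec (-q) ∈ dualCone τ.1}) => hom i q.1 (dualCone_anti h q.2.1) q.2.2
  -- The factor `χ i` compensates for moving the monomial past `a i`, so multiplying `x` by one
  -- scalar multiple of a monomial becomes a diagonal operator on the tuple `(x a_i)`.
  let R : T → Fin r → mulIdeal (sections E.obj ρ) (killing Y ρ) →+
      mulIdeal (sections E.obj ρ) (killing Y ρ) := fun t i =>
    AddMonoidHom.mk' (fun z => z ◃ ((t.2 * χ i t.1) • mon (θ := θ) ρ t.1.1 t.1.2.1))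
      (fun z z' => add_act z z' _)
  let W : AddSubgroup (Fin r → mulIdeal (sections E.obj ρ) (killing Y ρ)) :=
    { carrier := {w | ∃ x : sections E.obj ρ, ∀ i, res h (w i).1 = res h x ◃ a i}
      add_mem' := by
        rintro w w' ⟨x, hx⟩ ⟨x', hx'⟩
        refine ⟨x + x', fun i => ?_⟩
        rw [map_add, add_act, ← hx, ← hx', ← map_add]
        rfl
      zero_mem' := ⟨0, fun i => by rw [map_zero, zero_act]; exact map_zero _⟩
      neg_mem' := by
        rintro w ⟨x, hx⟩
        refine ⟨-x, fun i => ?_⟩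
        rw [map_neg, neg_act, ← hx, ← map_neg]
        rfl }
  let m : T := (⟨cutter h, (isCutter_cutter h).mem_dual, (isCutter_cutter h).neg_mem⟩, 1)
  have hcomm : ∀ (t : T) i, incl h (t.2 • mon (θ := θ) ρ t.1.1 t.1.2.1) * a i =
      a i * incl h ((t.2 * χ i t.1) • mon (θ := θ) ρ t.1.1 t.1.2.1) := fun t i => by
    rw [map_smul, map_smul, incl_mon, smul_mul_assoc, hχ, mul_smul_comm, smul_smul]
  have hR : ∀ (t : T) i (z : mulIdeal (sections E.obj ρ) (killing Y ρ)) (x : sections E.obj ρ),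
      res h z.1 = res h x ◃ a i →
      res h (R t i z).1 = res h (x ◃ (t.2 • mon (θ := θ) ρ t.1.1 t.1.2.1)) ◃ a i := fun t i z x hz => by
    change res h (z.1 ◃ ((t.2 * χ i t.1) • mon (θ := θ) ρ t.1.1 t.1.2.1)) = _
    rw [res_act, hz, res_act, ← act_mul, ← act_mul, hcomm]
  have hmem : ∀ i, ∃ z ∈ mulIdeal (sections E.obj ρ) (killing Y ρ), res h x ◃ a i = res h z :=
    fun i => H.exists_act_eq_res_of_mem hY h _ (haI i)
  choose w hw hxw using hmem
  -- Since each `χ i` is nonzero, every scalar multiple of the monomial occurs among the operators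
  -- on the `i`-th factor; this is what its simplicity requires.
  obtain ⟨w', ⟨x', hx'⟩, hww'⟩ := exists_eq_diagonal_of_mem m r R (fun i U hU => by
      refine H.eq_bot_or_eq_top hY h U fun q hq hq' c z hz => ?_
      have h1 := hU (⟨q, hq, hq'⟩, c / χ i ⟨q, hq, hq'⟩) z hz
      change z ◃ ((c / χ i ⟨q, hq, hq'⟩ * χ i ⟨q, hq, hq'⟩) • mon (θ := θ) ρ q hq) ∈ U at h1
      rwa [div_mul_cancel₀ _ (hχ0 _ _)] at h1)
    (fun i z => by
      obtain ⟨z', hz', h1⟩ := H.exists_act_mon_eq hY h m.1.2.1 m.1.2.2 z.2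
      refine ⟨⟨z', hz'⟩ ◃ algebraMap ℂ (chart θ ρ.1) (1 * χ i m.1)⁻¹, Subtype.ext ?_⟩
      change z' ◃ algebraMap ℂ (chart θ ρ.1) (1 * χ i m.1)⁻¹ ◃
        ((1 * χ i m.1) • mon (θ := θ) ρ m.1.1 m.1.2.1) = z.1
      rw [← act_mul, ← Algebra.smul_def, smul_smul, inv_mul_cancel₀ (by
        rw [one_mul]; exact hχ0 i m.1), one_smul, h1])
    W (by
      rintro t v ⟨y, hy⟩
      exact ⟨_, fun i => hR t i (v i) y (hy i)⟩)
    (fun i => ⟨w i, hw i⟩) ⟨x, fun i => (hxw i).symm⟩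
  refine ⟨x', fun b hb => ?_⟩
  have hgen : ∀ i, res h (x - x' ◃ den θ h) ◃ a i = 0 := fun i => by
    have h1 : res h (w i) = res h (R m i (w' i)).1 :=
      congrArg (fun v => res h (v i).1) hww'
    rw [hR m i _ x' (hx' i), ← hxw] at h1
    rw [map_sub, sub_act, h1]
    change _ ◃ a i - res h (x' ◃ mon (θ := θ) ρ (cutter h) (isCutter_cutter h).mem_dual) ◃ a i = 0
    rw [show m.2 = 1 from rfl, one_smul, sub_self]
  have hb' := hspan b hb
  clear hb
  induction hb' using Submodule.span_induction with
  | mem c hc => obtain ⟨i, rfl⟩ := hc; exact hgen i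
  | zero => rw [act_zero]
  | add c c' _ _ hc hc' => rw [act_add, hc, hc', add_zero]
  | smul c c' _ hc =>
    have h1 : res h (x - x' ◃ den θ h) ◃ (c' * c.unop) = 0 := by rw [act_mul, hc, zero_act]
    exact h1

/-- The sections over `U[τ]` come from larger open sets, up to sections killed by the ideal. -/
lemma exists_sub_res_act_eq_zero (hY : IsClosedSubscheme Y) (H : IsMinimalUnkilled Y E τ)
    {ρ : Opens F} (h : τ ≤ ρ) (y : sections E.obj τ) :
    ∃ x : sections E.obj ρ, ∀ a ∈ killing Y τ, (y - res h x) ◃ a = 0 := by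
  -- Iterating the division is legitimate because the error at each stage, multiplied by a further
  -- denominator, is still killed by the two-sided ideal `I_τ`.
  have key : ∀ (k : ℕ) (x : sections E.obj ρ), ∃ x' : sections E.obj ρ,
      ∀ a ∈ killing Y τ, res h (x - x' ◃ den θ h ^ k) ◃ a = 0 := fun k => by
    induction k with
    | zero => exact fun x => ⟨x, fun a _ => by
        rw [pow_zero, act_one, sub_self, map_zero, zero_act]⟩
    | succ k ih =>
      intro x
      obtain ⟨x₁, h₁⟩ := H.exists_sub_act_den_act_eq_zero hY h x
      obtain ⟨x₂, h₂⟩ := ih x₁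
      refine ⟨x₂, fun a ha => ?_⟩
      have h3 : x - x₂ ◃ den θ h ^ (k + 1) =
          (x - x₁ ◃ den θ h) + (x₁ - x₂ ◃ den θ h ^ k) ◃ den θ h := by
        rw [sub_act, pow_succ, act_mul]; abel
      rw [h3, map_add, add_act, h₁ a ha, res_act, ← act_mul,
        h₂ _ (TwoSidedIdeal.mul_mem_left _ _ _ ha), add_zero]
  obtain ⟨k, hk⟩ := exists_act_den_pow_eq_res E h y
  obtain ⟨x, hx⟩ := hk k le_rfl
  obtain ⟨x', hx'⟩ := key k x
  obtain ⟨u, hu, -⟩ := isUnit_den_pow (θ := θ) h k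
  refine ⟨x', fun a ha => ?_⟩
  have h1 := hx' (u * a) (TwoSidedIdeal.mul_mem_left _ _ _ ha)
  rwa [map_sub, ← hx, res_act, map_pow, ← sub_act, ← act_mul, ← mul_assoc, hu, one_mul] at h1

/-- The direct image of `E` from `U[τ]` is generated by the image of `E` and the direct image of the
killed part `G`, both members. It is then a member, so the ideal kills `E_τ`, contrary to the choice
of `τ`. -/
lemma not_isClosedSubscheme (H : IsMinimalUnkilled Y E τ) : ¬ IsClosedSubscheme Y := fun hY => by
  let G : Subsheaf E := extendFrom (killedBy (sections E.obj τ) (killing Y τ))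
  have hGmod : G.mod τ = killedBy (sections E.obj τ) (killing Y τ) := extendFrom_mod _
  have hG : Y (direct G.obj τ) := hY.prop_direct_iff.2 fun x a ha => by
    apply G.ι_injective τ
    have h1 := G.ι_mem τ x
    rw [hGmod] at h1
    rw [map_act, map_zero, h1 a ha]
  obtain ⟨e, a, ha, hea⟩ := H.unkilled
  refine hea (hY.prop_direct_iff.1 (hY.prop_of_generated fun N hN ρ x => ?_) e a ha)
  -- If `ρ` contains `τ`, the section is a restriction from `ρ` plus a killed section. Otherwise `τ
  -- ∩ ρ` is a proper face of `τ`, over which `E` is zero.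
  by_cases hτ : τ ≤ ρ
  · set z := res (le_inter le_rfl hτ) (directSections E τ ρ x) with hz
    have hzx : res (τ.inter_le_left ρ) z = directSections E τ ρ x := by
      rw [hz, res_res, res_refl]
    obtain ⟨x₀, hx₀⟩ := H.exists_sub_res_act_eq_zero hY hτ z
    obtain ⟨g, hg⟩ := G.exists_ι_eq (σ := τ) (e := z - res hτ x₀) (by rw [hGmod]; exact hx₀)
    have h1 := hN E H.mem (toDirect E τ) ρ x₀
    have h2 := hN _ hG (directMap (onSections G.ι τ)) ρ
      ((directSections G.obj τ ρ).symm (res (τ.inter_le_left ρ) g))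
    convert add_mem h1 h2 using 1
    apply (directSections E τ ρ).injective
    rw [map_add, directSections_toDirect, directSections_directMap, AddEquiv.apply_symm_apply,
      loc_res, hg, map_sub, hzx, res_res, add_sub_cancel]
  · have h1 : directSections E τ ρ x = 0 := H.eq_zero_of_lt hY (τ.inter_le_left ρ)
      (fun h => hτ (h ▸ τ.inter_le_right ρ)) _
    rw [(map_eq_zero_iff _ (directSections E τ ρ).injective).1 h1]
    exact zero_mem _

end IsMinimalUnkilled

/-- Every closed subscheme is the subscheme of its ideal sheaf. -/
lemma IsClosedSubscheme.subscheme_idealSheaf (hY : IsClosedSubscheme Y) :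
    hY.idealSheaf.subscheme = Y := by
  refine le_antisymm hY.subscheme_idealSheaf_le fun E hE σ e a ha => ?_
  by_contra hea
  obtain ⟨_, _, H⟩ := hY.exists_isMinimalUnkilled ⟨E, hE, σ, e, a, ha, hea⟩
  exact H.not_isClosedSubscheme hY

end NCToric

/-! ### Ideal sheaves define closed subschemes and are determined by them -/

namespace NCToric

variable {n : ℕ} {θ : Matrix (Fin n) (Fin n) ℂ} {F : Fan n}

/-! ## The subscheme of an ideal sheaf -/

namespace IdealSheaf

variable (I : IdealSheaf θ F)

/-- The subsheaf `E I` of `E`. -/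
def mulSubsheaf (E : Coh θ F) : Subsheaf E where
  mod σ := mulIdeal (sections E.obj σ) (I.ideal σ)
  res_mem {τ σ} h x hx := by
    induction hx using Submodule.span_induction with
    | mem x hx =>
      obtain ⟨e, a, ha, rfl⟩ := hx
      rw [res_act]
      exact act_mem_mulIdeal _ (I.restrict_mem τ σ h a ha)
    | zero => rw [map_zero]; exact zero_mem _
    | add x y _ _ hx hy => rw [map_add]; exact add_mem hx hy
    | smul b x _ hx =>
      have h1 : res h (x ◃ b.unop) ∈ mulIdeal (sections E.obj τ) (I.ideal τ) := by
        rw [res_act]; exact act_mem hx _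
      exact h1
  exists_res {τ σ} h y hy := by
    have h1 : y ∈ Submodule.span (chart θ τ.1)ᵐᵒᵖ
        (res h '' (mulIdeal (sections E.obj σ) (I.ideal σ) : Set (sections E.obj σ))) := by
      refine mulIdeal_le.2 (fun e a ha => ?_) hy
      obtain ⟨j, hj⟩ := exists_act_den_pow_eq_res E h e
      obtain ⟨x, hx⟩ := hj j le_rfl
      obtain ⟨u, hu, -⟩ := isUnit_den_pow (θ := θ) h j
      -- The section is `e a` with `e` a restricted section times `u`; coherence is applied to `u
      -- a`, which lies in the ideal because the ideal is two-sided.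
      obtain ⟨k, b, hb, hab⟩ := I.isCoherent_iff.1 I.coherent τ σ h (u * a)
        (TwoSidedIdeal.mul_mem_left _ _ _ ha)
      refine mem_of_act_den_pow_mem h k (Submodule.subset_span
        ⟨x ◃ b, act_mem_mulIdeal x hb, ?_⟩)
      rw [res_act, ← hx, ← hab, ← act_mul, ← act_mul, ← mul_assoc, ← mul_assoc, hu, one_mul]
    obtain ⟨k, hk⟩ := exists_res_of_mem_span h h1
    obtain ⟨x, hx, hxy⟩ := hk k le_rfl
    exact ⟨k, x, hx, hxy⟩

lemma subscheme_quot (E : Coh θ F) : I.subscheme (I.mulSubsheaf E).quot := fun σ e a ha => by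
  obtain ⟨x, rfl⟩ := (I.mulSubsheaf E).π_surjective σ e
  rw [rightMul_eq_act, ← map_act, Subsheaf.π_eq_zero_iff]
  exact act_mem_mulIdeal x ha

lemma onSections_eq_zero_of_mem {E E' : Coh θ F} (hE' : I.subscheme E') (f : E ⟶ E')
    (σ : Opens F) : ∀ x ∈ (I.mulSubsheaf E).mod σ, onSections f σ x = 0 := by
  have : (I.mulSubsheaf E).mod σ ≤ LinearMap.ker (onSections f σ) := mulIdeal_le.2 fun e a ha =>
    LinearMap.mem_ker.2 (by rw [map_act]; exact hE' σ _ a ha)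
  exact fun x hx => LinearMap.mem_ker.1 (this hx)

/-- The largest subsheaf killed by the ideal sheaf. -/
def killedSubsheaf (E : Coh θ F) : Subsheaf E :=
  Subsheaf.sSup {N | ∀ σ, ∀ x ∈ N.mod σ, ∀ a ∈ I.ideal σ, x ◃ a = 0}

lemma subscheme_killedSubsheaf (E : Coh θ F) : I.subscheme (I.killedSubsheaf E).obj :=
  fun σ e a ha => by
    have h1 : (I.killedSubsheaf E).mod σ ≤ killedBy (sections E.obj σ) (I.ideal σ) :=
      iSup₂_le fun N hN x hx => hN σ x hx
    apply (I.killedSubsheaf E).ι_injective σ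
    rw [rightMul_eq_act, map_act, map_zero]
    exact h1 ((I.killedSubsheaf E).ι_mem σ e) a ha

/-- The image of a killed sheaf is a killed subsheaf, hence one of the summands; this gives the
universal property behind the right adjoint. -/
lemma onSections_mem_killedSubsheaf {E E' : Coh θ F} (hE : I.subscheme E) (f : E ⟶ E')
    (σ : Opens F) (x : sections E.obj σ) : onSections f σ x ∈ (I.killedSubsheaf E').mod σ := by
  have h1 : imageSubsheaf f ∈
      {N : Subsheaf E' | ∀ σ, ∀ x ∈ N.mod σ, ∀ a ∈ I.ideal σ, x ◃ a = 0} := by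
    rintro σ _ ⟨x, rfl⟩ a ha
    rw [← map_act, show x ◃ a = 0 from hE σ x a ha, map_zero]
  exact (le_iSup₂ (f := fun (N : Subsheaf E') (_ : N ∈ {N : Subsheaf E' | ∀ σ, ∀ x ∈ N.mod σ,
    ∀ a ∈ I.ideal σ, x ◃ a = 0}) => N.mod σ) (imageSubsheaf f) h1) ⟨x, rfl⟩

lemma isRightAdjoint_subscheme_ι : I.subscheme.ι.IsRightAdjoint :=
  (Adjunction.adjunctionOfEquivLeft (G := I.subscheme.ι)
    (F_obj := fun E => (⟨(I.mulSubsheaf E).quot, I.subscheme_quot E⟩ : I.subscheme.FullSubcategory))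
    (fun E E' =>
      { toFun := fun f => (I.mulSubsheaf E).π ≫ f.hom
        invFun := fun g => ObjectProperty.homMk ((I.mulSubsheaf E).desc g
          (I.onSections_eq_zero_of_mem E'.property g))
        left_inv := fun _ => ObjectProperty.hom_ext _ (hom_ext_sections fun σ x => by
          obtain ⟨x, rfl⟩ := (I.mulSubsheaf E).π_surjective σ x
          rfl)
        right_inv := fun g => (I.mulSubsheaf E).π_desc g _ })
    (fun _ _ _ _ _ => rfl)).isRightAdjoint

lemma isLeftAdjoint_subscheme_ι : I.subscheme.ι.IsLeftAdjoint :=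
  (Adjunction.adjunctionOfEquivRight (F := I.subscheme.ι)
    (G_obj := fun E => (⟨(I.killedSubsheaf E).obj, I.subscheme_killedSubsheaf E⟩ :
      I.subscheme.FullSubcategory))
    (fun E' E =>
      { toFun := fun g => ObjectProperty.homMk ((I.killedSubsheaf E).lift g
          (I.onSections_mem_killedSubsheaf E'.property g))
        invFun := fun f => f.hom ≫ (I.killedSubsheaf E).ι
        left_inv := fun g => (I.killedSubsheaf E).lift_ι g _
        right_inv := fun _ => ObjectProperty.hom_ext _ (hom_ext_sections fun σ _ =>
          (I.killedSubsheaf E).ι_injective σ rfl) })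
    (fun _ _ _ _ _ => rfl)).isLeftAdjoint

/-- The subscheme of an ideal sheaf is closed. -/
lemma isClosedSubscheme : IsClosedSubscheme I.subscheme where
  subobjects := ⟨fun {E E'} f _ hE' σ e a ha => injective_of_mono f σ (by
    rw [rightMul_eq_act, map_act, map_zero]
    exact hE' σ _ a ha)⟩
  exists_rightAdjoint := I.isLeftAdjoint_subscheme_ι
  exists_leftAdjoint := I.isRightAdjoint_subscheme_ι

variable {I} in
-- Tested on the quotient of the structure sheaf by `I`: if `a ∈ J_σ` kills the class of `1`, then
-- `a ∈ I_σ`.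
lemma ideal_le_of_subscheme_le {J : IdealSheaf θ F} (h : I.subscheme ≤ J.subscheme) (σ : Opens F) :
    J.ideal σ ≤ I.ideal σ := fun a ha => by
  have h1 := h _ (I.subscheme_quot (unit θ F)) σ
    (onSections (I.mulSubsheaf (unit θ F)).π σ ((unitSections σ).symm 1)) a ha
  rw [rightMul_eq_act, ← map_act, Subsheaf.π_eq_zero_iff] at h1
  have h2 : mulIdeal (sections (unit θ F).obj σ) (I.ideal σ) ≤
      (rightIdeal (I.ideal σ)).comap (unitSections σ).toLinearMap := mulIdeal_le.2 fun e b hb => by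
    change unitSections σ (e ◃ b) ∈ I.ideal σ
    rw [unitSections_act]
    exact TwoSidedIdeal.mul_mem_left _ _ _ hb
  have h3 : unitSections σ ((unitSections σ).symm 1 ◃ a) ∈ I.ideal σ := h2 h1
  rwa [unitSections_act, LinearEquiv.apply_symm_apply, one_mul] at h3

lemma subscheme_injective :
    Function.Injective (fun I : IdealSheaf θ F => I.subscheme) := fun I J h => by
  have h1 : I.toSubsheafOfIdeals = J.toSubsheafOfIdeals :=
    SubsheafOfIdeals.ext (funext fun σ => le_antisymm
      (ideal_le_of_subscheme_le (le_of_eq h.symm) σ) (ideal_le_of_subscheme_le (le_of_eq h) σ))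
  cases I
  cases J
  cases h1
  rfl

end IdealSheaf

end NCToric

end

/-- Ideal sheaves on a noncommutative toric variety that agree on overlaps correspond bijectively to
closed subschemes, where `I` corresponds to the category of sheaves of right `𝒪/I`-modules. -/
theorem mainTheorem9 (n : ℕ) (θ : Matrix (Fin n) (Fin n) ℂ) (hθ : θ.transpose = -θ)
    (F : NCToric.Fan n) :
    Set.BijOn (fun I : NCToric.IdealSheaf θ F => I.subscheme)
      {I | I.AgreesOnOverlaps}
      {Y : CategoryTheory.ObjectProperty (NCToric.Coh θ F) | NCToric.IsClosedSubscheme Y} := by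
  refine ⟨fun I _ => I.isClosedSubscheme, NCToric.IdealSheaf.subscheme_injective.injOn, fun Y hY => ?_⟩
  exact ⟨hY.idealSheaf, hY.agreesOnOverlaps_idealSheaf, hY.subscheme_idealSheaf⟩
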